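/- **Conventions.** Let $\kappa\colon[0,\infty)\to[0,\infty)$ be increasing, concave and sublinear ($\kappa(t)/t\to 0$). Let $G$ be a finitely generated group acting geometrically (isometrically, properly, cocompactly) on a geodesic metric space $Y$ with base point $o$ (for instance a Cayley graph with $o=e$). Quasi-geodesics need not be continuous. Write $\mathcal N_\kappa(Z,n)=\{y\in Y: d(y,Z)\le n\,\kappa(d(o,y))\}$. A *Morse gauge* for $Z\subseteq Y$ is a function $N\colon[1,\infty)\times[0,\infty)\to[0,\infty)$ such that every $(K,C)$-quasi-geodesic segment with end points on $Z$ lies in $\mathcal N_\kappa(Z,N(K,C))$; a quasi-geodesic ray is $\kappa$-Morse if its image has a Morse gauge. Two rays are $\kappa$-close if each lies in some $\mathcal N_\kappa(\cdot,n)$ of the other. Let $\partial_\kappa G=\partial_\kappa Y$ be the set of $\kappa$-Morse quasi-geodesic rays modulo $\kappa$-closeness, and let $\partial^N_{e,\kappa}G$ be the set of classes of $\kappa$-Morse quasi-geodesic rays starting at $o$ with Morse gauge $N$. Let $T_\infty$ be the tree (edges of length $1$) all of whose vertices have countably infinite degree, and $\partial_\infty T_\infty$ its boundary at infinity (equivalence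 classes of sequences converging to infinity, defined by Gromov products) with the visual topology. Suppose $G$ acts coboundedly by isometries on $T_\infty$, and let $p\colon Y\to T_\infty$ be a coarsely Lipschitz, coarsely $G$-equivariant map (it is unique up to bounded distance). A map $\gamma\colon[0,\infty)\to T_\infty$ *defines* $\xi\in\partial_\infty T_\infty$ if $(\gamma(t_i))_i$ converges to infinity and lies in $\xi$ whenever $t_1\le t_2\le\dots$ and $t_i\to\infty$. The pair $(G,T_\infty)$ is *$\kappa$-injective* if for every $\kappa$-Morse quasi-geodesic ray $\gamma$ in $Y$ the map $p\circ\gamma$ defines a point of $\partial_\infty T_\infty$, and two such rays are $\kappa$-close if and only if their images define the same point. Then $[\gamma]\mapsto[p\circ\gamma]$ is a well-defined injection $\partial p\colon\partial_\kappa G\hookrightarrow\partial_\infty T_\infty$; let $\mathcal T(G,T_\infty)$ be the topology on $\partial_\kappa G$ pulled back by $\partial p$. A *strongly entwined filling chain* is a sequence $T_1\subset T_2\subset\dots\subset T_\infty$ of (non-empty) subtrees in which every vertex of $T_i$ has finite degree at least three in $T_i$ and strictly larger degree in $T_{i+1}$, and such that every edge of $T_\infty$ lies in some $T_i$. A *Cantor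 chain* is a topological space homeomorphic to the subspace $\bigcup_i\partial_\infty T_i\subset\partial_\infty T_\infty$ for some strongly entwined filling chain $(T_i)$. **Theorem.** Suppose $(G,T_\infty)$ is $\kappa$-injective. For a Morse gauge $N$ let $T_{N,\kappa}$ be the convex hull of $\partial p(\partial^N_{e,\kappa}G)$ in $T_\infty$, that is, the union of all bi-infinite geodesics with both end points in $\partial p(\partial^N_{e,\kappa}G)$. Suppose there are Morse gauges $N_1\le N_2\le\dots$ such that $T_{N_1,\kappa}\subset T_{N_2,\kappa}\subset\dots$ is a strongly entwined filling chain and $\bigcup_i\partial^{N_i}_{e,\kappa}G=\partial_\kappa G$. Then $\partial_\kappa G$ with the topology $\mathcal T(G,T_\infty)$ is a Cantor chain. -/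

import Mathlib

open Filter Topology Set
open scoped NNReal

namespace CantorChain

/-! ### Gromov products and the boundary at infinity -/

section Boundary

variable {X : Type*} [MetricSpace X]

/-- The Gromov product `(x ∣ y)_o`. -/
noncomputable def gromovProduct (o x y : X) : ℝ :=
  (dist o x + dist o y - dist x y) / 2

/-- The sequence `x` converges to infinity. In every metric space this does not depend on `o`. -/
def ConvergesToInfinity (x : ℕ → X) : Prop :=
  ∀ o : X, Tendsto (fun ij : ℕ × ℕ => gromovProduct o (x ij.1) (x ij.2)) atTop atTop

variable (X) in
/-- The sequences in `X` that converge to infinity. -/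
abbrev InfSeq : Type _ := {x : ℕ → X // ConvergesToInfinity x}

/-- Equivalence of sequences converging to infinity. -/
def InfSeq.Equivalent (x y : InfSeq X) : Prop :=
  ∀ o : X, Tendsto (fun i : ℕ => gromovProduct o (x.1 i) (y.1 i)) atTop atTop

variable (X) in
/-- The boundary at infinity: equivalence classes of sequences that converge to infinity. -/
def GromovBoundary : Type _ := Quot (InfSeq.Equivalent (X := X))

/-- The sequence `x` converges to infinity and its class is `ξ`. -/
def Represents (x : ℕ → X) (ξ : GromovBoundary X) : Prop :=
  ∃ h : ConvergesToInfinity x, (Quot.mk _ ⟨x, h⟩ : GromovBoundary X) = ξ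

/-- The Gromov product of two boundary points, with values in the extended reals. -/
noncomputable def boundaryProduct (o : X) (ξ η : GromovBoundary X) : EReal :=
  ⨅ (x : ℕ → X) (_ : Represents x ξ) (y : ℕ → X) (_ : Represents y η),
    liminf (fun i : ℕ => ((gromovProduct o (x i) (y i) : ℝ) : EReal)) atTop

/-- The visual topology: the sets `{η | R < (ξ ∣ η)_o}`, `R ≥ 0`, are the basic neighbourhoods
of `ξ`. In hyperbolic spaces they give the same topology for every `o`. -/
instance visualTopology : TopologicalSpace (GromovBoundary X) where
  IsOpen U := ∀ ξ ∈ U, ∀ o : X, ∃ R : ℝ, 0 ≤ R ∧ {η | (R : EReal) < boundaryProduct o ξ η} ⊆ U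
  isOpen_univ := fun _ _ _ => ⟨0, le_rfl, subset_univ _⟩
  isOpen_inter := by
    intro U W hU hW ξ hξ o
    obtain ⟨R, hR, hRU⟩ := hU ξ hξ.1 o
    obtain ⟨Q, hQ, hQW⟩ := hW ξ hξ.2 o
    refine ⟨max R Q, le_max_of_le_left hR, fun η hη => ⟨hRU ?_, hQW ?_⟩⟩
    · exact lt_of_le_of_lt (EReal.coe_le_coe_iff.2 (le_max_left R Q)) hη
    · exact lt_of_le_of_lt (EReal.coe_le_coe_iff.2 (le_max_right R Q)) hη
  isOpen_sUnion := by
    intro 𝒰 h𝒰 ξ ⟨U, hU, hξ⟩ o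
    obtain ⟨R, hR, hRU⟩ := h𝒰 U hU ξ hξ o
    exact ⟨R, hR, hRU.trans (subset_sUnion_of_mem hU)⟩

/-- The (not necessarily continuous) map `γ : [0, ∞) → X` defines the point `ξ` at infinity:
along every increasing sequence of times tending to infinity it gives a sequence of class `ξ`. -/
def DefinesPoint (γ : ℝ≥0 → X) (ξ : GromovBoundary X) : Prop :=
  ∀ t : ℕ → ℝ≥0, Monotone t → Tendsto t atTop atTop → Represents (fun i => γ (t i)) ξ

theorem DefinesPoint.unique {γ : ℝ≥0 → X} {ξ η : GromovBoundary X}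
    (hξ : DefinesPoint γ ξ) (hη : DefinesPoint γ η) : ξ = η := by
  have hm : Monotone (fun n : ℕ => (n : ℝ≥0)) := Nat.mono_cast
  have ht : Tendsto (fun n : ℕ => (n : ℝ≥0)) atTop atTop := tendsto_natCast_atTop_atTop
  obtain ⟨_, h1⟩ := hξ _ hm ht
  obtain ⟨_, h2⟩ := hη _ hm ht
  exact h1.symm.trans h2

/-- The part of the boundary at infinity that is reached by sequences in the subset `S`. If `S` is
the vertex set of a subtree of a tree, this is the boundary of the subtree. -/
def boundaryOf (S : Set X) : Set (GromovBoundary X) :=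
  {ξ | ∃ x : ℕ → X, (∀ n, x n ∈ S) ∧ Represents x ξ}

end Boundary

/-! ### Quasi-geodesics and the sublinearly Morse boundary -/

section Morse

/-- `(K, C)`-quasi-isometric embeddings. If the domain is an interval, these are the
`(K, C)`-quasi-geodesics. -/
def IsQuasiIsometricEmbedding {A B : Type*} [MetricSpace A] [MetricSpace B]
    (K C : ℝ) (f : A → B) : Prop :=
  ∀ x y, (1 / K) * dist x y - C ≤ dist (f x) (f y) ∧ dist (f x) (f y) ≤ K * dist x y + C

/-- `κ : [0, ∞) → [0, ∞)` is increasing, concave and sublinear. -/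
structure IsSublinear (κ : ℝ → ℝ) : Prop where
  nonneg : ∀ t, 0 ≤ t → 0 ≤ κ t
  monotone : MonotoneOn κ (Ici 0)
  concave : ConcaveOn ℝ (Ici 0) κ
  sublinear : Tendsto (fun t => κ t / t) atTop (𝓝 0)

variable {Y : Type*} [MetricSpace Y]

/-- The `(κ, n)`-neighbourhood of `Z`, with respect to the base point `o`. -/
def kappaNeighborhood (κ : ℝ → ℝ) (o : Y) (Z : Set Y) (n : ℝ) : Set Y :=
  {y | Metric.infDist y Z ≤ n * κ (dist o y)}

/-- `N` is a `κ`-Morse gauge for `Z`: every `(K, C)`-quasi-geodesic segment with end points on `Z`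
is contained in the `(κ, N K C)`-neighbourhood of `Z`. -/
def HasMorseGauge (κ : ℝ → ℝ) (o : Y) (Z : Set Y) (N : ℝ → ℝ → ℝ≥0) : Prop :=
  ∀ K C : ℝ, 1 ≤ K → 0 ≤ C → ∀ (s t : ℝ) (hst : s ≤ t) (β : Icc s t → Y),
    IsQuasiIsometricEmbedding K C β →
    β ⟨s, left_mem_Icc.2 hst⟩ ∈ Z → β ⟨t, right_mem_Icc.2 hst⟩ ∈ Z →
    ∀ u, β u ∈ kappaNeighborhood κ o Z (N K C)

/-- A quasi-geodesic ray. -/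
def IsQuasiGeodesicRay (γ : ℝ≥0 → Y) : Prop :=
  ∃ K C : ℝ, 1 ≤ K ∧ 0 ≤ C ∧ IsQuasiIsometricEmbedding K C γ

/-- The `κ`-Morse quasi-geodesic rays (with any starting point). -/
def MorseRay (κ : ℝ → ℝ) (o : Y) : Type _ :=
  {γ : ℝ≥0 → Y // IsQuasiGeodesicRay γ ∧ ∃ N, HasMorseGauge κ o (range γ) N}

/-- Two rays `κ`-fellow travel (are `κ`-close). -/
def FellowTravel (κ : ℝ → ℝ) (o : Y) (α β : ℝ≥0 → Y) : Prop :=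
  ∃ n : ℝ, range α ⊆ kappaNeighborhood κ o (range β) n ∧
    range β ⊆ kappaNeighborhood κ o (range α) n

/-- The `κ`-Morse boundary of `Y`. -/
def KappaBoundary (κ : ℝ → ℝ) (o : Y) : Type _ :=
  Quot (fun α β : MorseRay κ o => FellowTravel κ o α.1 β.1)

/-- The stratum of the `κ`-Morse boundary given by the rays that start at the base point `o` and
have Morse gauge `N`. -/
def stratum (κ : ℝ → ℝ) (o : Y) (N : ℝ → ℝ → ℝ≥0) : Set (KappaBoundary κ o) :=
  {ξ | ∃ γ : MorseRay κ o, γ.1 0 = o ∧ HasMorseGauge κ o (range γ.1) N ∧ Quot.mk _ γ = ξ}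

end Morse

/-! ### Actions and hyperbolic projections -/

section Projections

/-- Any two points are joined by a geodesic. -/
def IsGeodesicSpace (Y : Type*) [MetricSpace Y] : Prop :=
  ∀ x y : Y, ∃ γ : Icc (0 : ℝ) (dist x y) → Y, Isometry γ ∧
    γ ⟨0, left_mem_Icc.2 dist_nonneg⟩ = x ∧ γ ⟨dist x y, right_mem_Icc.2 dist_nonneg⟩ = y

/-- Geometric actions: isometric, proper and cocompact. -/
structure IsGeometricAction (G Y : Type*) [Group G] [MetricSpace Y] [MulAction G Y] : Prop where
  isometric : ∀ (g : G) (x y : Y), dist (g • x) (g • y) = dist x y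
  proper : ∀ (y : Y) (r : ℝ), {g : G | dist y (g • y) ≤ r}.Finite
  cocompact : ∃ K : Set Y, IsCompact K ∧ ∀ y : Y, ∃ g : G, ∃ k ∈ K, g • k = y

/-- Cobounded isometric actions. -/
structure IsCoboundedAction (G X : Type*) [Group G] [MetricSpace X] [MulAction G X] : Prop where
  isometric : ∀ (g : G) (x y : X), dist (g • x) (g • y) = dist x y
  cobounded : ∃ (x : X) (r : ℝ), ∀ y : X, ∃ g : G, dist y (g • x) ≤ r

/-- Projection maps: coarsely Lipschitz, coarsely `G`-equivariant maps. -/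
structure IsProjection (G : Type*) {Y X : Type*} [Group G] [MetricSpace Y] [MetricSpace X]
    [MulAction G Y] [MulAction G X] (p : Y → X) : Prop where
  coarselyLipschitz : ∃ K C : ℝ, ∀ x y, dist (p x) (p y) ≤ K * dist x y + C
  coarselyEquivariant : ∃ C : ℝ, ∀ (g : G) (y : Y), dist (p (g • y)) (g • p y) ≤ C

variable {Y X : Type*} [MetricSpace Y] [MetricSpace X]

/-- `κ`-injectivity, for a projection `p`: the image of every `κ`-Morse quasi-geodesic ray
defines a point at infinity, and two such rays are `κ`-close if and only if their images define
the same point. -/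
structure KappaInjective (κ : ℝ → ℝ) (o : Y) (p : Y → X) : Prop where
  definesPoint : ∀ γ : MorseRay κ o, ∃ ξ : GromovBoundary X, DefinesPoint (p ∘ γ.1) ξ
  close_iff : ∀ α β : MorseRay κ o, FellowTravel κ o α.1 β.1 ↔
    ∃ ξ : GromovBoundary X, DefinesPoint (p ∘ α.1) ξ ∧ DefinesPoint (p ∘ β.1) ξ

/-- The induced map `∂p : ∂_κ Y → ∂_∞ X`, which sends the class of `γ` to the point defined by
`p ∘ γ`. -/
noncomputable def boundaryMap {κ : ℝ → ℝ} {o : Y} {p : Y → X} (h : KappaInjective κ o p) :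
    KappaBoundary κ o → GromovBoundary X :=
  Quot.lift (fun γ => (h.definesPoint γ).choose) (by
    intro α β hαβ
    obtain ⟨ξ, hα, hβ⟩ := (h.close_iff α β).1 hαβ
    exact ((h.definesPoint α).choose_spec.unique hα).trans
      (hβ.unique (h.definesPoint β).choose_spec))

/-- The topology of the hyperbolic projection: the pull-back of the visual topology. -/
noncomputable abbrev projectionTopology {κ : ℝ → ℝ} {o : Y} {p : Y → X}
    (h : KappaInjective κ o p) : TopologicalSpace (KappaBoundary κ o) :=
  TopologicalSpace.induced (boundaryMap h) visualTopology

end Projections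

/-! ### Trees and Cantor chains

Trees are handled through their vertex sets, with the path metric. A subtree of a tree is
determined by its set of vertices. -/

section Trees

variable {V : Type*}

/-- `T` is the tree all of whose vertices have countably infinite degree. -/
structure IsCountablyInfiniteValenceTree (T : SimpleGraph V) : Prop where
  isTree : T.IsTree
  infinite : ∀ v, (T.neighborSet v).Infinite
  countable : ∀ v, (T.neighborSet v).Countable

/-- The degree of `v` in the subgraph of `T` induced on `S` (for `v ∈ S`). -/
noncomputable def degreeIn (T : SimpleGraph V) (S : Set V) (v : V) : ℕ :=
  (T.neighborSet v ∩ S).ncard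

/-- The sets `S 0 ⊆ S 1 ⊆ …` are the vertex sets of a strongly entwined sequence of locally finite
subtrees of `T`, all of whose vertices have degree at least three, and these subtrees fill `T`. -/
structure IsStronglyEntwinedFillingChain (T : SimpleGraph V) (S : ℕ → Set V) : Prop where
  isTree : ∀ i, (T.induce (S i)).IsTree
  nested : ∀ i, S i ⊆ S (i + 1)
  locallyFinite : ∀ i, ∀ v ∈ S i, (T.neighborSet v ∩ S i).Finite
  three_le_degree : ∀ i, ∀ v ∈ S i, 3 ≤ degreeIn T (S i) v
  stronglyEntwined : ∀ i, ∀ v ∈ S i, degreeIn T (S i) v < degreeIn T (S (i + 1)) v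
  filling : ∀ u v, T.Adj u v → ∃ i, u ∈ S i ∧ v ∈ S i

variable [MetricSpace V]

/-- The convex hull of a set `Λ` of boundary points: the union of all bi-infinite geodesics with
both end points in `Λ`. -/
def geodesicHull (Λ : Set (GromovBoundary V)) : Set V :=
  {v | ∃ ℓ : ℤ → V, (∀ i j : ℤ, dist (ℓ i) (ℓ j) = |(i : ℝ) - j|) ∧
    (∃ ξ ∈ Λ, Represents (fun n : ℕ => ℓ n) ξ) ∧
    (∃ η ∈ Λ, Represents (fun n : ℕ => ℓ (-n)) η) ∧ v ∈ range ℓ}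

/-- `X` is a Cantor chain: it is homeomorphic to the union of the boundaries of the trees in a
strongly entwined filling chain of the tree `T` of countably infinite valence. -/
def IsCantorChain (T : SimpleGraph V) (X : Type*) [TopologicalSpace X] : Prop :=
  ∃ S : ℕ → Set V, IsStronglyEntwinedFillingChain T S ∧
    Nonempty (X ≃ₜ ↥(⋃ i, boundaryOf (S i)))

end Trees

end CantorChain

set_option linter.unusedSectionVars false

namespace CantorChain

/-! ### Gauge functions -/

/-! Boundary points of the tree are identified with the geodesic rays from `p o`, that is, with
sequences of vertices; the visual topology becomes the product topology with discrete factors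
(`represents_iff`, `isInducing_rayTo`). The Morse boundary then is a set `MorseSetting.ends` of
sequences. It suffices to write this set as an increasing union of nonempty compact perfect sets,
each nowhere dense in the next, and to recognise such a union as the boundary of a chain of trees.
The given hulls provide an end behind every vertex; the trees of the conclusion are constructed
afresh.

Compactness: every Morse class has a geodesic representative from `o` whose gauge depends only on
the gauge and the constants of the ray (`exists_representative`), so countably many gauges suffice
(`exists_cover`). A limit of geodesics with a common gauge is Morse, and its end is the limit of
their ends (`eventually_end_eq`). So the ends of one gauge take finitely many values at each level,
and their closure consists of Morse ends.

This continuity rests on `exists_escape`: geodesics with a common gauge leave bounded sets of the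
tree uniformly. A failure produces a limit geodesic and long Morse segments along elements that fix
vertices of the tree. Three such families with different ends could be combined to a Morse ray whose
projection has no end (`not_three_families`). With at most two ends, a pigeonhole argument gives an
element that translates along the limit; then only finitely many elements fix both its end and a
vertex of the tree ray (`finite_of_axis`), but the failure provides infinitely many.

Morse rays are built by `exists_concatenation`: Morse segments of rapidly growing length,
consecutive ones diverging linearly, form a Morse quasi-geodesic ray (`Concat.wg_union`). Out of
three directions at most one fails to diverge and at most one is excluded by a further restriction,
so the ray can be steered. A diagonal argument therefore gives uncountably many ends
(`not_countable_ends`), and translations by the group give uncountably many behind every vertex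
(`not_countable_shadow`).

Topology: behind each vertex the Cantor-Bendixson theorem yields a perfect set of ends, and
attaching such sets to a given compact set along all its vertices yields the exhaustion
(`exists_exhaustion`). Finally the space is cut repeatedly into countably many clopen pieces, which
are matched with the children of the vertices of the tree (`exists_partition`,
`IsExhausted.exists_chain`). -/

/-- A sublinear gauge function that is at least one. -/
structure IsGauge (k : ℝ → ℝ) : Prop where
  one_le : ∀ t, 1 ≤ k t
  mono : Monotone k
  subadd : ∀ a b, 0 ≤ a → 0 ≤ b → k (a + b) ≤ k a + k b
  sublin : ∀ ε, 0 < ε → ∃ C, 0 ≤ C ∧ ∀ t, 0 ≤ t → k t ≤ ε * t + C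

theorem IsGauge.pos {k : ℝ → ℝ} (hk : IsGauge k) (t : ℝ) : 0 < k t :=
  lt_of_lt_of_le one_pos (hk.one_le t)

theorem IsGauge.add_le {k : ℝ → ℝ} (hk : IsGauge k) {a b : ℝ} (ha : 0 ≤ a) (hb : 0 ≤ b) :
    k (a + b) ≤ (1 + k b) * k a := by
  have h1 := hk.subadd a b ha hb
  have h2 := hk.one_le a
  have h3 := hk.pos b
  nlinarith

theorem IsGauge.double_le {k : ℝ → ℝ} (hk : IsGauge k) {a : ℝ} (ha : 0 ≤ a) :
    k (2 * a) ≤ 2 * k a := by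
  have := hk.subadd a a ha ha
  rw [two_mul]; linarith

theorem IsGauge.nat_mul {k : ℝ → ℝ} (hk : IsGauge k) {a : ℝ} (ha : 0 ≤ a) (n : ℕ) :
    k ((n + 1 : ℕ) * a) ≤ (n + 1 : ℕ) * k a := by
  induction n with
  | zero => simp
  | succ n ih =>
    have := hk.subadd ((n + 1 : ℕ) * a) a (by positivity) ha
    have e : ((n + 1 + 1 : ℕ) : ℝ) * a = ((n + 1 : ℕ) : ℝ) * a + a := by push_cast; ring
    rw [e]
    have e' : ((n + 1 + 1 : ℕ) : ℝ) * k a = ((n + 1 : ℕ) : ℝ) * k a + k a := by push_cast; ring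
    linarith

theorem IsGauge.mul_le {k : ℝ → ℝ} (hk : IsGauge k) {a c : ℝ} (ha : 0 ≤ a) (hc : 0 ≤ c) :
    k (c * a) ≤ (c + 1) * k a := by
  have h1 : c ≤ ((⌊c⌋₊ + 1 : ℕ) : ℝ) := by push_cast; exact (Nat.lt_floor_add_one c).le
  have h2 : ((⌊c⌋₊ + 1 : ℕ) : ℝ) ≤ c + 1 := by
    push_cast; linarith [Nat.floor_le hc]
  have h3 := hk.nat_mul ha ⌊c⌋₊
  have h4 : k (c * a) ≤ k ((⌊c⌋₊ + 1 : ℕ) * a) := hk.mono (mul_le_mul_of_nonneg_right h1 ha)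
  have h5 := mul_le_mul_of_nonneg_right h2 (hk.pos a).le
  linarith

/-- Points whose norms differ by a multiple of the gauge have comparable gauges. -/
theorem IsGauge.comp {k : ℝ → ℝ} (hk : IsGauge k) (A : ℝ) (hA : 0 ≤ A) :
    ∃ B, 1 ≤ B ∧ ∀ a b, 0 ≤ a → 0 ≤ b → a ≤ b + A * k a → k a ≤ B * k b := by
  -- With this slope `A * k a` is at most `a / 2` plus a constant, so that `a` is bounded linearly
  -- in `b`.
  obtain ⟨C, hC, h⟩ := hk.sublin (1 / (2 * (A + 1))) (by positivity)
  refine ⟨2 + k (2 * (A * C)), by linarith [hk.one_le (2 * (A * C))], fun a b ha hb hab => ?_⟩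
  have h1 := h a ha
  have h2 : A * k a ≤ a / 2 + A * C := by
    have h3 : A * k a ≤ A * (1 / (2 * (A + 1)) * a + C) := mul_le_mul_of_nonneg_left h1 hA
    have h4 : A * (1 / (2 * (A + 1)) * a) ≤ a / 2 := by
      have : A * (1 / (2 * (A + 1)) * a) = (A / (A + 1)) * (a / 2) := by field_simp
      rw [this]
      have h5 : A / (A + 1) ≤ 1 := by rw [div_le_one (by positivity)]; linarith
      nlinarith
    linarith
  have h3 : a ≤ 2 * b + 2 * (A * C) := by linarith
  have h4 := hk.mono h3
  have h5 := hk.subadd (2 * b) (2 * (A * C)) (by positivity) (by positivity)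
  have h6 := hk.double_le hb
  have h7 := hk.one_le b
  have h8 := hk.pos (2 * (A * C))
  nlinarith

/-- A gauge is eventually smaller than any linear function. -/
theorem IsGauge.eventually_le {k : ℝ → ℝ} (hk : IsGauge k) (A B : ℝ) (hA : 0 ≤ A) :
    ∀ᶠ t : ℝ in atTop, A * k t + B ≤ t := by
  obtain ⟨C, hC, h⟩ := hk.sublin (1 / (2 * (A + 1))) (by positivity)
  filter_upwards [eventually_ge_atTop (max 0 (2 * (A * C + |B|)))] with t ht
  have ht0 : 0 ≤ t := le_trans (le_max_left _ _) ht
  have ht1 : 2 * (A * C + |B|) ≤ t := le_trans (le_max_right _ _) ht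
  have h1 := mul_le_mul_of_nonneg_left (h t ht0) hA
  have h4 : A * (1 / (2 * (A + 1)) * t) ≤ t / 2 := by
    have : A * (1 / (2 * (A + 1)) * t) = (A / (A + 1)) * (t / 2) := by field_simp
    rw [this]
    have h5 : A / (A + 1) ≤ 1 := by rw [div_le_one (by positivity)]; linarith
    nlinarith
  have := le_abs_self B
  nlinarith

/-- The gauge `κ + 1` of a sublinear function. -/
noncomputable def gaugeOf (κ : ℝ → ℝ) (t : ℝ) : ℝ := κ (max t 0) + 1

/-- Subadditivity follows from concavity and `κ 0 ≥ 0`: the graph lies above the chord from the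
origin to the point over `a + b`. The added one allows additive constants to be absorbed in
multiples of the gauge. -/
theorem IsSublinear.isGauge {κ : ℝ → ℝ} (h : IsSublinear κ) : IsGauge (gaugeOf κ) where
  one_le t := by
    have := h.nonneg (max t 0) (le_max_right _ _)
    unfold gaugeOf; linarith
  mono := by
    intro a b hab
    have := h.monotone (mem_Ici.2 (le_max_right a 0)) (mem_Ici.2 (le_max_right b 0))
      (max_le_max_right 0 hab)
    unfold gaugeOf; linarith
  subadd := by
    intro a b ha hb
    unfold gaugeOf
    rw [max_eq_left ha, max_eq_left hb, max_eq_left (add_nonneg ha hb)]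
    rcases eq_or_lt_of_le (add_nonneg ha hb) with h0 | h0
    · have ea : a = 0 := by linarith
      have eb : b = 0 := by linarith
      subst ea; subst eb
      have := h.nonneg 0 le_rfl
      simp only [add_zero]; linarith
    · have key : ∀ x, 0 ≤ x → x ≤ a + b → x / (a + b) * κ (a + b) ≤ κ x := by
        intro x hx hxs
        have e1 : 0 ≤ x / (a + b) := by positivity
        have e2 : 0 ≤ 1 - x / (a + b) := by rw [sub_nonneg, div_le_one h0]; exact hxs
        have h1 := h.concave.2 (mem_Ici.2 h0.le) (mem_Ici.2 (le_refl (0 : ℝ))) e1 e2 (by ring)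
        simp only [smul_eq_mul, mul_zero, add_zero] at h1
        have e : x / (a + b) * (a + b) = x := by field_simp
        rw [e] at h1
        have h2 : 0 ≤ (1 - x / (a + b)) * κ 0 := mul_nonneg
          (by rw [sub_nonneg, div_le_one h0]; exact hxs) (h.nonneg 0 le_rfl)
        linarith
      have k1 := key a ha (by linarith)
      have k2 := key b hb (by linarith)
      have e : a / (a + b) * κ (a + b) + b / (a + b) * κ (a + b) = κ (a + b) := by
        field_simp
      linarith
  sublin := by
    intro ε hε
    have h1 := h.sublinear.eventually (gt_mem_nhds hε)
    obtain ⟨A, hA⟩ := eventually_atTop.1 h1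
    have hm := h.nonneg (max A 1) (by positivity)
    refine ⟨κ (max A 1) + 1, by positivity, fun t ht => ?_⟩
    unfold gaugeOf
    rw [max_eq_left ht]
    by_cases htA : t ≤ max A 1
    · have := h.monotone (mem_Ici.2 ht) (mem_Ici.2 (le_trans ht htA)) htA
      have : 0 ≤ ε * t := by positivity
      linarith
    · push Not at htA
      have h2 := hA t (le_trans (le_max_left _ _) htA.le)
      have h3 : 0 < t := lt_of_lt_of_le one_pos (le_trans (le_max_right _ _) htA.le)
      rw [div_lt_iff₀ h3] at h2
      linarith

/-! ### Quasi-geodesic segments and surgery -/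

section Surgery

variable {Y : Type*} [MetricSpace Y]

/-- `β` is a `(K, K)`-quasi-geodesic on `[s, t]`. -/
def QG (K s t : ℝ) (β : ℝ → Y) : Prop :=
  ∀ x ∈ Icc s t, ∀ y ∈ Icc s t, x ≤ y →
    (y - x) / K - K ≤ dist (β x) (β y) ∧ dist (β x) (β y) ≤ K * (y - x) + K

theorem QG.sub {K s t s' t' : ℝ} {β : ℝ → Y} (h : QG K s t β) (hs : s ≤ s') (ht : t' ≤ t) :
    QG K s' t' β := fun x hx y hy hxy =>
  h x ⟨hs.trans hx.1, hx.2.trans ht⟩ y ⟨hs.trans hy.1, hy.2.trans ht⟩ hxy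

theorem QG.mono {K K' s t : ℝ} {β : ℝ → Y} (h : QG K s t β) (hK : 1 ≤ K) (hKK : K ≤ K') :
    QG K' s t β := by
  intro x hx y hy hxy
  obtain ⟨h1, h2⟩ := h x hx y hy hxy
  have h3 : (y - x) / K' ≤ (y - x) / K :=
    div_le_div_of_nonneg_left (by linarith) (by linarith) hKK
  have h4 : K * (y - x) ≤ K' * (y - x) := mul_le_mul_of_nonneg_right hKK (by linarith)
  exact ⟨by linarith, by linarith⟩

theorem QG.rev {K s t : ℝ} {β : ℝ → Y} (h : QG K s t β) : QG K (-t) (-s) (fun x => β (-x)) := by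
  intro x hx y hy hxy
  have := h (-y) ⟨by linarith [hy.2], by linarith [hy.1]⟩ (-x) ⟨by linarith [hx.2], by linarith [hx.1]⟩
    (by linarith)
  have e : -x - -y = y - x := by ring
  rw [e, dist_comm] at this
  exact this

theorem exists_geodesic (hY : IsGeodesicSpace Y) (x y : Y) :
    ∃ γ : ℝ → Y, γ 0 = x ∧ γ (dist x y) = y ∧
      ∀ s ∈ Icc 0 (dist x y), ∀ t ∈ Icc 0 (dist x y), dist (γ s) (γ t) = |s - t| := by
  obtain ⟨γ, h1, h2, h3⟩ := hY x y
  refine ⟨fun s => γ (projIcc 0 (dist x y) dist_nonneg s), ?_, ?_, ?_⟩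
  · show γ _ = x
    rw [projIcc_left]; exact h2
  · show γ _ = y
    rw [projIcc_right]; exact h3
  · intro s hs t ht
    show dist (γ _) (γ _) = _
    rw [h1.dist_eq, projIcc_of_mem _ hs, projIcc_of_mem _ ht]
    rfl

/-- Attaching a geodesic from an almost nearest point. -/
theorem QG.attach (hY : IsGeodesicSpace Y) {K s q : ℝ} {β : ℝ → Y} (h : QG K s q β) (hK : 1 ≤ K)
    (hsq : s ≤ q) (m : Y) (hq : ∀ x ∈ Icc s q, dist (β q) m ≤ dist (β x) m + 1) :
    ∃ β' : ℝ → Y, QG (3 * K) s (q + dist (β q) m) β' ∧ β' (q + dist (β q) m) = m ∧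
      (∀ x ≤ q, β' x = β x) ∧
      ∀ x ∈ Icc 0 (dist (β q) m), dist (β' (q + x)) m = dist (β q) m - x := by
  obtain ⟨γ, g0, g1, g2⟩ := exists_geodesic hY (β q) m
  set L := dist (β q) m with hL
  have hL0 : 0 ≤ L := dist_nonneg
  have hgm : ∀ x ∈ Icc 0 L, dist (γ x) m = L - x := by
    intro x hx
    have := g2 x hx L ⟨hL0, le_rfl⟩
    rw [g1] at this
    rw [this, abs_sub_comm, abs_of_nonneg (by linarith [hx.2])]
  have hgq : ∀ x ∈ Icc 0 L, dist (β q) (γ x) = x := by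
    intro x hx
    have := g2 0 ⟨le_rfl, hL0⟩ x hx
    rw [g0] at this
    rw [this, abs_sub_comm, sub_zero, abs_of_nonneg hx.1]
  have hval : ∀ x ∈ Icc 0 L, (if q + x ≤ q then β (q + x) else γ (q + x - q)) = γ x := by
    intro x hx
    split_ifs with hc
    · have : x = 0 := le_antisymm (by linarith) hx.1
      subst this; rw [add_zero, g0]
    · rw [add_sub_cancel_left]
  refine ⟨fun x => if x ≤ q then β x else γ (x - q), ?_, ?_, ?_, ?_⟩
  · intro x hx y hy hxy
    have hK3 : (y - x) / (3 * K) ≤ y - x := by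
      apply div_le_self (by linarith) (by linarith)
    by_cases hyq : y ≤ q
    · have hxq := hxy.trans hyq
      simp only [hxq, hyq, if_true]
      exact (h.mono hK (by linarith : K ≤ 3 * K)) x ⟨hx.1, hxq⟩ y ⟨hy.1, hyq⟩ hxy
    · push Not at hyq
      have hyL : y - q ∈ Icc 0 L := ⟨by linarith, by linarith [hy.2]⟩
      by_cases hxq : x ≤ q
      · simp only [hxq, if_true, not_le.2 hyq, if_false]
        obtain ⟨h1, h2⟩ := h x ⟨hx.1, hxq⟩ q ⟨hsq, le_rfl⟩ hxq
        have t1 := dist_triangle (β x) (β q) (γ (y - q))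
        have t2 := dist_triangle (β x) (γ (y - q)) (β q)
        have t3 := dist_triangle (β x) (γ (y - q)) m
        rw [hgq _ hyL] at t1
        rw [dist_comm (γ _) (β q), hgq _ hyL] at t2
        rw [hgm _ hyL] at t3
        have h3 := hq x ⟨hx.1, hxq⟩
        -- There are two lower bounds for the distance: `dist (β x) (β q) - (y - q)`, and `(y - q) -
        -- 1` because `β q` is almost nearest to `m`. One third of the first plus two thirds of the
        -- second gives the constant `3 * K`.
        constructor
        · have e : (y - x) / (3 * K) = (q - x) / K / 3 + (y - q) / K / 3 := by
            field_simp; ring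
          have e2 : (y - q) / K ≤ y - q := div_le_self (by linarith) hK
          rw [e]
          linarith
        · have : y - q ≤ K * (y - q) := le_mul_of_one_le_left (by linarith) hK
          nlinarith
      · push Not at hxq
        simp only [not_le.2 hxq, if_false, not_le.2 hyq]
        have := g2 (x - q) ⟨by linarith, by linarith [hyL.2]⟩ (y - q) hyL
        rw [this, abs_sub_comm, abs_of_nonneg (by linarith)]
        have e : y - q - (x - q) = y - x := by ring
        rw [e]
        constructor
        · linarith
        · nlinarith
  · show (if _ then _ else _) = m
    rw [hval L ⟨hL0, le_rfl⟩]; exact g1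
  · intro x hx
    simp [hx]
  · intro x hx
    show dist (if _ then _ else _) m = _
    rw [hval x hx]; exact hgm x hx

/-- A quasi-geodesic need not be continuous, so a nearest point may not exist; hence the slack of
one. -/
theorem exists_almost_nearest {s t : ℝ} (hst : s ≤ t) (β : ℝ → Y) (m : Y) :
    ∃ q ∈ Icc s t, ∀ x ∈ Icc s t, dist (β q) m ≤ dist (β x) m + 1 := by
  have hne : ((fun x => dist (β x) m) '' Icc s t).Nonempty := ⟨_, s, ⟨le_rfl, hst⟩, rfl⟩
  have hbd : BddBelow ((fun x => dist (β x) m) '' Icc s t) := ⟨0, by rintro _ ⟨x, _, rfl⟩; exact dist_nonneg⟩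
  obtain ⟨_, ⟨q, hq, rfl⟩, h⟩ := exists_lt_of_csInf_lt hne (lt_add_one _)
  exact ⟨q, hq, fun x hx => by
    have := csInf_le hbd ⟨x, hx, rfl⟩
    simp only at h this
    linarith⟩

/-- Splitting a quasi-geodesic at a point that is almost nearest to `m`. -/
theorem QG.split (hY : IsGeodesicSpace Y) {K s t : ℝ} {β : ℝ → Y} (h : QG K s t β) (hK : 1 ≤ K)
    (hst : s ≤ t) (m : Y) : ∃ q ∈ Icc s t, (∀ x ∈ Icc s t, dist (β q) m ≤ dist (β x) m + 1) ∧
      (∃ β₁ : ℝ → Y, QG (3 * K) s (q + dist (β q) m) β₁ ∧ β₁ (q + dist (β q) m) = m ∧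
        (∀ x ≤ q, β₁ x = β x) ∧
        ∀ x ∈ Icc 0 (dist (β q) m), dist (β₁ (q + x)) m = dist (β q) m - x) ∧
      (∃ β₂ : ℝ → Y, QG (3 * K) (q - dist (β q) m) t β₂ ∧ β₂ (q - dist (β q) m) = m ∧
        (∀ x, q ≤ x → β₂ x = β x) ∧
        ∀ x ∈ Icc 0 (dist (β q) m), dist (β₂ (q - x)) m = dist (β q) m - x) := by
  obtain ⟨q, hq, hmin⟩ := exists_almost_nearest hst β m
  refine ⟨q, hq, hmin, (h.sub le_rfl hq.2).attach hY hK hq.1 m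
    (fun x hx => hmin x ⟨hx.1, hx.2.trans hq.2⟩), ?_⟩
  have h' := (h.sub hq.1 le_rfl).rev
  obtain ⟨β', b1, b2, b3, b4⟩ := h'.attach hY hK (by linarith [hq.2]) m (fun x hx => by
    simp only [neg_neg]
    exact hmin (-x) ⟨by linarith [hx.2, hq.1], by linarith [hx.1]⟩)
  simp only [neg_neg] at b1 b2 b4
  refine ⟨fun x => β' (-x), ?_, ?_, ?_, ?_⟩
  · have := b1.rev
    simp only [neg_neg] at this
    have e : -(-q + dist (β q) m) = q - dist (β q) m := by ring
    rwa [e] at this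
  · show β' (-(q - dist (β q) m)) = m
    rw [show -(q - dist (β q) m) = -q + dist (β q) m by ring]; exact b2
  · intro x hx
    show β' (-x) = _
    rw [b3 (-x) (by linarith)]; simp
  · intro x hx
    show dist (β' (-(q - x))) m = _
    rw [show -(q - x) = -q + x by ring]; exact b4 x hx

/-- The constant that controls the part of a quasi-geodesic that is lost in a surgery. -/
def lossConst (K : ℝ) : ℝ := 108 * K ^ 3

theorem one_le_lossConst {K : ℝ} (hK : 1 ≤ K) : 1 ≤ lossConst K := by
  have : 1 ≤ K ^ 3 := one_le_pow₀ hK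
  unfold lossConst; linarith

/-- Moving the end point of a quasi-geodesic to a nearby point. -/
theorem QG.move_end (hY : IsGeodesicSpace Y) {K s t : ℝ} {β : ℝ → Y} (h : QG K s t β) (hK : 1 ≤ K)
    (hst : s ≤ t) (m : Y) {δ : ℝ} (hδ : dist (β t) m ≤ δ) :
    ∃ t' β', s ≤ t' ∧ QG (3 * K) s t' β' ∧ β' s = β s ∧ β' t' = m ∧ ∀ x ∈ Icc s t,
      (x ∈ Icc s t' ∧ β' x = β x) ∨ dist (β x) (β t) ≤ 4 * K ^ 3 * (δ + 1) := by
  obtain ⟨q, hq, hmin, ⟨β', b1, b2, b3, -⟩, -⟩ := h.split hY hK hst m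
  refine ⟨_, β', ?_, b1, b3 s hq.1, b2, fun x hx => ?_⟩
  · linarith [hq.1, dist_nonneg (x := β q) (y := m)]
  · by_cases hxq : x ≤ q
    · exact Or.inl ⟨⟨hx.1, by linarith [dist_nonneg (x := β q) (y := m)]⟩, b3 x hxq⟩
    · right
      push Not at hxq
      -- Beyond `q` little time is left, since `β q` and `β t` are both within `δ + 1` of `m`.
      have h1 := hmin t ⟨hst, le_rfl⟩
      have h2 := dist_triangle_right (β q) (β t) m
      have h3 := (h q hq t ⟨hst, le_rfl⟩ hq.2).1
      have h4 := (h x hx t ⟨hst, le_rfl⟩ hx.2).2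
      have hδ0 : 0 ≤ δ := dist_nonneg.trans hδ
      have h5 : (t - q) / K ≤ 2 * δ + 1 + K := by linarith
      rw [div_le_iff₀ (by linarith)] at h5
      have h6 : t - x ≤ (2 * δ + 1 + K) * K := by linarith
      have h7 : K * (t - x) ≤ K * ((2 * δ + 1 + K) * K) := mul_le_mul_of_nonneg_left h6 (by linarith)
      have k2 : K ≤ K ^ 2 := by nlinarith
      have k3 : K ^ 2 ≤ K ^ 3 := by nlinarith [sq_nonneg K]
      have : K * ((2 * δ + 1 + K) * K) = 2 * δ * K ^ 2 + K ^ 2 + K ^ 3 := by ring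
      have h8 : 2 * δ * K ^ 2 ≤ 2 * δ * K ^ 3 := mul_le_mul_of_nonneg_left k3 (by linarith)
      have h9 : 0 ≤ δ * K ^ 3 := by positivity
      nlinarith

theorem QG.move_start (hY : IsGeodesicSpace Y) {K s t : ℝ} {β : ℝ → Y} (h : QG K s t β)
    (hK : 1 ≤ K) (hst : s ≤ t) (m : Y) {δ : ℝ} (hδ : dist (β s) m ≤ δ) :
    ∃ s' β', s' ≤ t ∧ QG (3 * K) s' t β' ∧ β' s' = m ∧ β' t = β t ∧ ∀ x ∈ Icc s t,
      (x ∈ Icc s' t ∧ β' x = β x) ∨ dist (β x) (β s) ≤ 4 * K ^ 3 * (δ + 1) := by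
  obtain ⟨t', β', h0, h1, h2, h3, h4⟩ := h.rev.move_end hY hK (by linarith) m (δ := δ) (by simpa using hδ)
  refine ⟨-t', fun x => β' (-x), by linarith, ?_, by simpa using h3, by simpa using h2, fun x hx => ?_⟩
  · have := h1.rev
    rwa [neg_neg] at this
  · rcases h4 (-x) ⟨by linarith [hx.2], by linarith [hx.1]⟩ with h5 | h5
    · left
      simp only [neg_neg] at h5
      exact ⟨⟨by linarith [h5.1.2], hx.2⟩, h5.2⟩
    · right; simpa using h5

/-- The `k`-Morse property of `Z`, with respect to the base point `z₀`. -/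
def WG (k : ℝ → ℝ) (z₀ : Y) (Z : Set Y) (M : ℝ → ℝ) : Prop :=
  ∀ K, 1 ≤ K → ∀ (s t : ℝ) (β : ℝ → Y), s ≤ t → QG K s t β → β s ∈ Z → β t ∈ Z →
    ∀ x ∈ Icc s t, ∃ z ∈ Z, dist (β x) z ≤ M K * k (dist z₀ (β x))

/-- A quasi-geodesic with end points near a Morse set stays near this set, except possibly near its
end points. -/
theorem WG.near_of_ends_near (hY : IsGeodesicSpace Y) {k : ℝ → ℝ} {z₀ : Y} {Z : Set Y} {M : ℝ → ℝ}
    (hZ : WG k z₀ Z M) {K s t : ℝ} {β : ℝ → Y} (h : QG K s t β) (hK : 1 ≤ K) (hst : s ≤ t)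
    {δ₁ δ₂ : ℝ} {z₁ z₂ : Y} (hz₁ : z₁ ∈ Z) (hz₂ : z₂ ∈ Z) (h₁ : dist (β s) z₁ ≤ δ₁)
    (h₂ : dist (β t) z₂ ≤ δ₂) (x : ℝ) (hx : x ∈ Icc s t) :
    (∃ z ∈ Z, dist (β x) z ≤ M (9 * K) * k (dist z₀ (β x))) ∨
      dist (β x) (β s) ≤ lossConst K * (δ₁ + 1) ∨ dist (β x) (β t) ≤ lossConst K * (δ₂ + 1) := by
  have hδ₁ : 0 ≤ δ₁ := dist_nonneg.trans h₁
  have hδ₂ : 0 ≤ δ₂ := dist_nonneg.trans h₂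
  have hK3 : 0 ≤ K ^ 3 := by positivity
  -- The end points are moved onto `Z` one after the other. Each surgery triples the constant, which
  -- gives `9 * K`, and the loss in the second one is governed by `4 * (3 * K) ^ 3 = 108 * K ^ 3`.
  obtain ⟨t', β', a0, a1, a2, a3, a4⟩ := h.move_end hY hK hst z₂ h₂
  obtain ⟨s', β'', c0, c1, c2, c3, c4⟩ := a1.move_start hY (by linarith) a0 z₁ (δ := δ₁)
    (by rw [a2]; exact h₁)
  rcases a4 x hx with ⟨hx', e⟩ | hl
  · rcases c4 x hx' with ⟨hx'', e'⟩ | hl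
    · left
      have := hZ (3 * (3 * K)) (by linarith) s' t' β'' c0 c1 (by rw [c2]; exact hz₁)
        (by rw [c3, a3]; exact hz₂) x hx''
      rw [e', e] at this
      rwa [show 9 * K = 3 * (3 * K) by ring]
    · right; left
      rw [e, a2] at hl
      refine hl.trans ?_
      unfold lossConst
      have : 4 * (3 * K) ^ 3 * (δ₁ + 1) = 108 * K ^ 3 * (δ₁ + 1) := by ring
      rw [this]
  · right; right
    refine hl.trans ?_
    unfold lossConst
    have : 0 ≤ K ^ 3 * (δ₂ + 1) := by positivity
    nlinarith

end Surgery

/-! ### Comparison of gauges, transfer of the Morse property -/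

/-- Replaces the intermediate value theorem along paths that may jump: a property that changes does
so between two times at most one apart. -/
theorem exists_crossing {P : ℝ → Prop} {s t : ℝ} (hst : s ≤ t) (hs : P s) (ht : ¬ P t) :
    ∃ x ∈ Icc s t, ∃ y ∈ Icc s t, x ≤ y ∧ y ≤ x + 1 ∧ P x ∧ ¬ P y := by
  have hne : {x | x ∈ Icc s t ∧ P x}.Nonempty := ⟨s, ⟨le_rfl, hst⟩, hs⟩
  have hbd : BddAbove {x | x ∈ Icc s t ∧ P x} := ⟨t, fun x hx => hx.1.2⟩
  obtain ⟨x, ⟨hx, hPx⟩, hlt⟩ := exists_lt_of_lt_csSup hne (sub_one_lt _)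
  refine ⟨x, hx, min (x + 1) t, ⟨le_min (by linarith [hx.1]) hst, min_le_right _ _⟩,
    le_min (by linarith) hx.2, min_le_left _ _, hPx, fun hP => ?_⟩
  have h1 := le_csSup hbd (show min (x + 1) t ∈ {x | x ∈ Icc s t ∧ P x} from
    ⟨⟨le_min (by linarith [hx.1]) hst, min_le_right _ _⟩, hP⟩)
  rcases min_choice (x + 1) t with h | h
  · rw [h] at h1; linarith
  · rw [h] at hP; exact ht hP

theorem exists_crossing' {P : ℝ → Prop} {s t : ℝ} (hst : s ≤ t) (hs : ¬ P s) (ht : P t) :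
    ∃ x ∈ Icc s t, ∃ y ∈ Icc s t, x ≤ y ∧ y ≤ x + 1 ∧ ¬ P x ∧ P y := by
  obtain ⟨x, hx, y, hy, h1, h2, h3, h4⟩ := exists_crossing (P := fun x => ¬ P x) hst hs (by simpa)
  exact ⟨x, hx, y, hy, h1, h2, h3, by simpa using h4⟩

variable {Y : Type*} [MetricSpace Y] {k : ℝ → ℝ}

/-- Points at distance at most a multiple of the gauge have comparable gauges. -/
theorem IsGauge.comp_dist (hk : IsGauge k) (A : ℝ) (hA : 0 ≤ A) :
    ∃ B, 1 ≤ B ∧ ∀ {Y : Type*} [MetricSpace Y] (o y z : Y), dist y z ≤ A * k (dist o y) →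
      k (dist o y) ≤ B * k (dist o z) ∧ k (dist o z) ≤ B * k (dist o y) := by
  obtain ⟨B, hB, h⟩ := hk.comp A hA
  obtain ⟨C, hC, hs⟩ := hk.sublin 1 one_pos
  refine ⟨B + (1 + (A + 1) * (1 + k C)), ?_, fun {Y} _ o y z hyz => ?_⟩
  · have := hk.pos C
    have : 0 ≤ (A + 1) * (1 + k C) := by positivity
    linarith
  have p1 := hk.pos C
  have p2 := hk.pos (dist o y)
  have p3 := hk.pos (dist o z)
  have q : 0 ≤ (A + 1) * (1 + k C) := by positivity
  constructor
  · have h1 := h (dist o y) (dist o z) dist_nonneg dist_nonneg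
      (by have := dist_triangle_right o y z; linarith)
    have : 0 ≤ (1 + (A + 1) * (1 + k C)) * k (dist o z) := by positivity
    linarith
  · have h1 : dist o z ≤ dist o y + A * k (dist o y) := by
      have := dist_triangle o y z; linarith
    have h2 := hk.mono h1
    have h3 := hk.subadd (dist o y) (A * k (dist o y)) dist_nonneg (by positivity)
    have h4 := hk.mul_le p2.le hA
    have h5 := hk.mono (hs (dist o y) dist_nonneg)
    rw [one_mul] at h5
    have h6 := hk.add_le (dist_nonneg (x := o) (y := y)) hC
    have h7 := mul_le_mul_of_nonneg_left (h5.trans h6) (by linarith : 0 ≤ A + 1)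
    have : 0 ≤ B * k (dist o y) := by positivity
    nlinarith

theorem QG.dist_le_two {K s t : ℝ} {β : ℝ → Y} (h : QG K s t β) (hK : 1 ≤ K) {x y : ℝ}
    (hx : x ∈ Icc s t) (hy : y ∈ Icc s t) (hxy : x ≤ y) (hyx : y ≤ x + 1) :
    dist (β x) (β y) ≤ 2 * K := by
  have := (h x hx y hy hxy).2
  nlinarith

/-- A quasi-geodesic with ends on `Z'` has its ends near `Z`, so `WG.near_of_ends_near` applies; a
point that is lost near an end is close to that end, which lies on `Z'`. The new gauge depends only
on `M` and `D`; this uniformity is essential for limits. -/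
theorem WG.transfer (hY : IsGeodesicSpace Y) (hk : IsGauge k) (M : ℝ → ℝ) (D : ℝ) (hD : 0 ≤ D) :
    ∃ M', ∀ (z₀ : Y) (Z Z' : Set Y), WG k z₀ Z M →
      (∀ z' ∈ Z', ∃ z ∈ Z, dist z' z ≤ D * k (dist z₀ z')) →
      (∀ z ∈ Z, ∃ z' ∈ Z', dist z z' ≤ D * k (dist z₀ z)) → WG k z₀ Z' M' := by
  have key : ∀ K, ∃ m, 1 ≤ K → ∀ (z₀ : Y) (Z Z' : Set Y), WG k z₀ Z M →
      (∀ z' ∈ Z', ∃ z ∈ Z, dist z' z ≤ D * k (dist z₀ z')) →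
      (∀ z ∈ Z, ∃ z' ∈ Z', dist z z' ≤ D * k (dist z₀ z)) →
      ∀ (s t : ℝ) (β : ℝ → Y), s ≤ t → QG K s t β → β s ∈ Z' → β t ∈ Z' →
        ∀ x ∈ Icc s t, ∃ z ∈ Z', dist (β x) z ≤ m * k (dist z₀ (β x)) := by
    intro K
    by_cases hK : 1 ≤ K
    swap
    · exact ⟨0, fun h => absurd h hK⟩
    have hl := one_le_lossConst hK
    obtain ⟨B, hB, hb⟩ := hk.comp_dist (lossConst K * (D + 1)) (by positivity)
    obtain ⟨B₂, hB₂, hb₂⟩ := hk.comp_dist |M (9 * K)| (abs_nonneg _)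
    refine ⟨|M (9 * K)| + D * B₂ + lossConst K * (D + 1) * B, fun _ z₀ Z Z' hZ h1 h2 s t β hst hβ hs ht x hx => ?_⟩
    have p := hk.pos (dist z₀ (β x))
    have hend : ∀ w ∈ Z', dist (β x) w ≤ lossConst K * (D * k (dist z₀ w) + 1) →
        ∃ z ∈ Z', dist (β x) z ≤ (|M (9 * K)| + D * B₂ + lossConst K * (D + 1) * B) *
          k (dist z₀ (β x)) := by
      intro w hw h
      refine ⟨w, hw, ?_⟩
      have h3 : lossConst K * (D * k (dist z₀ w) + 1) ≤ lossConst K * (D + 1) * k (dist z₀ w) := by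
        have := hk.one_le (dist z₀ w)
        rw [mul_assoc]
        exact mul_le_mul_of_nonneg_left (by linarith) (by linarith)
      have h4 := (hb z₀ w (β x) (by rw [dist_comm]; exact h.trans h3)).1
      have h5 := mul_le_mul_of_nonneg_left h4 (by positivity : 0 ≤ lossConst K * (D + 1))
      have : 0 ≤ (|M (9 * K)| + D * B₂) * k (dist z₀ (β x)) := by positivity
      linarith
    obtain ⟨z₁, hz₁, hd₁⟩ := h1 _ hs
    obtain ⟨z₂, hz₂, hd₂⟩ := h1 _ ht
    rcases hZ.near_of_ends_near hY hβ hK hst hz₁ hz₂ hd₁ hd₂ x hx with ⟨z, hz, h⟩ | h | h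
    · have h' : dist (β x) z ≤ |M (9 * K)| * k (dist z₀ (β x)) :=
        h.trans (mul_le_mul_of_nonneg_right (le_abs_self _) p.le)
      obtain ⟨z', hz', h3⟩ := h2 z hz
      refine ⟨z', hz', ?_⟩
      have h4 := mul_le_mul_of_nonneg_left (hb₂ z₀ _ _ h').2 hD
      have h5 := dist_triangle (β x) z z'
      have : 0 ≤ lossConst K * (D + 1) * B * k (dist z₀ (β x)) := by positivity
      linarith
    · exact hend _ hs h
    · exact hend _ ht h
  choose M' hM' using key
  exact ⟨M', fun z₀ Z Z' hZ h1 h2 K hK => hM' K hK z₀ Z Z' hZ h1 h2⟩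

theorem WG.change_base (hk : IsGauge k) {M : ℝ → ℝ} {z₀ z₁ : Y} {Z : Set Y} {D : ℝ}
    (h : WG k z₀ Z M) (hd : dist z₀ z₁ ≤ D) : WG k z₁ Z (fun K => |M K| * (1 + k D)) := by
  intro K hK s t β hst hβ hs ht x hx
  obtain ⟨z, hz, h1⟩ := h K hK s t β hst hβ hs ht x hx
  refine ⟨z, hz, h1.trans ?_⟩
  have h2 : dist z₀ (β x) ≤ dist z₁ (β x) + D := by
    have := dist_triangle z₀ z₁ (β x); linarith
  have h3 := (hk.mono h2).trans (hk.add_le dist_nonneg (dist_nonneg.trans hd))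
  calc M K * k (dist z₀ (β x)) ≤ |M K| * k (dist z₀ (β x)) :=
        mul_le_mul_of_nonneg_right (le_abs_self _) (hk.pos _).le
    _ ≤ |M K| * ((1 + k D) * k (dist z₁ (β x))) := mul_le_mul_of_nonneg_left h3 (abs_nonneg _)
    _ = _ := by ring

/-! ### Geodesic rays -/

/-- `A` is geodesic on `[0, ℓ]`. -/
def GeodOn (A : ℝ → Y) (ℓ : ℝ) : Prop :=
  ∀ s ∈ Icc 0 ℓ, ∀ t ∈ Icc 0 ℓ, dist (A s) (A t) = |s - t|

/-- `A` is a geodesic ray. -/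
def GRay (A : ℝ → Y) : Prop := ∀ s, 0 ≤ s → ∀ t, 0 ≤ t → dist (A s) (A t) = |s - t|

theorem GRay.geodOn {A : ℝ → Y} (h : GRay A) (ℓ : ℝ) : GeodOn A ℓ :=
  fun s hs t ht => h s hs.1 t ht.1

theorem GeodOn.qg {A : ℝ → Y} {ℓ : ℝ} (h : GeodOn A ℓ) : QG 1 0 ℓ A := by
  intro x hx y hy hxy
  rw [h x hx y hy, abs_sub_comm, abs_of_nonneg (by linarith)]
  constructor <;> linarith

/-- Let `β` have its ends on the segment. If a point of `β` is near the ray only beyond `A ℓ`, then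
`β` passes `A ℓ` closely both before and after this point. The time between the two passages is then
bounded by a multiple of the gauge at `A ℓ`, so the whole excursion stays near `A ℓ`. -/
theorem WG.segment (hk : IsGauge k) (M : ℝ → ℝ) :
    ∃ M', ∀ (z₀ : Y) (A : ℝ → Y), GRay A → WG k z₀ (A '' Ici 0) M →
      ∀ ℓ, 0 ≤ ℓ → WG k z₀ (A '' Icc 0 ℓ) M' := by
  have key : ∀ K, ∃ m, 1 ≤ K → ∀ (z₀ : Y) (A : ℝ → Y), GRay A → WG k z₀ (A '' Ici 0) M →
      ∀ ℓ, 0 ≤ ℓ → ∀ (s t : ℝ) (β : ℝ → Y), s ≤ t → QG K s t β → β s ∈ A '' Icc 0 ℓ →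
        β t ∈ A '' Icc 0 ℓ → ∀ x ∈ Icc s t, ∃ z ∈ A '' Icc 0 ℓ,
          dist (β x) z ≤ m * k (dist z₀ (β x)) := by
    intro K
    by_cases hK : 1 ≤ K
    swap
    · exact ⟨0, fun h => absurd h hK⟩
    set m := |M K| with hm
    have hm0 : 0 ≤ m := abs_nonneg _
    obtain ⟨B₀, hB₀, hb₀⟩ := hk.comp_dist (2 * K) (by positivity)
    set A₁ := 2 * m + 2 * K + m * B₀ with hA₁
    obtain ⟨B₁, hB₁, hb₁⟩ := hk.comp_dist A₁ (by positivity)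
    set A₂ := K * (K * (2 * (A₁ * B₁) + K)) + K + A₁ * B₁ with hA₂
    have hA₁0 : 0 ≤ A₁ := by positivity
    have hA₂0 : 0 ≤ A₂ := by positivity
    obtain ⟨B₂, hB₂, hb₂⟩ := hk.comp_dist A₂ hA₂0
    refine ⟨m + A₂ * B₂, fun _ z₀ A hA hW ℓ hℓ s t β hst hβ hs ht x hx => ?_⟩
    have near : ∀ y ∈ Icc s t, ∃ τ, 0 ≤ τ ∧ dist (β y) (A τ) ≤ m * k (dist z₀ (β y)) := by
      intro y hy
      obtain ⟨_, ⟨τ, hτ, rfl⟩, h⟩ := hW K hK s t β hst hβ (image_mono Icc_subset_Ici_self hs)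
        (image_mono Icc_subset_Ici_self ht) y hy
      exact ⟨τ, hτ, h.trans (mul_le_mul_of_nonneg_right (le_abs_self _) (hk.pos _).le)⟩
    let P : ℝ → Prop := fun y => ∃ τ, 0 ≤ τ ∧ τ ≤ ℓ ∧ dist (β y) (A τ) ≤ m * k (dist z₀ (β y))
    have hPz : ∀ y, β y ∈ A '' Icc 0 ℓ → P y := by
      rintro y ⟨τ, hτ, h⟩
      refine ⟨τ, hτ.1, hτ.2, ?_⟩
      rw [h, dist_self]; exact mul_nonneg hm0 (hk.pos _).le
    have px := hk.pos (dist z₀ (β x))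
    by_cases hPx : P x
    · obtain ⟨τ, h1, h2, h3⟩ := hPx
      refine ⟨A τ, ⟨τ, ⟨h1, h2⟩, rfl⟩, h3.trans ?_⟩
      have : 0 ≤ A₂ * B₂ * k (dist z₀ (β x)) := by positivity
      linarith
    have step : ∀ y ∈ Icc s t, ∀ y' ∈ Icc s t, dist (β y) (β y') ≤ 2 * K → P y → ¬ P y' →
        dist (β y') (A ℓ) ≤ A₁ * B₁ * k (dist z₀ (A ℓ)) := by
      rintro y hy y' hy' hd ⟨τ, h1, h2, h3⟩ hn
      obtain ⟨τ', g1, g3⟩ := near y' hy'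
      have g2 : ℓ < τ' := by
        by_contra hc
        exact hn ⟨τ', g1, not_lt.1 hc, g3⟩
      have p := hk.one_le (dist z₀ (β y'))
      have c1 := (hb₀ z₀ (β y') (β y) (by
        rw [dist_comm]; refine hd.trans ?_; nlinarith)).2
      have c2 := hA τ h1 τ' g1
      rw [abs_sub_comm, abs_of_nonneg (by linarith)] at c2
      have c3 : dist (A τ) (A τ') ≤ dist (β y) (A τ) + dist (β y) (β y') + dist (β y') (A τ') := by
        have := dist_triangle4 (A τ) (β y) (β y') (A τ')
        rwa [dist_comm (A τ) (β y)] at this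
      have c4 := hA τ' g1 ℓ hℓ
      rw [abs_of_nonneg (by linarith)] at c4
      have c5 := dist_triangle (β y') (A τ') (A ℓ)
      have c6 := mul_le_mul_of_nonneg_left c1 hm0
      have c7 : dist (β y') (A ℓ) ≤ A₁ * k (dist z₀ (β y')) := by
        rw [hA₁]; nlinarith
      have c8 := mul_le_mul_of_nonneg_left (hb₁ _ _ _ c7).1 hA₁0
      linarith
    obtain ⟨y₁, hy₁, y₁', hy₁', l1, l2, l3, l4⟩ := exists_crossing hx.1 (hPz s hs) hPx
    obtain ⟨y₂, hy₂, y₂', hy₂', r1, r2, r3, r4⟩ := exists_crossing' hx.2 hPx (hPz t ht)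
    have I1 : ∀ {y}, y ∈ Icc s x → y ∈ Icc s t := fun h => ⟨h.1, h.2.trans hx.2⟩
    have I2 : ∀ {y}, y ∈ Icc x t → y ∈ Icc s t := fun h => ⟨hx.1.trans h.1, h.2⟩
    have d1 := step y₁ (I1 hy₁) y₁' (I1 hy₁') (hβ.dist_le_two hK (I1 hy₁) (I1 hy₁') l1 l2) l3 l4
    have d2 := step y₂' (I2 hy₂') y₂ (I2 hy₂) (by
      rw [dist_comm]; exact hβ.dist_le_two hK (I2 hy₂) (I2 hy₂') r1 r2) r4 r3
    have e1 := (hβ y₁' (I1 hy₁') y₂ (I2 hy₂) (hy₁'.2.trans hy₂.1)).1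
    have e2 := dist_triangle_right (β y₁') (β y₂) (A ℓ)
    have e3 := (hβ y₁' (I1 hy₁') x hx hy₁'.2).2
    have e4 := dist_triangle (β x) (β y₁') (A ℓ)
    rw [dist_comm (β x) (β y₁')] at e4
    set kl := k (dist z₀ (A ℓ)) with hkl
    have pl : 1 ≤ kl := hk.one_le _
    have e5 : (y₂ - y₁') / K ≤ 2 * (A₁ * B₁) * kl + K := by linarith
    rw [div_le_iff₀ (by linarith)] at e5
    have e6 : x - y₁' ≤ (2 * (A₁ * B₁) * kl + K) * K := by linarith [hy₂.1]
    have e7 : K * (x - y₁') ≤ K * ((2 * (A₁ * B₁) * kl + K) * K) :=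
      mul_le_mul_of_nonneg_left e6 (by linarith)
    have e8 : dist (β x) (A ℓ) ≤ A₂ * kl := by
      have f1 : K * K * K ≤ K * K * K * kl := le_mul_of_one_le_right (by positivity) pl
      have f2 : K ≤ K * kl := le_mul_of_one_le_right (by positivity) pl
      rw [hA₂]; nlinarith
    refine ⟨A ℓ, ⟨ℓ, ⟨hℓ, le_rfl⟩, rfl⟩, e8.trans ?_⟩
    have e9 := mul_le_mul_of_nonneg_left (hb₂ z₀ (A ℓ) (β x) (by rw [dist_comm]; exact e8)).1 hA₂0
    have : 0 ≤ m * k (dist z₀ (β x)) := by positivity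
    linarith
  choose M' hM' using key
  exact ⟨M', fun z₀ A hA hW ℓ hℓ K hK => hM' K hK z₀ A hA hW ℓ hℓ⟩

/-- A quasi-geodesic ray that comes back to a Morse ray again and again stays near this ray. -/
theorem WG.near_of_follows (hY : IsGeodesicSpace Y) (hk : IsGauge k) {M : ℝ → ℝ} {o : Y}
    {α σ : ℝ → Y} (hW : WG k o (α '' Ici 0) M) {K : ℝ} (hK : 1 ≤ K) (hσ : ∀ t, QG K 0 t σ)
    {δ n : ℝ} (h0 : dist (σ 0) (α 0) ≤ δ) (hn : 0 ≤ n)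
    (hf : ∀ X, ∃ x, X ≤ x ∧ ∃ s, 0 ≤ s ∧ dist (σ x) (α s) ≤ n * k (dist o (σ x)))
    (x : ℝ) (hx : 0 ≤ x) :
    (∃ s, 0 ≤ s ∧ dist (σ x) (α s) ≤ M (9 * K) * k (dist o (σ x))) ∨
      dist (σ x) (σ 0) ≤ lossConst K * (δ + 1) := by
  have hl := one_le_lossConst hK
  -- The return time `y` is taken so late that the sublinear loss at the far end cannot reach back
  -- to `σ x`, whose distance from `σ y` grows linearly in `y`.
  obtain ⟨T, hT⟩ := eventually_atTop.1 (hk.eventually_le (K * K * (lossConst K * n))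
    (K * K * (lossConst K + x / K + K + 1) + (dist o (σ 0) + K)) (by positivity))
  obtain ⟨y, hy, s, hs, hd⟩ := hf (max x T)
  have hxy : x ≤ y := (le_max_left _ _).trans hy
  have hy0 := hx.trans hxy
  have hTy : T ≤ y := (le_max_right _ _).trans hy
  have d0 := dist_nonneg (x := o) (y := σ 0)
  have h1 := hT (dist o (σ 0) + (K * y + K)) (by nlinarith)
  have h2 := (hσ y 0 ⟨le_rfl, hy0⟩ y ⟨hy0, le_rfl⟩ hy0).2
  have h3 := hk.mono (show dist o (σ y) ≤ dist o (σ 0) + (K * y + K) by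
    have := dist_triangle o (σ 0) (σ y); simp only [sub_zero] at h2; linarith)
  rcases hW.near_of_ends_near hY (hσ y) hK hy0 ⟨0, mem_Ici.2 le_rfl, rfl⟩ ⟨s, hs, rfl⟩ h0 hd x ⟨hx, hxy⟩ with
    ⟨_, ⟨u, hu, rfl⟩, h⟩ | h | h
  · exact Or.inl ⟨u, hu, h⟩
  · exact Or.inr h
  · exfalso
    have h4 := (hσ y x ⟨hx, hxy⟩ y ⟨hy0, le_rfl⟩ hxy).1
    have h5 : lossConst K * n * k (dist o (σ y)) ≤
        lossConst K * n * k (dist o (σ 0) + (K * y + K)) := mul_le_mul_of_nonneg_left h3 (by positivity)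
    have h6 : (y - x) / K ≤ lossConst K * n * k (dist o (σ 0) + (K * y + K)) + lossConst K + K := by
      nlinarith
    have h7 : y ≤ K * (lossConst K * n * k (dist o (σ 0) + (K * y + K)) + lossConst K + K + x / K) := by
      have : (y - x) / K = y / K - x / K := sub_div _ _ _
      rw [this] at h6
      have h8 : y = K * (y / K) := by field_simp
      exact h8.le.trans (mul_le_mul_of_nonneg_left (by linarith) (by linarith))
    have h8 := mul_le_mul_of_nonneg_left h7 (by linarith : 0 ≤ K)
    nlinarith

/-- A Morse ray is near each ray that follows it. -/
theorem GRay.near_follower (hk : IsGauge k) (K m D : ℝ) (hK : 1 ≤ K) (hm : 0 ≤ m) (hD : 0 ≤ D) :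
    ∃ U C₀, 0 ≤ U ∧ 0 ≤ C₀ ∧ ∀ {Y : Type*} [MetricSpace Y] (o : Y) (α σ : ℝ → Y) (δ : ℝ), GRay α →
      dist o (α 0) ≤ D → (∀ t, QG K 0 t σ) → dist (σ 0) (α 0) ≤ δ →
      (∀ x, 0 ≤ x → (∃ s, 0 ≤ s ∧ dist (σ x) (α s) ≤ m * k (dist o (σ x))) ∨
        dist (σ x) (σ 0) ≤ lossConst K * (δ + 1)) →
      ∀ t, C₀ * (δ + 1) ≤ t → ∃ x, 0 ≤ x ∧ dist (α t) (σ x) ≤ U * k (dist o (α t)) := by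
  have hl := one_le_lossConst hK
  obtain ⟨C, hC, hs⟩ := hk.sublin 1 one_pos
  obtain ⟨B₀, hB₀, hb₀⟩ := hk.comp_dist (2 * K) (by positivity)
  set A₁ := 2 * m + 2 * K + m * B₀ with hA₁
  have hA₁0 : 0 ≤ A₁ := by positivity
  obtain ⟨B₁, hB₁, hb₁⟩ := hk.comp_dist A₁ hA₁0
  set c₁ := D + 1 + lossConst K + 2 * K with hc₁
  have hc₁0 : 0 ≤ c₁ := by positivity
  refine ⟨A₁ * B₁, c₁ + m * ((c₁ + 1) * (1 + C)), by positivity, by positivity, ?_⟩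
  intro Y _ o α σ δ hα hoα hσ hδ hnear t ht
  have hδ0 : 0 ≤ δ := dist_nonneg.trans hδ
  have ht0 : 0 ≤ t := le_trans (by positivity) ht
  -- `P x` says that `σ x` has not yet passed `α t`. It holds at the start and fails far out; where
  -- it changes, `σ` is near `α t`.
  let P : ℝ → Prop := fun x => (∃ s, 0 ≤ s ∧ s ≤ t ∧ dist (σ x) (α s) ≤ m * k (dist o (σ x))) ∨
        dist (σ x) (σ 0) ≤ lossConst K * (δ + 1)
  have hP0 : P 0 := Or.inr (by rw [dist_self]; positivity)
  obtain ⟨T, hT⟩ := eventually_atTop.1 (hk.eventually_le m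
    (D + t + lossConst K * (δ + 1) + dist o (σ 0) + 1) hm)
  have hfar : ∃ X, 0 ≤ X ∧ ¬ P X := by
    refine ⟨K * (max T 0 + K + dist o (σ 0)), by positivity, ?_⟩
    set X := K * (max T 0 + K + dist o (σ 0)) with hX
    have hX0 : 0 ≤ X := by positivity
    have h1 := (hσ X 0 ⟨le_rfl, hX0⟩ X ⟨hX0, le_rfl⟩ hX0).1
    have h2 : (X - 0) / K = max T 0 + K + dist o (σ 0) := by rw [hX, sub_zero]; field_simp
    rw [h2] at h1
    have h3 := dist_triangle_left (σ 0) (σ X) o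
    have h4 := hT (dist o (σ X)) (by linarith [le_max_left T 0])
    rintro (⟨s, s0, st, h⟩ | h)
    · have h5 := hα 0 le_rfl s s0
      rw [abs_sub_comm, sub_zero, abs_of_nonneg s0] at h5
      have h6 := dist_triangle o (α s) (σ X)
      have h7 := dist_triangle o (α 0) (α s)
      rw [dist_comm (α s)] at h6
      have : 0 ≤ lossConst K * (δ + 1) := by positivity
      linarith [dist_nonneg (x := o) (y := σ 0)]
    · have h6 := dist_triangle o (σ 0) (σ X)
      rw [dist_comm (σ 0)] at h6
      have : 0 ≤ m * k (dist o (σ X)) := mul_nonneg hm (hk.pos _).le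
      linarith
  obtain ⟨X, hX0, hX⟩ := hfar
  obtain ⟨x, hx, y, hy, xy, yx, hPx, hPy⟩ := exists_crossing hX0 hP0 hX
  have hd := (hσ X).dist_le_two hK hx hy xy yx
  obtain ⟨s', s0', hs'⟩ : ∃ s, 0 ≤ s ∧ dist (σ y) (α s) ≤ m * k (dist o (σ y)) := by
    rcases hnear y hy.1 with h | h
    · exact h
    · exact absurd (Or.inr h) hPy
  have hts' : t < s' := by
    by_contra hc
    exact hPy (Or.inl ⟨s', s0', not_lt.1 hc, hs'⟩)
  have py := hk.one_le (dist o (σ y))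
  rcases hPx with ⟨s, s0, st, h⟩ | h
  · refine ⟨y, hy.1, ?_⟩
    have c1 := (hb₀ o (σ y) (σ x) (by rw [dist_comm]; refine hd.trans ?_; nlinarith)).2
    have c2 := hα s s0 s' s0'
    rw [abs_sub_comm, abs_of_nonneg (by linarith)] at c2
    have c3 := dist_triangle4 (α s) (σ x) (σ y) (α s')
    rw [dist_comm (α s) (σ x)] at c3
    have c4 := hα s' s0' t ht0
    rw [abs_of_nonneg (by linarith)] at c4
    have c5 := dist_triangle (σ y) (α s') (α t)
    have c6 := mul_le_mul_of_nonneg_left c1 hm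
    have c7 : dist (σ y) (α t) ≤ A₁ * k (dist o (σ y)) := by rw [hA₁]; nlinarith
    have c8 := mul_le_mul_of_nonneg_left (hb₁ _ _ _ c7).1 hA₁0
    rw [dist_comm]; linarith
  -- If `σ x` still belonged to the lost initial part, then `σ y` would be near a point `α s'` with
  -- `s' ≤ C₀ * (δ + 1) ≤ t`, contrary to `t < s'`.
  · exfalso
    have c2 := hα 0 le_rfl s' s0'
    rw [abs_sub_comm, sub_zero, abs_of_nonneg s0'] at c2
    have c3 := dist_triangle4 (α 0) (σ 0) (σ x) (σ y)
    have c4 := dist_triangle (α 0) (σ y) (α s')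
    rw [dist_comm (α 0) (σ 0), dist_comm (σ 0) (σ x)] at c3
    have c5 := dist_triangle o (α 0) (σ y)
    have c6 : dist o (σ y) ≤ c₁ * (δ + 1) := by rw [hc₁]; nlinarith
    have c7 := (hk.mono c6).trans (hk.mul_le (by linarith : 0 ≤ δ + 1) hc₁0)
    have c8 := hs (δ + 1) (by linarith)
    have c9 : k (δ + 1) ≤ (1 + C) * (δ + 1) := by nlinarith
    have c10 := mul_le_mul_of_nonneg_left (c7.trans (mul_le_mul_of_nonneg_left c9 (by linarith))) hm
    have c11 : s' ≤ c₁ * (δ + 1) + m * ((c₁ + 1) * ((1 + C) * (δ + 1))) := by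
      have : δ + (lossConst K * (δ + 1)) + 2 * K ≤ c₁ * (δ + 1) := by rw [hc₁]; nlinarith
      linarith
    have c12 : (c₁ + m * ((c₁ + 1) * (1 + C))) * (δ + 1) =
      c₁ * (δ + 1) + m * ((c₁ + 1) * ((1 + C) * (δ + 1))) := by ring
    linarith

/-- Two Morse rays that do not follow each other: every geodesic that ends near their starting
point diverges linearly from one of them. -/
theorem exists_divergent (hY : IsGeodesicSpace Y) (hk : IsGauge k) {o : Y} {M : ℝ → ℝ} {D : ℝ}
    (hD : 0 ≤ D) {φ₁ φ₂ : ℝ → Y} (hφ₁ : GRay φ₁) (hφ₂ : GRay φ₂) (h₁ : dist o (φ₁ 0) ≤ D)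
    (h₂ : dist o (φ₂ 0) ≤ D) (hW₁ : WG k o (φ₁ '' Ici 0) M) (hW₂ : WG k o (φ₂ '' Ici 0) M)
    (hn : ∀ n, ∃ X, ∀ x, X ≤ x → ∀ s, 0 ≤ s → n * k (dist o (φ₁ x)) < dist (φ₁ x) (φ₂ s)) :
    ∃ E, 0 ≤ E ∧ ∀ E', E ≤ E' → ∀ (A : ℝ → Y) (ℓ : ℝ), GeodOn A ℓ → dist o (A ℓ) ≤ D →
      (∀ s ∈ Icc 0 ℓ, ∀ r, 0 ≤ r → (1 / 1000) * (ℓ - s + r) - E' ≤ dist (A s) (φ₁ r)) ∨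
      (∀ s ∈ Icc 0 ℓ, ∀ r, 0 ≤ r → (1 / 1000) * (ℓ - s + r) - E' ≤ dist (A s) (φ₂ r)) := by
  set m := |M 9| with hm
  have hm0 : 0 ≤ m := abs_nonneg _
  obtain ⟨B, hB, hb⟩ := hk.comp_dist m hm0
  obtain ⟨X, hX⟩ := hn (2 * m * B)
  obtain ⟨T, hT⟩ := eventually_atTop.1 (hk.eventually_le m (D + X) hm0)
  -- At distance `x` from `A ℓ` the geodesic is beyond the loss `108 * (2 * D + 1)` at its end, and
  -- so far from `o` that a nearby point of `φ₁` has parameter at least `X`.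
  set x := max T 0 + D + 108 * (2 * D + 1) + 1 with hx
  have hx0 : 0 < x := by positivity
  refine ⟨2 * D + 1 + x, by positivity, fun E' hE' A ℓ hA hℓ => ?_⟩
  by_contra hcon
  rw [not_or] at hcon
  push Not at hcon
  -- If `A` does not diverge from `φ`, then the piece of `A` between `A s` and `A ℓ` has both ends
  -- near `φ`, with an error of at most `3 / 1000` of its length `y`. As `108 * 3 / 1000 < 1`, the
  -- point at distance `x` from `A ℓ` survives the surgery and is near `φ`. If this happened for
  -- both rays, they would be near each other there.
  have main : ∀ φ : ℝ → Y, GRay φ → dist o (φ 0) ≤ D → WG k o (φ '' Ici 0) M →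
      (∃ s ∈ Icc 0 ℓ, ∃ r, 0 ≤ r ∧ dist (A s) (φ r) < (1 / 1000) * (ℓ - s + r) - E') →
      x ≤ ℓ ∧ ∃ u, 0 ≤ u ∧ dist (A (ℓ - x)) (φ u) ≤ m * k (dist o (A (ℓ - x))) := by
    rintro φ hφ h0 hW ⟨s, hs, r, hr, hd⟩
    set y := ℓ - s with hy
    have hy0 : 0 ≤ y := by linarith [hs.2]
    have hℓ0 : 0 ≤ ℓ := hs.1.trans hs.2
    have e1 := hA s hs ℓ ⟨hℓ0, le_rfl⟩
    rw [abs_sub_comm, abs_of_nonneg (by linarith)] at e1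
    have e2 := hφ 0 le_rfl r hr
    rw [abs_sub_comm, sub_zero, abs_of_nonneg hr] at e2
    have e3 := dist_triangle4 (φ 0) o (A ℓ) (φ r)
    have e4 := dist_triangle (A ℓ) (A s) (φ r)
    rw [dist_comm (φ 0) o] at e3
    rw [dist_comm (A ℓ) (A s)] at e4
    have e5 : r ≤ 2 * y := by linarith [dist_nonneg (x := A s) (y := φ r)]
    have e6 : dist (A s) (φ r) ≤ 3 / 1000 * y - E' := by linarith
    have e7 : 0 ≤ 3 / 1000 * y - E' := dist_nonneg.trans e6
    have hβ : QG 1 0 y (fun z => A (ℓ - z)) := by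
      intro a ha b hb hab
      rw [hA _ ⟨by linarith [ha.2, hs.1], by linarith [ha.1]⟩ _
        ⟨by linarith [hb.2, hs.1], by linarith [hb.1]⟩, abs_of_nonneg (by linarith)]
      constructor <;> linarith
    have hxy : x ≤ y := by linarith
    refine ⟨by linarith [hs.1], ?_⟩
    have hloss : lossConst 1 = 108 := by unfold lossConst; norm_num
    rcases hW.near_of_ends_near hY hβ le_rfl hy0 ⟨0, mem_Ici.2 le_rfl, rfl⟩ ⟨r, hr, rfl⟩ (δ₁ := 2 * D)
      (δ₂ := 3 / 1000 * y - E') (by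
        simp only [sub_zero]
        have := dist_triangle_left (A ℓ) (φ 0) o; linarith) (by
        rw [show ℓ - y = s by rw [hy]; ring]; exact e6) x ⟨hx0.le, hxy⟩ with
      ⟨_, ⟨u, hu, rfl⟩, h⟩ | h | h
    · refine ⟨u, hu, h.trans ?_⟩
      rw [mul_one]
      exact mul_le_mul_of_nonneg_right (le_abs_self _) (hk.pos _).le
    · exfalso
      rw [hloss, sub_zero, hA _ ⟨by linarith [hs.1], by linarith⟩ _ ⟨hℓ0, le_rfl⟩, abs_sub_comm,
        abs_of_nonneg (by linarith)] at h
      have : x ≤ 108 * (2 * D + 1) := by linarith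
      have := le_max_right T 0
      linarith
    · exfalso
      rw [hloss, hA _ ⟨by linarith [hs.1], by linarith⟩ _ ⟨by linarith [hs.1], by linarith⟩,
        abs_of_nonneg (by linarith)] at h
      nlinarith [le_max_right T 0]
  obtain ⟨hxℓ, u, hu, hdu⟩ := main φ₁ hφ₁ h₁ hW₁ hcon.1
  obtain ⟨-, v, hv, hdv⟩ := main φ₂ hφ₂ h₂ hW₂ hcon.2
  set z := A (ℓ - x) with hz
  have g1 := hA (ℓ - x) ⟨by linarith, by linarith⟩ ℓ ⟨by linarith, le_rfl⟩
  rw [abs_sub_comm, abs_of_nonneg (by linarith)] at g1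
  have g2 : x - D ≤ dist o z := by
    have := dist_triangle_left z (A ℓ) o; linarith
  have g3 := hT (dist o z) (by linarith [le_max_left T 0])
  have g4 : X ≤ u := by
    have e2 := hφ₁ 0 le_rfl u hu
    rw [abs_sub_comm, sub_zero, abs_of_nonneg hu] at e2
    have e3 := dist_triangle4 o (φ₁ 0) (φ₁ u) z
    rw [dist_comm (φ₁ u)] at e3
    linarith
  have g5 := hX u g4 v hv
  have g6 := dist_triangle_left (φ₁ u) (φ₂ v) z
  have g7 := mul_le_mul_of_nonneg_left (hb o z (φ₁ u) hdu).1 hm0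
  nlinarith

/-! ### Concatenations of Morse segments of rapidly increasing length -/

variable {Y : Type*} [MetricSpace Y] {k : ℝ → ℝ}

/-- The sum of the first `i` lengths. -/
noncomputable def partialLength (ℓ : ℕ → ℝ) (i : ℕ) : ℝ := ∑ j ∈ Finset.range i, ℓ j

/-- Morse segments `X i` of rapidly increasing lengths `ℓ i`, from `m i` to `m (i + 1)`, such that
consecutive segments diverge linearly. -/
structure Concat (k : ℝ → ℝ) (X : ℕ → ℝ → Y) (m : ℕ → Y) (ℓ : ℕ → ℝ) (e D E : ℝ) (M : ℝ → ℝ) :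
    Prop where
  e_pos : 0 < e
  e_le : e ≤ 1
  D_nonneg : 0 ≤ D
  E_nonneg : 0 ≤ E
  geod : ∀ i, GeodOn (X i) (ℓ i)
  start : ∀ i, dist (m i) (X i 0) ≤ D
  finish : ∀ i, dist (m (i + 1)) (X i (ℓ i)) ≤ D
  morse : ∀ i, WG k (m i) (X i '' Icc 0 (ℓ i)) M
  diverge : ∀ i, ∀ s ∈ Icc 0 (ℓ i), ∀ r ∈ Icc 0 (ℓ (i + 1)),
    e * (ℓ i - s + r) - E ≤ dist (X i s) (X (i + 1) r)
  -- The cube leaves room against `threshold`, which carries only one factor `i + 1`.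
  growth : ∀ i : ℕ, 4 * (E + 4 * D + 3) * (i + 1) ^ 3 * (partialLength ℓ i + 1) ≤ e * ℓ i

theorem partialLength_succ (ℓ : ℕ → ℝ) (i : ℕ) :
    partialLength ℓ (i + 1) = partialLength ℓ i + ℓ i := Finset.sum_range_succ _ _

namespace Concat

variable {X : ℕ → ℝ → Y} {m : ℕ → Y} {ℓ : ℕ → ℝ} {e D E : ℝ} {M : ℝ → ℝ}

theorem le_partialLength (h : Concat k X m ℓ e D E M) (i : ℕ) : (i : ℝ) ≤ partialLength ℓ i := by
  induction i with
  | zero => simp [partialLength]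
  | succ i ih =>
    have h1 := h.growth i
    have hD := h.D_nonneg
    have hE := h.E_nonneg
    have h2 : (1 : ℝ) ≤ (i + 1) ^ 3 := one_le_pow₀ (by linarith [Nat.cast_nonneg (α := ℝ) i])
    have h3 : 0 ≤ partialLength ℓ i := le_trans (Nat.cast_nonneg _) ih
    have h4 : 1 * 1 * 1 ≤ 4 * (E + 4 * D + 3) * (i + 1) ^ 3 * (partialLength ℓ i + 1) := by
      gcongr <;> linarith
    have h5 : 1 ≤ ℓ i := by
      by_contra hc
      have := mul_lt_mul_of_pos_left (not_le.1 hc) h.e_pos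
      linarith [h.e_le]
    rw [partialLength_succ]; push_cast; linarith

theorem partialLength_nonneg (h : Concat k X m ℓ e D E M) (i : ℕ) : 0 ≤ partialLength ℓ i :=
  le_trans (Nat.cast_nonneg _) (h.le_partialLength i)

theorem growth_sq (h : Concat k X m ℓ e D E M) (i : ℕ) :
    4 * (E + 4 * D + 3) * (partialLength ℓ i + 1) ≤ e * ℓ i := by
  have h1 := h.growth i
  have hD := h.D_nonneg
  have hE := h.E_nonneg
  have h0 := h.partialLength_nonneg i
  have h2 : (1 : ℝ) ≤ (i + 1) ^ 3 := one_le_pow₀ (by linarith [Nat.cast_nonneg (α := ℝ) i])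
  have : 0 ≤ 4 * (E + 4 * D + 3) * (partialLength ℓ i + 1) := by positivity
  nlinarith

theorem len_large (h : Concat k X m ℓ e D E M) (i : ℕ) : partialLength ℓ i + 1 ≤ ℓ i := by
  have h1 := h.growth_sq i
  have hD := h.D_nonneg
  have hE := h.E_nonneg
  have h0 := h.partialLength_nonneg i
  by_contra hc
  have h3 := mul_lt_mul_of_pos_left (not_le.1 hc) h.e_pos
  have h4 : e * (partialLength ℓ i + 1) ≤ 1 * (partialLength ℓ i + 1) :=
    mul_le_mul_of_nonneg_right h.e_le (by linarith)
  nlinarith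

theorem len_pos (h : Concat k X m ℓ e D E M) (i : ℕ) : 1 ≤ ℓ i := by
  linarith [h.len_large i, h.partialLength_nonneg i]

theorem partialLength_mono (h : Concat k X m ℓ e D E M) {i j : ℕ} (hij : i ≤ j) :
    partialLength ℓ i + (j - i : ℝ) ≤ partialLength ℓ j := by
  induction j, hij using Nat.le_induction with
  | base => simp
  | succ j _ ih =>
    rw [partialLength_succ]; push_cast; linarith [h.len_pos j]

theorem dist_le_of_mem (h : Concat k X m ℓ e D E M) (i : ℕ) {s t : ℝ} (hs : s ∈ Icc 0 (ℓ i))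
    (ht : t ∈ Icc 0 (ℓ i)) (hst : s ≤ t) : dist (X i s) (X i t) = t - s := by
  rw [h.geod i s hs t ht, abs_sub_comm, abs_of_nonneg (by linarith)]

theorem zero_mem (h : Concat k X m ℓ e D E M) (i : ℕ) : (0 : ℝ) ∈ Icc 0 (ℓ i) :=
  ⟨le_rfl, by linarith [h.len_pos i]⟩

theorem len_mem (h : Concat k X m ℓ e D E M) (i : ℕ) : ℓ i ∈ Icc 0 (ℓ i) :=
  ⟨by linarith [h.len_pos i], le_rfl⟩

theorem dist_base_le (h : Concat k X m ℓ e D E M) {i j : ℕ} (hij : i ≤ j) :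
    dist (m i) (m j) ≤ partialLength ℓ j - partialLength ℓ i + 2 * D * (j - i) := by
  induction j, hij using Nat.le_induction with
  | base => simp
  | succ j _ ih =>
    have h1 := dist_triangle4 (m j) (X j 0) (X j (ℓ j)) (m (j + 1))
    have h2 := h.dist_le_of_mem j (h.zero_mem j) (h.len_mem j) (h.len_mem j).1
    have h3 := h.start j
    have h4 := h.finish j
    rw [dist_comm] at h4
    have h5 := dist_triangle (m i) (m j) (m (j + 1))
    rw [partialLength_succ]; push_cast; linarith

theorem dist_piece_le (h : Concat k X m ℓ e D E M) {i j : ℕ} (hij : i < j) {s : ℝ}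
    (hs : s ∈ Icc 0 (ℓ i)) :
    dist (X i s) (m j) ≤ partialLength ℓ j - (partialLength ℓ i + s) + 2 * D * (j - i) := by
  have h1 := h.dist_base_le (Nat.succ_le_of_lt hij)
  have h2 := h.dist_le_of_mem i hs (h.len_mem i) hs.2
  have h3 := dist_triangle4 (X i s) (X i (ℓ i)) (m (i + 1)) (m j)
  have h4 := h.finish i
  rw [dist_comm] at h4
  have hD := h.D_nonneg
  rw [Nat.succ_eq_add_one, partialLength_succ] at h1
  push_cast at h1
  linarith

theorem norm_base_le (h : Concat k X m ℓ e D E M) (j : ℕ) :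
    dist (m 0) (m j) ≤ (1 + 2 * D) * (partialLength ℓ j + 1) := by
  have h1 := h.dist_base_le (Nat.zero_le j)
  have h2 := h.le_partialLength j
  have h3 : partialLength ℓ 0 = 0 := by simp [partialLength]
  have hD := h.D_nonneg
  have : D * j ≤ D * partialLength ℓ j := mul_le_mul_of_nonneg_left h2 hD
  rw [h3] at h1
  simp only [Nat.cast_zero, sub_zero] at h1
  nlinarith

theorem norm_le (h : Concat k X m ℓ e D E M) (j : ℕ) {r : ℝ} (hr : r ∈ Icc 0 (ℓ j)) :
    dist (m 0) (X j r) ≤ (1 + 3 * D) * (partialLength ℓ j + 1) + r := by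
  have h1 := h.norm_base_le j
  have h2 := h.dist_le_of_mem j (h.zero_mem j) hr hr.1
  have h3 := dist_triangle4 (m 0) (m j) (X j 0) (X j r)
  have h4 := h.start j
  have hD := h.D_nonneg
  have := mul_nonneg hD (h.partialLength_nonneg j)
  linarith

/-- The point diverges from `X j 0`, whose norm is at most a multiple of the earlier lengths and
hence negligible against `ℓ j`. -/
theorem le_norm (h : Concat k X m ℓ e D E M) (j : ℕ) {r : ℝ} (hr : r ∈ Icc 0 (ℓ (j + 1))) :
    e / 2 * (ℓ j + r) ≤ dist (m 0) (X (j + 1) r) := by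
  have h1 := h.diverge j 0 (h.zero_mem j) r hr
  have h2 := h.norm_le j (h.zero_mem j)
  have h3 := dist_triangle_left (X j 0) (X (j + 1) r) (m 0)
  have h4 := h.growth_sq j
  have hD := h.D_nonneg
  have hE := h.E_nonneg
  have h0 := h.partialLength_nonneg j
  have h5 := mul_nonneg h.e_pos.le hr.1
  have h6 : (1 + 3 * D) * (partialLength ℓ j + 1) + E ≤
    2 * (E + 4 * D + 3) * (partialLength ℓ j + 1) := by
    nlinarith [mul_nonneg hD h0, mul_nonneg hE h0]
  linarith

/-- The lower estimate between points of different segments. -/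
theorem lower (h : Concat k X m ℓ e D E M) {i j : ℕ} (hij : i ≤ j) {s r : ℝ}
    (hs : s ∈ Icc 0 (ℓ i)) (hr : r ∈ Icc 0 (ℓ j)) (hsr : i = j → s ≤ r) :
    e / 2 * (partialLength ℓ j + r - (partialLength ℓ i + s)) - E ≤ dist (X i s) (X j r) := by
  have he := h.e_pos
  have he1 := h.e_le
  have hE := h.E_nonneg
  have hD := h.D_nonneg
  rcases eq_or_lt_of_le hij with rfl | hlt
  · rw [h.dist_le_of_mem i hs hr (hsr rfl)]
    have := hsr rfl
    nlinarith
  obtain ⟨p, rfl⟩ : ∃ p, j = p + 1 := ⟨j - 1, by omega⟩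
  rw [partialLength_succ]
  rcases eq_or_lt_of_le (Nat.le_of_lt_succ hlt) with rfl | hlt'
  · have := h.diverge i s hs r hr
    have := mul_nonneg he.le (by linarith [hs.2, hr.1] : 0 ≤ ℓ i - s + r)
    nlinarith
  -- For segments that are not adjacent, `X i s` is replaced by the start of segment `p`. The error
  -- is of the order of `partialLength ℓ p`, which is dominated by `ℓ p`.
  · have h1 := h.diverge p 0 (h.zero_mem p) r hr
    have h2 := h.dist_piece_le hlt' hs
    have h3 := dist_triangle4_left (X p 0) (X (p + 1) r) (m p) (X i s)
    have h4 := h.start p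
    have h5 := dist_triangle (X p 0) (X i s) (X (p + 1) r)
    have h6 := dist_triangle (X p 0) (m p) (X i s)
    rw [dist_comm (X p 0) (m p), dist_comm (m p) (X i s)] at h6
    have h7 := h.growth_sq p
    have h8 := h.partialLength_nonneg i
    have h9 := h.le_partialLength p
    have h0 := h.partialLength_nonneg p
    have h10 : D * (p - i) ≤ D * partialLength ℓ p :=
      mul_le_mul_of_nonneg_left (by linarith [Nat.cast_nonneg (α := ℝ) i]) hD
    have h11 : e / 2 * (partialLength ℓ p + ℓ p + r - (partialLength ℓ i + s)) ≤
        e / 2 * (ℓ p + r) + 1 / 2 * partialLength ℓ p := by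
      have : e / 2 * (partialLength ℓ p - (partialLength ℓ i + s)) ≤ 1 / 2 * partialLength ℓ p := by
        have := mul_nonneg he.le (by linarith [hs.1] : 0 ≤ partialLength ℓ i + s)
        have := mul_le_mul_of_nonneg_right he1 h0
        nlinarith
      linarith
    have h12 := mul_nonneg he.le hr.1
    have h13 : (partialLength ℓ p + 2 * (D * partialLength ℓ p)) + D + E + 1 / 2 * partialLength ℓ p ≤
      2 * (E + 4 * D + 3) * (partialLength ℓ p + 1) := by
      nlinarith [mul_nonneg hD h0, mul_nonneg hE h0]
    nlinarith [hs.1]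

/-- The upper estimate between points of different segments. -/
theorem upper (h : Concat k X m ℓ e D E M) {i j : ℕ} (hij : i ≤ j) {s r : ℝ}
    (hs : s ∈ Icc 0 (ℓ i)) (hr : r ∈ Icc 0 (ℓ j)) (hsr : i = j → s ≤ r) :
    dist (X i s) (X j r) ≤
      (1 + 2 * D) * (partialLength ℓ j + r - (partialLength ℓ i + s)) + 3 * D := by
  have hD := h.D_nonneg
  rcases eq_or_lt_of_le hij with rfl | hlt
  · rw [h.dist_le_of_mem i hs hr (hsr rfl)]
    have := hsr rfl
    nlinarith
  · have h1 := h.dist_piece_le hlt hs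
    have h2 := h.dist_le_of_mem j (h.zero_mem j) hr hr.1
    have h3 := dist_triangle4 (X i s) (m j) (X j 0) (X j r)
    have h4 := h.start j
    have h5 := h.partialLength_mono (Nat.succ_le_of_lt hlt)
    rw [Nat.succ_eq_add_one, partialLength_succ] at h5
    push_cast at h5
    have h6 : D * (j - i) ≤ D * (partialLength ℓ j + r - (partialLength ℓ i + s) + 1) :=
      mul_le_mul_of_nonneg_left (by linarith [hs.2, hr.1]) hD
    nlinarith

theorem exists_index (h : Concat k X m ℓ e D E M) (t : ℝ) (ht : 0 ≤ t) :
    ∃ i, partialLength ℓ i ≤ t ∧ t < partialLength ℓ (i + 1) := by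
  have hex : ∃ i, t < partialLength ℓ (i + 1) := by
    obtain ⟨n, hn⟩ := exists_nat_gt t
    refine ⟨n, hn.trans_le ?_⟩
    have := h.le_partialLength (n + 1)
    push_cast at this; linarith
  classical
  refine ⟨Nat.find hex, ?_, Nat.find_spec hex⟩
  rcases Nat.eq_zero_or_pos (Nat.find hex) with h0 | h0
  · rw [h0]; simpa [partialLength] using ht
  · have := Nat.find_min hex (Nat.sub_lt h0 one_pos)
    rwa [show Nat.find hex - 1 + 1 = Nat.find hex by omega, not_lt] at this

/-- The concatenation is a quasi-geodesic ray. -/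
theorem exists_ray (h : Concat k X m ℓ e D E M) : ∃ σ : ℝ → Y,
    (∀ t, QG (2 / e + 5 * D + E + 2) 0 t σ) ∧
    (∀ i, ∀ s, 0 ≤ s → s < ℓ i → σ (partialLength ℓ i + s) = X i s) ∧
    ∀ t, 0 ≤ t → ∃ i, ∃ s ∈ Icc 0 (ℓ i), σ t = X i s := by
  have he := h.e_pos
  have hE := h.E_nonneg
  have hD := h.D_nonneg
  choose! idx hidx using h.exists_index
  have hmem : ∀ t, 0 ≤ t → t - partialLength ℓ (idx t) ∈ Icc 0 (ℓ (idx t)) := by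
    intro t ht
    have h1 := (hidx t ht).1
    have h2 := (hidx t ht).2
    rw [partialLength_succ] at h2
    exact ⟨by linarith, by linarith⟩
  have hmono : ∀ s t, 0 ≤ s → s ≤ t → idx s ≤ idx t := by
    intro s t hs hst
    by_contra hc
    have h1 := h.partialLength_mono (Nat.succ_le_of_lt (not_le.1 hc))
    have h2 : ((idx t).succ : ℝ) ≤ idx s := by exact_mod_cast Nat.succ_le_of_lt (not_le.1 hc)
    have h3 := (hidx s hs).1
    have h4 := (hidx t (hs.trans hst)).2
    rw [Nat.succ_eq_add_one] at h1 h2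
    linarith
  refine ⟨fun t => X (idx t) (t - partialLength ℓ (idx t)), ?_, ?_, ?_⟩
  · intro T x hx y hy hxy
    have h1 := h.lower (hmono x y hx.1 hxy) (hmem x hx.1) (hmem y hy.1) (fun hh => by rw [hh]; linarith)
    have h2 := h.upper (hmono x y hx.1 hxy) (hmem x hx.1) (hmem y hy.1) (fun hh => by rw [hh]; linarith)
    simp only [add_sub_cancel] at h1 h2
    have h3 : (y - x) / (2 / e + 5 * D + E + 2) ≤ e / 2 * (y - x) := by
      have h4 : (y - x) / (2 / e + 5 * D + E + 2) ≤ (y - x) / (2 / e) :=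
        div_le_div_of_nonneg_left (by linarith) (by positivity) (by linarith)
      have h5 : (y - x) / (2 / e) = e / 2 * (y - x) := by field_simp
      linarith
    have h6 : 0 ≤ 2 / e := by positivity
    constructor
    · linarith
    · have : (1 + 2 * D) * (y - x) ≤ (2 / e + 5 * D + E + 2) * (y - x) :=
        mul_le_mul_of_nonneg_right (by linarith) (by linarith)
      linarith
  · intro i s hs hsl
    have h0 := h.partialLength_nonneg i
    have h1 := hidx (partialLength ℓ i + s) (by linarith)
    have h2 : idx (partialLength ℓ i + s) = i := by
      rcases lt_trichotomy (idx (partialLength ℓ i + s)) i with hlt | heq | hlt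
      · have h3 := h.partialLength_mono (Nat.succ_le_of_lt hlt)
        have h4 : ((idx (partialLength ℓ i + s)).succ : ℝ) ≤ i := by
          exact_mod_cast Nat.succ_le_of_lt hlt
        rw [Nat.succ_eq_add_one] at h3 h4
        linarith
      · exact heq
      · have h3 := h.partialLength_mono (Nat.succ_le_of_lt hlt)
        have h4 : ((i.succ : ℕ) : ℝ) ≤ idx (partialLength ℓ i + s) := by
          exact_mod_cast Nat.succ_le_of_lt hlt
        rw [Nat.succ_eq_add_one, partialLength_succ] at h3
        rw [Nat.succ_eq_add_one] at h4
        linarith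
    show X (idx _) (_ - partialLength ℓ (idx _)) = _
    rw [h2, add_sub_cancel_left]
  · intro t ht
    exact ⟨idx t, _, hmem t ht, rfl⟩

end Concat

/-! ### The Morse property of a concatenation -/

variable {Y : Type*} [MetricSpace Y] {k : ℝ → ℝ}

namespace Concat

variable {X : ℕ → ℝ → Y} {m : ℕ → Y} {ℓ : ℕ → ℝ} {e D E : ℝ} {M : ℝ → ℝ}

/-- The norm from which on the `i`-th segment dominates. -/
noncomputable def threshold (ℓ : ℕ → ℝ) (i : ℕ) : ℝ := (i + 1) * (partialLength ℓ i + 1)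

theorem le_threshold (h : Concat k X m ℓ e D E M) (i : ℕ) :
    partialLength ℓ i + 1 ≤ threshold ℓ i ∧ (i : ℝ) ≤ threshold ℓ i := by
  have h0 := h.partialLength_nonneg i
  have h1 := Nat.cast_nonneg (α := ℝ) i
  unfold threshold
  constructor <;> nlinarith

/-- Each segment is Morse with respect to its own base point; beyond `threshold ℓ i` this is as good
as with respect to `m 0`. The norm of `m i` is at most a multiple of the threshold. The point `m (i
+ 1)` may be much farther out, but so is all of segment `i + 1`, and `y` is sublinearly close to a
point of that segment. -/
theorem gauge_le (h : Concat k X m ℓ e D E M) (hk : IsGauge k) (A : ℝ) (hA : 0 ≤ A) :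
    ∃ A', 0 ≤ A' ∧ ∀ i j y z, threshold ℓ i ≤ dist (m 0) y → (j = i ∨ j = i + 1) →
      z ∈ X j '' Icc 0 (ℓ j) → dist y z ≤ A * k (dist (m j) y) → dist y z ≤ A' * k (dist (m 0) y) := by
  have he := h.e_pos
  have hD := h.D_nonneg
  set A₂ := (1 + 2 * D) * (4 / e) with hA₂
  have hA₂0 : 0 ≤ A₂ := by positivity
  obtain ⟨B, hB, hb⟩ := hk.comp (A₂ * A) (by positivity)
  refine ⟨A * (3 + 2 * D) + A * (B * (1 + A₂ + 1)), by positivity, ?_⟩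
  rintro i j y z hy hj ⟨r, hr, rfl⟩ hd
  have p0 := hk.pos (dist (m 0) y)
  rcases hj with rfl | rfl
  · have h1 := h.norm_base_le j
    have h2 := (h.le_threshold j).1
    have h3 := dist_triangle_left (m j) y (m 0)
    have h4 : dist (m j) y ≤ (2 + 2 * D) * dist (m 0) y := by
      have : (1 + 2 * D) * (partialLength ℓ j + 1) ≤ (1 + 2 * D) * dist (m 0) y :=
        mul_le_mul_of_nonneg_left (by linarith) (by linarith)
      linarith
    have h5 := (hk.mono h4).trans (hk.mul_le dist_nonneg (by linarith))
    have h6 := mul_le_mul_of_nonneg_left h5 hA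
    have : 0 ≤ A * (B * (1 + A₂ + 1)) * k (dist (m 0) y) := by positivity
    linarith
  · have h1 := h.norm_base_le (i + 1)
    have h2 := h.le_norm i hr
    have h3 := dist_triangle_left (m (i + 1)) y (m 0)
    have h4 := h.len_large i
    have h5 := dist_triangle (m 0) y (X (i + 1) r)
    rw [partialLength_succ] at h1
    have h6 : partialLength ℓ i + ℓ i + 1 ≤ 4 / e * dist (m 0) (X (i + 1) r) := by
      have h7 : 4 / e * (e / 2 * ℓ i) = 2 * ℓ i := by field_simp; ring
      have h8 : 4 / e * (e / 2 * ℓ i) ≤ 4 / e * dist (m 0) (X (i + 1) r) := by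
        apply mul_le_mul_of_nonneg_left _ (by positivity)
        have := mul_nonneg he.le hr.1
        linarith
      linarith
    have h7 : dist (m 0) (m (i + 1)) ≤ A₂ * dist (m 0) (X (i + 1) r) := by
      refine h1.trans ?_
      rw [hA₂, mul_assoc]
      exact mul_le_mul_of_nonneg_left h6 (by linarith)
    have h8 : A₂ * dist (m 0) (X (i + 1) r) ≤ A₂ * (dist (m 0) y + A * k (dist (m (i + 1)) y)) :=
      mul_le_mul_of_nonneg_left (by linarith) hA₂0
    have h9 := hb (dist (m (i + 1)) y) ((1 + A₂) * dist (m 0) y) dist_nonneg (by positivity)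
      (by linarith)
    have h10 := hk.mul_le (dist_nonneg (x := m 0) (y := y)) (by linarith : 0 ≤ 1 + A₂)
    have h11 := mul_le_mul_of_nonneg_left (h9.trans (mul_le_mul_of_nonneg_left h10 (by linarith))) hA
    have : 0 ≤ A * (3 + 2 * D) * k (dist (m 0) y) := by positivity
    linarith

/-- Together with `le_norm_of_lt` this shows that between `threshold ℓ i` and `threshold ℓ (i + 1)`
only the segments `i` and `i + 1` matter: earlier ones lie much closer to `m 0` and later ones much
farther away. -/
theorem norm_le_of_lt (h : Concat k X m ℓ e D E M) {i j : ℕ} (hj : j < i) {z : Y}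
    (hz : z ∈ X j '' Icc 0 (ℓ j)) : dist (m 0) z ≤ (1 + 3 * D) * (partialLength ℓ i + 1) := by
  obtain ⟨r, hr, rfl⟩ := hz
  have h1 := h.norm_le j hr
  have h2 := h.partialLength_mono (Nat.succ_le_of_lt hj)
  have h3 : ((j.succ : ℕ) : ℝ) ≤ i := by exact_mod_cast Nat.succ_le_of_lt hj
  rw [Nat.succ_eq_add_one] at h2 h3
  rw [partialLength_succ] at h2
  have hD := h.D_nonneg
  have h4 := h.len_pos j
  have h5 : (1 + 3 * D) * (partialLength ℓ j + ℓ j + 1) ≤ (1 + 3 * D) * (partialLength ℓ i + 1) :=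
    mul_le_mul_of_nonneg_left (by linarith) (by linarith)
  nlinarith [hr.2]

theorem le_norm_of_lt (h : Concat k X m ℓ e D E M) {i j : ℕ} (hj : i + 1 < j) {z : Y}
    (hz : z ∈ X j '' Icc 0 (ℓ j)) : 24 * threshold ℓ (i + 1) ≤ dist (m 0) z := by
  obtain ⟨r, hr, rfl⟩ := hz
  obtain ⟨p, rfl⟩ : ∃ p, j = p + 1 := ⟨j - 1, by omega⟩
  have hp : i + 1 ≤ p := by omega
  have h1 := h.le_norm p hr
  have h2 := h.partialLength_mono hp
  have h3 := h.growth p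
  have h4 : (i : ℝ) + 1 ≤ p := by exact_mod_cast hp
  have hi := Nat.cast_nonneg (α := ℝ) i
  have hD := h.D_nonneg
  have hE := h.E_nonneg
  have h0 := h.partialLength_nonneg (i + 1)
  push_cast at h2
  have h5 : 4 * 3 * ((i : ℝ) + 2) ^ 3 * (partialLength ℓ (i + 1) + 1) ≤
      4 * (E + 4 * D + 3) * (p + 1) ^ 3 * (partialLength ℓ p + 1) := by
    have h6 : ((i : ℝ) + 2) ^ 3 ≤ (p + 1) ^ 3 := pow_le_pow_left₀ (by linarith) (by linarith) 3
    exact mul_le_mul (mul_le_mul (by linarith) h6 (by positivity) (by positivity)) (by linarith)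
      (by linarith) (by positivity)
  have h6 : 4 * ((i : ℝ) + 2) ≤ ((i : ℝ) + 2) ^ 3 := by nlinarith [sq_nonneg (i : ℝ)]
  have h7 : 4 * ((i : ℝ) + 2) * (partialLength ℓ (i + 1) + 1) ≤
      ((i : ℝ) + 2) ^ 3 * (partialLength ℓ (i + 1) + 1) :=
    mul_le_mul_of_nonneg_right h6 (by linarith)
  have h8 := mul_nonneg h.e_pos.le hr.1
  unfold threshold
  push_cast
  nlinarith

/-- The union of the segments of a concatenation is Morse. -/
theorem wg_union (h : Concat k X m ℓ e D E M) (hY : IsGeodesicSpace Y) (hk : IsGauge k) :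
    ∃ M', WG k (m 0) (⋃ i, X i '' Icc 0 (ℓ i)) M' := by
  set Z := ⋃ i, X i '' Icc 0 (ℓ i) with hZ
  have hZi : ∀ {i z}, z ∈ X i '' Icc 0 (ℓ i) → z ∈ Z := fun hz => mem_iUnion.2 ⟨_, hz⟩
  have hD := h.D_nonneg
  have key : ∀ K, ∃ m', 1 ≤ K → ∀ (s t : ℝ) (β : ℝ → Y), s ≤ t → QG K s t β → β s ∈ Z → β t ∈ Z →
      ∀ x ∈ Icc s t, ∃ z ∈ Z, dist (β x) z ≤ m' * k (dist (m 0) (β x)) := by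
    intro K
    by_cases hK : 1 ≤ K
    swap
    · exact ⟨0, fun h => absurd h hK⟩
    have hK3 : 1 ≤ 3 * K := by linarith
    obtain ⟨m₁, hm₁, hgauge⟩ := h.gauge_le hk |M (9 * (3 * K))| (abs_nonneg _)
    set L := lossConst (3 * K) with hL
    have hL1 : 1 ≤ L := one_le_lossConst hK3
    set m₂ := m₁ + (L * (D + 1) + D) with hm₂
    have hm₂0 : 0 ≤ m₂ := by positivity
    let good : Y → Prop := fun v => ∃ z ∈ Z, dist v z ≤ m₂ * k (dist (m 0) v)
    have good_of_le : ∀ v z, z ∈ Z → dist v z ≤ L * (D + 1) + D → good v := by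
      intro v z hz hd
      refine ⟨z, hz, hd.trans ?_⟩
      have := hk.one_le (dist (m 0) v)
      have h1 : 0 ≤ L * (D + 1) + D := by positivity
      nlinarith
    obtain ⟨T, hT⟩ := eventually_atTop.1 (hk.eventually_le (2 * L * m₂) (2 * L) (by positivity))
    obtain ⟨i₀, hi₀⟩ := exists_nat_ge (max T (max K ((1 + 3 * D) + L * (2 * (1 + 3 * D) + 1))))
    have hi₀T : T ≤ i₀ := (le_max_left _ _).trans hi₀
    have hi₀K : K ≤ i₀ := ((le_max_left _ _).trans (le_max_right _ _)).trans hi₀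
    have hi₀D : (1 + 3 * D) + L * (2 * (1 + 3 * D) + 1) ≤ i₀ :=
      ((le_max_right _ _).trans (le_max_right _ _)).trans hi₀
    -- One step of a downward induction over windows of norms: points beyond the next threshold are
    -- already known to be near `Z`.
    have window : ∀ i, i₀ ≤ i → ∀ (s t : ℝ) (β : ℝ → Y), s ≤ t → QG K s t β → β s ∈ Z → β t ∈ Z →
        (∀ x ∈ Icc s t, threshold ℓ (i + 1) ≤ dist (m 0) (β x) → good (β x)) →
        ∀ x ∈ Icc s t, threshold ℓ i ≤ dist (m 0) (β x) → good (β x) := by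
      intro i hi s t β hst hβ hs ht hgood x hx hxi
      by_cases hxi' : threshold ℓ (i + 1) ≤ dist (m 0) (β x)
      · exact hgood x hx hxi'
      have hiR : (i₀ : ℝ) ≤ i := by exact_mod_cast hi
      set S := threshold ℓ (i + 1) with hS
      have hSi : (i : ℝ) + 1 ≤ S := by
        have := (h.le_threshold (i + 1)).2; push_cast at this; exact this
      have hQ0 : ∀ j, 0 ≤ partialLength ℓ j := h.partialLength_nonneg
      have hsmall : ∀ j : ℕ, i ≤ j → (1 + 3 * D) * (partialLength ℓ j + 1) +
          L * (2 * (1 + 3 * D) * (partialLength ℓ j + 1) + 1) < threshold ℓ j := by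
        intro j hj
        have hjR : (i : ℝ) ≤ j := by exact_mod_cast hj
        have h1 : ((1 + 3 * D) + L * (2 * (1 + 3 * D) + 1)) * (partialLength ℓ j + 1) <
          (j + 1) * (partialLength ℓ j + 1) :=
          mul_lt_mul_of_pos_right (by linarith) (by linarith [hQ0 j])
        unfold threshold
        nlinarith [mul_nonneg (by linarith : 0 ≤ L) (hQ0 j)]
      -- `w` can serve as an end point of a path that is compared with segment `j`: it is near this
      -- segment, and the points of the window that a surgery at `w` may lose are good for other
      -- reasons.
      let EndJ : ℕ → Y → Prop := fun j w => ∃ z ∈ X j '' Icc 0 (ℓ j), ∃ δ, dist w z ≤ δ ∧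
        ∀ v, threshold ℓ i ≤ dist (m 0) v → dist (m 0) v < S → dist v w ≤ L * (δ + 1) → good v
      have end_base : ∀ j, j = i ∨ j = i + 1 → EndJ j (m (i + 1)) := by
        rintro j (rfl | rfl)
        · refine ⟨_, ⟨_, h.len_mem j, rfl⟩, D, h.finish j, fun v _ _ hv => ?_⟩
          refine good_of_le v _ (hZi ⟨_, h.len_mem j, rfl⟩) ?_
          linarith [dist_triangle v (m (j + 1)) (X j (ℓ j)), h.finish j]
        · refine ⟨_, ⟨_, h.zero_mem (i + 1), rfl⟩, D, h.start (i + 1), fun v _ _ hv => ?_⟩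
          refine good_of_le v _ (hZi ⟨_, h.zero_mem (i + 1), rfl⟩) ?_
          linarith [dist_triangle v (m (i + 1)) (X (i + 1) 0), h.start (i + 1)]
      have end_mem : ∀ w ∈ Z, dist (m 0) w < 2 * S → ∃ j, (j = i ∨ j = i + 1) ∧ EndJ j w := by
        intro w hw hwS
        obtain ⟨j, hj⟩ := mem_iUnion.1 hw
        by_cases hji : j < i
        · refine ⟨i, Or.inl rfl, _, ⟨_, h.zero_mem i, rfl⟩,
            2 * (1 + 3 * D) * (partialLength ℓ i + 1), ?_, ?_⟩
          · have h1 := h.norm_le_of_lt hji hj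
            have h2 := h.norm_le i (h.zero_mem i)
            have h3 := dist_triangle_left w (X i 0) (m 0)
            linarith
          · intro v hv _ hvw
            exfalso
            have h1 := h.norm_le_of_lt hji hj
            have h3 := dist_triangle_right (m 0) v w
            have h4 := dist_triangle (m 0) w v
            rw [dist_comm w v] at h4
            have := hsmall i le_rfl
            linarith
        · by_cases hji' : i + 1 < j
          · have := h.le_norm_of_lt hji' hj
            rw [← hS] at this
            exfalso; linarith
          · refine ⟨j, by omega, w, hj, 0, by rw [dist_self], fun v _ _ hv => ?_⟩
            refine good_of_le v w hw (hv.trans ?_)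
            nlinarith
      -- The path is cut where it leaves the ball of radius `2 * S`. The cutting point is good by
      -- induction, the nearby point of `Z` must lie on segment `i + 1`, and the surgery there loses
      -- nothing of norm below `S`.
      have end_good : ∀ w, good w → 2 * S ≤ dist (m 0) w → dist (m 0) w ≤ 2 * S + 2 * K →
          ∃ j, (j = i ∨ j = i + 1) ∧ EndJ j w := by
        rintro w ⟨z, hz, hd⟩ hw hw'
        have hTw := hT (dist (m 0) w) (by linarith)
        have pw := hk.pos (dist (m 0) w)
        have hmk : m₂ * k (dist (m 0) w) ≤ L * (m₂ * k (dist (m 0) w)) :=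
          le_mul_of_one_le_left (by positivity) hL1
        have t1 := dist_triangle (m 0) w z
        have t2 := dist_triangle_right (m 0) w z
        obtain ⟨j, hj⟩ := mem_iUnion.1 hz
        have hj1 : ¬ j < i + 1 := by
          intro hc
          have h1 := h.norm_le_of_lt hc hj
          have h2 := hsmall (i + 1) (Nat.le_succ i)
          have h3 : 0 ≤ L * (2 * (1 + 3 * D) * (partialLength ℓ (i + 1) + 1) + 1) := by
            have := hQ0 (i + 1)
            positivity
          linarith
        have hj2 : ¬ i + 1 < j := by
          intro hc
          have h1 := h.le_norm_of_lt hc hj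
          rw [← hS] at h1
          linarith
        refine ⟨j, by omega, z, hj, _, hd, fun v _ hv hvw => ?_⟩
        exfalso
        have t3 := dist_triangle (m 0) v w
        linarith
      have same : ∀ (a b : ℝ) (β' : ℝ → Y) (j : ℕ), (j = i ∨ j = i + 1) → a ≤ b → QG (3 * K) a b β' →
          EndJ j (β' a) → EndJ j (β' b) → ∀ y ∈ Icc a b, threshold ℓ i ≤ dist (m 0) (β' y) →
          dist (m 0) (β' y) < S → good (β' y) := by
        rintro a b β' j hj hab hβ' ⟨z₁, hz₁, δ₁, hd₁, hl₁⟩ ⟨z₂, hz₂, δ₂, hd₂, hl₂⟩ y hy hy1 hy2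
        rcases (h.morse j).near_of_ends_near hY hβ' hK3 hab hz₁ hz₂ hd₁ hd₂ y hy with
          ⟨z, hz, hd⟩ | hd | hd
        · refine ⟨z, hZi hz, ?_⟩
          have h1 := hgauge i j (β' y) z hy1 hj hz
            (hd.trans (mul_le_mul_of_nonneg_right (le_abs_self _) (hk.pos _).le))
          have h2 : 0 ≤ (L * (D + 1) + D) * k (dist (m 0) (β' y)) := by
            have := hk.pos (dist (m 0) (β' y)); positivity
          linarith
        · exact hl₁ _ hy1 hy2 hd
        · exact hl₂ _ hy1 hy2 hd
      have left : ∃ s' ∈ Icc s x, ∃ j, (j = i ∨ j = i + 1) ∧ EndJ j (β s') := by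
        by_cases hall : ∃ u ∈ Icc s x, 2 * S ≤ dist (m 0) (β u)
        · obtain ⟨u, hu, hu2⟩ := hall
          obtain ⟨y, hy, y', hy', h1, h2, h3, h4⟩ := exists_crossing
            (P := fun u => 2 * S ≤ dist (m 0) (β u)) hu.2 hu2 (by push Not at hxi' ⊢; linarith)
          have Iy : y ∈ Icc s t := ⟨hu.1.trans hy.1, hy.2.trans hx.2⟩
          have Iy' : y' ∈ Icc s t := ⟨hu.1.trans hy'.1, hy'.2.trans hx.2⟩
          have h5 := hβ.dist_le_two hK Iy Iy' h1 h2
          have h6 := dist_triangle_right (m 0) (β y) (β y')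
          refine ⟨y, ⟨Iy.1, hy.2⟩, end_good _ (hgood y Iy (by linarith)) h3 ?_⟩
          push Not at h4
          linarith
        · push Not at hall
          exact ⟨s, ⟨le_rfl, hx.1⟩, end_mem _ hs (hall s ⟨le_rfl, hx.1⟩)⟩
      have right : ∃ t' ∈ Icc x t, ∃ j, (j = i ∨ j = i + 1) ∧ EndJ j (β t') := by
        by_cases hall : ∃ u ∈ Icc x t, 2 * S ≤ dist (m 0) (β u)
        · obtain ⟨u, hu, hu2⟩ := hall
          obtain ⟨y, hy, y', hy', h1, h2, h3, h4⟩ := exists_crossing'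
            (P := fun u => 2 * S ≤ dist (m 0) (β u)) hu.1 (by push Not at hxi' ⊢; linarith) hu2
          have Iy : y ∈ Icc s t := ⟨hx.1.trans hy.1, hy.2.trans hu.2⟩
          have Iy' : y' ∈ Icc s t := ⟨hx.1.trans hy'.1, hy'.2.trans hu.2⟩
          have h5 := hβ.dist_le_two hK Iy Iy' h1 h2
          have h6 := dist_triangle (m 0) (β y) (β y')
          refine ⟨y', ⟨hy'.1, Iy'.2⟩, end_good _ (hgood y' Iy' (by linarith)) h4 ?_⟩
          push Not at h3
          linarith
        · push Not at hall
          exact ⟨t, ⟨hx.2, le_rfl⟩, end_mem _ ht (hall t ⟨hx.2, le_rfl⟩)⟩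
      obtain ⟨s', hs', j₁, hj₁, he₁⟩ := left
      obtain ⟨t', ht', j₂, hj₂, he₂⟩ := right
      push Not at hxi'
      have hβ' := hβ.sub hs'.1 ht'.2
      have hst' := hs'.2.trans ht'.1
      have hx' : x ∈ Icc s' t' := ⟨hs'.2, ht'.1⟩
      by_cases hj : j₁ = j₂
      · subst hj
        exact same s' t' β j₁ hj₁ hst' (hβ'.mono hK (by linarith)) he₁ he₂ x hx' hxi hxi'
      -- The two ends belong to the two different segments. The path is split at a point almost
      -- nearest to `m (i + 1)`, which is near both segments, and the half containing `x` is
      -- compared with a single segment.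
      · obtain ⟨q, hq, -, ⟨β₁, a1, a2, a3, -⟩, ⟨β₂, b1, b2, b3, -⟩⟩ :=
          hβ'.split hY hK hst' (m (i + 1))
        have hd0 := dist_nonneg (x := β q) (y := m (i + 1))
        rcases le_total x q with hxq | hxq
        · have := same s' _ β₁ j₁ hj₁ (by linarith [hq.1]) a1 (by rw [a3 _ hq.1]; exact he₁)
            (by rw [a2]; exact end_base _ hj₁) x ⟨hx'.1, by linarith⟩
          rw [a3 x hxq] at this
          exact this hxi hxi'
        · have := same _ t' β₂ j₂ hj₂ (by linarith [hq.2]) b1 (by rw [b2]; exact end_base _ hj₂)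
            (by rw [b3 _ hq.2]; exact he₂) x ⟨by linarith, hx'.2⟩
          rw [b3 x hxq] at this
          exact this hxi hxi'
    refine ⟨m₂ + (threshold ℓ i₀ + D), fun _ s t β hst hβ hs ht => ?_⟩
    have hbig : ∃ I, i₀ ≤ I ∧ ∀ x ∈ Icc s t, dist (m 0) (β x) < threshold ℓ I := by
      obtain ⟨n, hn⟩ := exists_nat_gt (dist (m 0) (β s) + (K * (t - s) + K))
      refine ⟨max i₀ n, le_max_left _ _, fun x hx => ?_⟩
      have h1 := (hβ s ⟨le_rfl, hst⟩ x hx hx.1).2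
      have h2 := dist_triangle (m 0) (β s) (β x)
      have h3 := (h.le_threshold (max i₀ n)).2
      have h4 : (n : ℝ) ≤ (max i₀ n : ℕ) := by exact_mod_cast le_max_right _ _
      have h5 : K * (x - s) ≤ K * (t - s) := mul_le_mul_of_nonneg_left (by linarith [hx.2]) (by linarith)
      linarith
    obtain ⟨I, hI, hIb⟩ := hbig
    have all : ∀ x ∈ Icc s t, threshold ℓ i₀ ≤ dist (m 0) (β x) → good (β x) := by
      -- The induction starts at an index `I` whose threshold exceeds all norms on `β`, where
      -- nothing is to be shown.
      refine Nat.decreasingInduction'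
        (P := fun i => ∀ x ∈ Icc s t, threshold ℓ i ≤ dist (m 0) (β x) → good (β x)) ?_ hI ?_
      · intro i _ hi ih
        exact window i hi s t β hst hβ hs ht ih
      · intro x hx hc
        exact absurd (hIb x hx) (not_lt.2 hc)
    intro x hx
    have p := hk.one_le (dist (m 0) (β x))
    have hth : 0 ≤ threshold ℓ i₀ := le_trans (Nat.cast_nonneg _) (h.le_threshold i₀).2
    by_cases hxi : threshold ℓ i₀ ≤ dist (m 0) (β x)
    · obtain ⟨z, hz, hd⟩ := all x hx hxi
      refine ⟨z, hz, hd.trans ?_⟩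
      exact mul_le_mul_of_nonneg_right (by linarith) (by linarith)
    · push Not at hxi
      refine ⟨_, hZi ⟨0, h.zero_mem 0, rfl⟩, ?_⟩
      have h1 := dist_triangle_left (β x) (X 0 0) (m 0)
      have h2 := h.start 0
      nlinarith
  choose M' hM' using key
  exact ⟨M', fun K hK => hM' K hK⟩

/-- The concatenation is a Morse quasi-geodesic ray. -/
theorem exists_morse_ray (h : Concat k X m ℓ e D E M) (hY : IsGeodesicSpace Y) (hk : IsGauge k) :
    ∃ σ : ℝ → Y, (∀ t, QG (2 / e + 5 * D + E + 2) 0 t σ) ∧ (∃ M', WG k (m 0) (σ '' Ici 0) M') ∧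
    ∀ i, ∀ s, 0 ≤ s → s < ℓ i → σ (partialLength ℓ i + s) = X i s := by
  obtain ⟨σ, h1, h2, h3⟩ := h.exists_ray
  obtain ⟨M₁, hM₁⟩ := h.wg_union hY hk
  have hD := h.D_nonneg
  -- `σ` may omit the last point of a segment; it is within `2 * D` of the start of the next one.
  obtain ⟨M', hM'⟩ := WG.transfer hY hk M₁ (2 * D) (by linarith)
  refine ⟨σ, h1, ⟨M', hM' _ _ _ hM₁ ?_ ?_⟩, h2⟩
  · rintro _ ⟨t, ht, rfl⟩
    obtain ⟨i, s, hs, he⟩ := h3 t ht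
    refine ⟨_, mem_iUnion.2 ⟨i, s, hs, rfl⟩, ?_⟩
    rw [he, dist_self]
    exact mul_nonneg (by linarith) (hk.pos _).le
  · intro z hz
    obtain ⟨i, s, hs, rfl⟩ := mem_iUnion.1 hz
    rcases lt_or_eq_of_le hs.2 with hlt | rfl
    · refine ⟨_, ⟨partialLength ℓ i + s, mem_Ici.2 (by linarith [h.partialLength_nonneg i, hs.1]), rfl⟩, ?_⟩
      rw [h2 i s hs.1 hlt, dist_self]
      exact mul_nonneg (by linarith) (hk.pos _).le
    · refine ⟨_, ⟨partialLength ℓ (i + 1) + 0,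
        mem_Ici.2 (by linarith [h.partialLength_nonneg (i + 1)]), rfl⟩, ?_⟩
      rw [h2 (i + 1) 0 le_rfl (by linarith [h.len_pos (i + 1)])]
      have t1 := dist_triangle_left (X i (ℓ i)) (X (i + 1) 0) (m (i + 1))
      have t2 := h.start (i + 1)
      have t3 := h.finish i
      have := hk.one_le (dist (m 0) (X i (ℓ i)))
      nlinarith

end Concat

/-! ### The geometry of trees -/

section TreeGeometry

variable {V : Type*} [MetricSpace V]

/-- `w` lies on a geodesic from `x` to `y`. -/
def Betw (x w y : V) : Prop := dist x w + dist w y = dist x y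

/-- The properties of the vertex set of a tree that are used. -/
structure IsTreeMetric (V : Type*) [MetricSpace V] : Prop where
  exists_nat : ∀ x y : V, ∃ n : ℕ, dist x y = n
  exists_point : ∀ (x y : V) (n : ℕ), (n : ℝ) ≤ dist x y → ∃ w, dist x w = n ∧ Betw x w y
  branch : ∀ {u w x y : V}, Betw u w x → ¬ Betw u w y → Betw x w y

/-- Shortest walks from `x` to `w` and from `w` to `y` compose to a path when their lengths add up
to the distance, and paths in a tree are unique. -/
theorem betw_iff_mem_support {T : SimpleGraph V} (hT : T.IsTree)
    (hdist : ∀ u v : V, dist u v = (T.dist u v : ℝ)) {x w y : V} {q : T.Walk x y} (hq : q.IsPath) :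
    Betw x w y ↔ w ∈ q.support := by
  classical
  unfold Betw
  rw [hdist, hdist, hdist]
  norm_cast
  have hlen : q.length = T.dist x y := by
    obtain ⟨q', h1, h2⟩ := hT.connected.exists_path_of_dist x y
    rw [(hT.existsUnique_path x y).unique hq h1, h2]
  constructor
  · intro h
    obtain ⟨p₁, h₁⟩ := hT.connected.exists_walk_length_eq_dist x w
    obtain ⟨p₂, h₂⟩ := hT.connected.exists_walk_length_eq_dist w y
    have h3 : (p₁.append p₂).IsPath := by
      apply SimpleGraph.Walk.isPath_of_length_eq_dist
      rw [SimpleGraph.Walk.length_append, h₁, h₂, h]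
    rw [(hT.existsUnique_path x y).unique hq h3]
    simp
  · intro hw
    have h1 := SimpleGraph.dist_le (q.takeUntil w hw)
    have h2 := SimpleGraph.dist_le (q.dropUntil w hw)
    have h3 : (q.takeUntil w hw).length + (q.dropUntil w hw).length = q.length := by
      rw [← SimpleGraph.Walk.length_append, q.take_spec hw]
    have h4 := hT.connected.dist_triangle (u := x) (v := w) (w := y)
    omega

theorem isTreeMetric {T : SimpleGraph V} (hT : T.IsTree)
    (hdist : ∀ u v : V, dist u v = (T.dist u v : ℝ)) : IsTreeMetric V where
  exists_nat x y := ⟨_, hdist x y⟩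
  exists_point x y n hn := by
    rw [hdist] at hn
    obtain ⟨q, h1, h2⟩ := hT.connected.exists_path_of_dist x y
    have hn' : n ≤ q.length := by rw [h2]; exact_mod_cast hn
    refine ⟨q.getVert n, ?_, (betw_iff_mem_support hT hdist h1).2 (q.getVert_mem_support n)⟩
    have e1 := (betw_iff_mem_support hT hdist h1).2 (q.getVert_mem_support n)
    unfold Betw at e1
    rw [hdist, hdist, hdist] at e1
    rw [hdist]
    norm_cast at e1 ⊢
    have e2 := SimpleGraph.dist_le (q.take n)
    have e3 := SimpleGraph.dist_le (q.drop n)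
    rw [SimpleGraph.Walk.take_length] at e2
    rw [SimpleGraph.Walk.drop_length] at e3
    omega
  branch := by
    intro u w x y h1 h2
    classical
    obtain ⟨p, hp, -⟩ := hT.connected.exists_path_of_dist u y
    obtain ⟨q, hq, -⟩ := hT.connected.exists_path_of_dist x y
    rw [betw_iff_mem_support hT hdist hp] at h2
    rw [betw_iff_mem_support hT hdist hq]
    by_contra h3
    have h4 := (betw_iff_mem_support hT hdist (p.append q.reverse).bypass_isPath).1 h1
    have h5 := (p.append q.reverse).support_bypass_subset_support h4
    rw [SimpleGraph.Walk.mem_support_append_iff, SimpleGraph.Walk.support_reverse,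
      List.mem_reverse] at h5
    exact h5.elim h2 h3

theorem Betw.symm {x w y : V} (h : Betw x w y) : Betw y w x := by
  unfold Betw at *
  rw [dist_comm y w, dist_comm w x, dist_comm y x]; linarith

theorem Betw.trans {u v w x : V} (h1 : Betw u v w) (h2 : Betw u w x) : Betw u v x := by
  unfold Betw at *
  have := dist_triangle v w x
  have := dist_triangle u v x
  linarith

theorem Betw.trans_right {u v w x : V} (h1 : Betw u v w) (h2 : Betw u w x) : Betw v w x := by
  unfold Betw at *
  have := dist_triangle v w x
  have := dist_triangle u v x
  linarith

theorem betw_self_right (u x : V) : Betw u x x := by simp [Betw]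

namespace IsTreeMetric

variable (hV : IsTreeMetric V)
include hV

theorem unique {u w w' x : V} (h : Betw u w x) (h' : Betw u w' x) (he : dist u w = dist u w') :
    w = w' := by
  by_contra hne
  have hpos := dist_pos.2 hne
  have h1 : ¬ Betw u w w' := by unfold Betw; linarith
  have h2 : ¬ Betw u w' w := by unfold Betw; rw [dist_comm w']; linarith
  have h3 := hV.branch h h1
  have h4 := hV.branch h' h2
  unfold Betw at h3 h4
  rw [dist_comm w' w] at h4
  linarith

/-- Two vertices on a geodesic. -/
theorem betw_of_le {u w w' x : V} (h : Betw u w x) (h' : Betw u w' x) (hle : dist u w ≤ dist u w') :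
    Betw u w w' := by
  obtain ⟨n, hn⟩ := hV.exists_nat u w
  obtain ⟨v, hv, hb⟩ := hV.exists_point u w' n (by linarith)
  rwa [hV.unique h (hb.trans h') (by rw [hn, hv])]

/-- The Gromov product in a tree measures the common initial part of two geodesics, so that
convergence to infinity becomes eventual agreement of prefixes. -/
theorem le_gromovProduct_iff {u x y : V} {n : ℕ} :
    (n : ℝ) ≤ gromovProduct u x y ↔ ∃ w, dist u w = n ∧ Betw u w x ∧ Betw u w y := by
  unfold gromovProduct
  constructor
  · intro h
    obtain ⟨w, hw, hb⟩ := hV.exists_point u x n (by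
      have := dist_triangle_left u y x
      have := dist_triangle u x y
      rw [dist_comm] at this
      linarith [dist_triangle_right u y x, dist_triangle u x y, dist_comm x y])
    refine ⟨w, hw, hb, ?_⟩
    by_contra hc
    have h1 := hV.branch hb hc
    unfold Betw at *
    have := dist_triangle u w y
    rw [dist_comm x w] at h1
    apply hc
    linarith
  · rintro ⟨w, hw, h1, h2⟩
    unfold Betw at *
    have := dist_triangle_left x y w
    linarith

theorem one_le_dist {x y : V} (h : x ≠ y) : 1 ≤ dist x y := by
  obtain ⟨n, hn⟩ := hV.exists_nat x y
  have := dist_pos.2 h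
  rw [hn] at this ⊢
  exact_mod_cast Nat.one_le_iff_ne_zero.2 (by rintro rfl; simp at this)

theorem discreteTopology : DiscreteTopology V := by
  refine discreteTopology_iff_isOpen_singleton.2 fun x => Metric.isOpen_iff.2 ?_
  rintro y rfl
  refine ⟨1, one_pos, fun z hz => ?_⟩
  by_contra hne
  exact absurd (Metric.mem_ball.1 hz) (not_lt.2 (hV.one_le_dist hne))

/-- Moving a far end point by a small distance does not change the branch. -/
theorem betw_of_dist_lt {u v w x y : V} (h1 : Betw u v w) (h2 : Betw u w x)
    (h3 : dist x y < dist v x) : Betw u v y := by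
  by_contra hc
  have h4 := hV.branch (h1.trans h2) hc
  unfold Betw at h4
  rw [dist_comm x v] at h4
  have := dist_nonneg (x := v) (y := y)
  linarith

end IsTreeMetric

/-! ### Rays in trees -/

/-- `r` is a geodesic ray from `u`. -/
def IsRayFrom (u : V) (r : ℕ → V) : Prop := r 0 = u ∧ ∀ i j, dist (r i) (r j) = |(i : ℝ) - j|

theorem IsRayFrom.dist_base {u : V} {r : ℕ → V} (h : IsRayFrom u r) (i : ℕ) : dist u (r i) = i := by
  have := h.2 0 i
  rw [h.1] at this
  rw [this, abs_sub_comm]; simp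

theorem IsRayFrom.betw {u : V} {r : ℕ → V} (h : IsRayFrom u r) {i j : ℕ} (hij : i ≤ j) :
    Betw u (r i) (r j) := by
  unfold Betw
  rw [h.dist_base, h.dist_base, h.2, abs_sub_comm, abs_of_nonneg (by simpa using hij)]
  ring

/-- The points `γ i` converge to the end of the ray `r` from `u`. -/
def TendsTo {ι : Type*} (u : V) (r : ℕ → V) (l : Filter ι) (γ : ι → V) : Prop :=
  ∀ k, ∀ᶠ i in l, Betw u (r k) (γ i)

theorem IsRayFrom.tendsTo {u : V} {r : ℕ → V} (h : IsRayFrom u r) : TendsTo u r atTop r :=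
  fun k => (eventually_ge_atTop k).mono fun _ hi => h.betw hi

theorem TendsTo.comp {ι ι' : Type*} {u : V} {r : ℕ → V} {l : Filter ι} {l' : Filter ι'} {γ : ι → V}
    (h : TendsTo u r l γ) {f : ι' → ι} (hf : Tendsto f l' l) : TendsTo u r l' (γ ∘ f) :=
  fun k => hf.eventually (h k)

theorem gromovProduct_le_add (u w x y : V) :
    gromovProduct u x y ≤ gromovProduct w x y + dist u w := by
  unfold gromovProduct
  have := dist_triangle u w x
  have := dist_triangle u w y
  linarith

theorem IsRayFrom.of_step {u : V} {r : ℕ → V} (h0 : r 0 = u) (h1 : ∀ i, dist (r i) (r (i + 1)) = 1)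
    (h2 : ∀ i, dist u (r i) = i) : IsRayFrom u r := by
  refine ⟨h0, ?_⟩
  have key : ∀ i n, dist (r i) (r (i + n)) = n := by
    intro i n
    apply le_antisymm
    · induction n with
      | zero => simp
      | succ n ih =>
        have := dist_triangle (r i) (r (i + n)) (r (i + n + 1))
        rw [h1] at this
        rw [← add_assoc]; push_cast; linarith
    · have := dist_triangle u (r i) (r (i + n))
      rw [h2, h2] at this
      push_cast at this
      linarith
  intro i j
  rcases le_total i j with h | h
  · obtain ⟨n, rfl⟩ := Nat.exists_eq_add_of_le h
    rw [key, abs_sub_comm]; simp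
  · obtain ⟨n, rfl⟩ := Nat.exists_eq_add_of_le h
    rw [dist_comm, key]; simp

namespace IsTreeMetric

variable (hV : IsTreeMetric V)
include hV

theorem ray_eq_of_betw {u x : V} {r s : ℕ → V} (hr : IsRayFrom u r) (hs : IsRayFrom u s) {k : ℕ}
    (h1 : Betw u (r k) x) (h2 : Betw u (s k) x) : r k = s k :=
  hV.unique h1 h2 (by rw [hr.dist_base, hs.dist_base])

theorem ray_eq_of_le {u : V} {r s : ℕ → V} (hr : IsRayFrom u r) (hs : IsRayFrom u s) {j k : ℕ}
    (hjk : j ≤ k) (h : r k = s k) : r j = s j :=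
  hV.ray_eq_of_betw hr hs (hr.betw hjk) (h ▸ hs.betw hjk)

theorem tendsTo_unique {ι : Type*} {l : Filter ι} [l.NeBot] {γ : ι → V} {u : V} {r s : ℕ → V}
    (hr : IsRayFrom u r) (hs : IsRayFrom u s) (h1 : TendsTo u r l γ) (h2 : TendsTo u s l γ) :
    r = s := by
  funext k
  obtain ⟨i, hi, hi'⟩ := ((h1 k).and (h2 k)).exists
  exact hV.ray_eq_of_betw hr hs hi hi'

/-- For each `n` all late values have the same vertex at distance `n` from `u` on their geodesics,
and these vertices form the limiting ray. -/
theorem exists_tendsTo {ι : Type*} {l : Filter ι} [l.NeBot] {γ : ι → V} (u : V)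
    (h : ∀ n : ℕ, ∀ᶠ p in l ×ˢ l, (n : ℝ) ≤ gromovProduct u (γ p.1) (γ p.2)) :
    ∃ r, IsRayFrom u r ∧ TendsTo u r l γ := by
  have key : ∀ n : ℕ, ∃ w, dist u w = n ∧ ∀ᶠ i in l, Betw u w (γ i) := by
    intro n
    obtain ⟨s, hs, hp⟩ := (eventually_prod_self_iff
      (r := fun i j => (n : ℝ) ≤ gromovProduct u (γ i) (γ j))).1 (h n)
    obtain ⟨i, hi⟩ := l.nonempty_of_mem hs
    obtain ⟨w, hw, hb, -⟩ := hV.le_gromovProduct_iff.1 (hp i hi i hi)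
    refine ⟨w, hw, mem_of_superset hs fun j hj => ?_⟩
    obtain ⟨w', hw', hb', hb''⟩ := hV.le_gromovProduct_iff.1 (hp i hi j hj)
    rwa [mem_ofPred_eq, hV.unique hb hb' (by rw [hw, hw'])]
  choose r hr hb using key
  refine ⟨r, IsRayFrom.of_step ?_ ?_ hr, hb⟩
  · have := hr 0
    simp only [Nat.cast_zero, dist_eq_zero] at this
    exact this.symm
  · intro i
    obtain ⟨j, h1, h2⟩ := ((hb i).and (hb (i + 1))).exists
    have := hV.betw_of_le h1 h2 (by rw [hr, hr]; push_cast; linarith)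
    unfold Betw at this
    rw [hr, hr] at this
    push_cast at this
    linarith

theorem TendsTo.le_product {ι : Type*} {l : Filter ι} {γ : ι → V} {u : V} {r : ℕ → V}
    (hr : IsRayFrom u r) (h : TendsTo u r l γ) (n : ℕ) :
    ∀ᶠ p in l ×ˢ l, (n : ℝ) ≤ gromovProduct u (γ p.1) (γ p.2) := by
  refine (eventually_prod_self_iff (r := fun i j => (n : ℝ) ≤ gromovProduct u (γ i) (γ j))).2
    ⟨_, h n, fun i hi j hj => ?_⟩
  exact hV.le_gromovProduct_iff.2 ⟨r n, hr.dist_base n, hi, hj⟩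

theorem TendsTo.perturb {ι : Type*} {l : Filter ι} {γ γ' : ι → V} {u : V} {r : ℕ → V}
    (hr : IsRayFrom u r) (h : TendsTo u r l γ) {C : ℝ} (hC : ∀ i, dist (γ i) (γ' i) ≤ C) :
    TendsTo u r l γ' := by
  intro k
  obtain ⟨m, hm⟩ := exists_nat_gt C
  filter_upwards [h (k + m)] with i hi
  refine hV.betw_of_dist_lt (hr.betw (Nat.le_add_right k m)) hi ?_
  have h1 := (hr.betw (Nat.le_add_right k m)).trans_right hi
  unfold Betw at h1
  rw [hr.2, abs_sub_comm, abs_of_nonneg (by push_cast; linarith [Nat.cast_nonneg (α := ℝ) m])] at h1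
  push_cast at h1
  linarith [hC i, dist_nonneg (x := r (k + m)) (y := γ i)]

/-! ### The boundary at infinity as a space of rays -/

theorem exists_ray_of_convergesToInfinity (u : V) {x : ℕ → V} (hx : ConvergesToInfinity x) :
    ∃ r, IsRayFrom u r ∧ TendsTo u r atTop x := by
  apply hV.exists_tendsTo
  intro n
  rw [prod_atTop_atTop_eq]
  exact (hx u).eventually_ge_atTop _

theorem convergesToInfinity_of_tendsTo {u : V} {r x : ℕ → V} (hr : IsRayFrom u r)
    (h : TendsTo u r atTop x) : ConvergesToInfinity x := by
  intro o
  rw [tendsto_atTop]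
  intro b
  obtain ⟨m, hm⟩ := exists_nat_ge (b + dist u o)
  have := TendsTo.le_product hV hr h m
  rw [prod_atTop_atTop_eq] at this
  filter_upwards [this] with p hp
  linarith [gromovProduct_le_add u o (x p.1) (x p.2)]

theorem tendsTo_of_equivalent {u : V} {x y : InfSeq V} (h : x.Equivalent y) {r : ℕ → V}
    (hr : IsRayFrom u r) (hx : TendsTo u r atTop x.1) : TendsTo u r atTop y.1 := by
  intro k
  filter_upwards [(h u).eventually_ge_atTop (k : ℝ), hx k] with i h1 h2
  obtain ⟨w, hw, hb, hb'⟩ := hV.le_gromovProduct_iff.1 h1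
  rwa [hV.unique h2 hb (by rw [hr.dist_base, hw])]

/-- The ray from `u` to a point at infinity. -/
noncomputable def rayTo (u : V) : GromovBoundary V → ℕ → V :=
  Quot.lift (fun x => (hV.exists_ray_of_convergesToInfinity u x.2).choose) (by
    intro x y hxy
    have h1 := (hV.exists_ray_of_convergesToInfinity u x.2).choose_spec
    have h2 := (hV.exists_ray_of_convergesToInfinity u y.2).choose_spec
    exact hV.tendsTo_unique h1.1 h2.1 (hV.tendsTo_of_equivalent hxy h1.1 h1.2) h2.2)

theorem rayTo_isRayFrom (u : V) (ξ : GromovBoundary V) : IsRayFrom u (hV.rayTo u ξ) := by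
  obtain ⟨x, rfl⟩ := Quot.exists_rep ξ
  exact (hV.exists_ray_of_convergesToInfinity u x.2).choose_spec.1

/-- Allows sequences to be handled from the single base point `u`; another base point changes Gromov
products by a bounded amount. -/
theorem represents_iff (u : V) (x : ℕ → V) (ξ : GromovBoundary V) :
    Represents x ξ ↔ TendsTo u (hV.rayTo u ξ) atTop x := by
  constructor
  · rintro ⟨h, rfl⟩
    exact (hV.exists_ray_of_convergesToInfinity u h).choose_spec.2
  · intro h
    have hx := hV.convergesToInfinity_of_tendsTo (hV.rayTo_isRayFrom u ξ) h
    refine ⟨hx, ?_⟩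
    obtain ⟨y, rfl⟩ := Quot.exists_rep ξ
    have hr := hV.rayTo_isRayFrom u (Quot.mk _ y)
    have hy : TendsTo u (hV.rayTo u (Quot.mk _ y)) atTop y.1 :=
      (hV.exists_ray_of_convergesToInfinity u y.2).choose_spec.2
    apply Quot.sound
    intro o
    rw [tendsto_atTop]
    intro b
    obtain ⟨m, hm⟩ := exists_nat_ge (b + dist u o)
    filter_upwards [h m, hy m] with i h1 h2
    have := hV.le_gromovProduct_iff.2 ⟨_, hr.dist_base m, h1, h2⟩
    linarith [gromovProduct_le_add u o (x i) (y.1 i)]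

theorem exists_rayTo_eq (u : V) {r : ℕ → V} (hr : IsRayFrom u r) : ∃ ξ, hV.rayTo u ξ = r := by
  have hc := hV.convergesToInfinity_of_tendsTo hr hr.tendsTo
  refine ⟨Quot.mk _ ⟨r, hc⟩, ?_⟩
  have h1 := (hV.represents_iff u r _).1 ⟨hc, rfl⟩
  exact hV.tendsTo_unique (hV.rayTo_isRayFrom u _) hr h1 hr.tendsTo

theorem rayTo_represents (u : V) (ξ : GromovBoundary V) : Represents (hV.rayTo u ξ) ξ :=
  (hV.represents_iff u _ _).2 (hV.rayTo_isRayFrom u ξ).tendsTo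

theorem rayTo_injective (u : V) : Function.Injective (hV.rayTo u) := by
  intro ξ η h
  obtain ⟨_, h1⟩ := hV.rayTo_represents u ξ
  obtain ⟨_, h2⟩ := hV.rayTo_represents u η
  rw [← h1, ← h2]
  congr 2

/-- If convergence failed at arbitrarily late times, one could choose such times with gaps of at
least one. They form an increasing sequence of the kind tested by `DefinesPoint`. -/
theorem definesPoint_iff (u : V) (γ : ℝ≥0 → V) (ξ : GromovBoundary V) :
    DefinesPoint γ ξ ↔ TendsTo u (hV.rayTo u ξ) atTop γ := by
  constructor
  · intro h k
    by_contra hc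
    rw [not_eventually, frequently_atTop] at hc
    choose f hf hf' using hc
    let t : ℕ → ℝ≥0 := fun n => Nat.rec (f 0) (fun _ a => f (a + 1)) n
    have ht : ∀ n, t n + 1 ≤ t (n + 1) := fun n => hf (t n + 1)
    have hmono : Monotone t := monotone_nat_of_le_succ fun n => le_trans (by simp) (ht n)
    have hle : ∀ n : ℕ, (n : ℝ≥0) ≤ t n := by
      intro n
      induction n with
      | zero => simp
      | succ n ih => push_cast; exact le_trans (by gcongr) (ht n)
    have htend : Tendsto t atTop atTop := tendsto_atTop_mono hle tendsto_natCast_atTop_atTop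
    have h1 := (hV.represents_iff u _ _).1 (h t hmono htend)
    obtain ⟨n, hn⟩ := (h1 k).exists
    cases n with
    | zero => exact hf' 0 hn
    | succ n => exact hf' _ hn
  · intro h t _ ht
    exact (hV.represents_iff u _ _).2 (h.comp ht)

theorem le_boundaryProduct (u o : V) {ξ η : GromovBoundary V} {k : ℕ}
    (h : hV.rayTo u ξ k = hV.rayTo u η k) :
    ((k - dist u o : ℝ) : EReal) ≤ boundaryProduct o ξ η := by
  refine le_iInf fun x => le_iInf fun hx => le_iInf fun y => le_iInf fun hy => ?_
  apply le_liminf_of_le (by isBoundedDefault)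
  filter_upwards [(hV.represents_iff u _ _).1 hx k, (hV.represents_iff u _ _).1 hy k] with i h1 h2
  have := hV.le_gromovProduct_iff.2 ⟨_, (hV.rayTo_isRayFrom u ξ).dist_base k, h1, h ▸ h2⟩
  exact EReal.coe_le_coe_iff.2 (by linarith [gromovProduct_le_add u o (x i) (y i)])

theorem rayTo_eq_of_lt_boundaryProduct (u o : V) {ξ η : GromovBoundary V} {k : ℕ}
    (h : ((k + dist o u : ℝ) : EReal) < boundaryProduct o ξ η) :
    hV.rayTo u ξ k = hV.rayTo u η k := by
  have h1 : boundaryProduct o ξ η ≤ liminf (fun i : ℕ =>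
      ((gromovProduct o (hV.rayTo u ξ i) (hV.rayTo u η i) : ℝ) : EReal)) atTop :=
    iInf_le_of_le _ (iInf_le_of_le (hV.rayTo_represents u ξ)
      (iInf_le_of_le _ (iInf_le _ (hV.rayTo_represents u η))))
  have h2 := eventually_lt_of_lt_liminf (h.trans_le h1)
  obtain ⟨i, hi, hk⟩ := (h2.and (eventually_ge_atTop k)).exists
  have h3 := EReal.coe_lt_coe_iff.1 hi
  have h4 := gromovProduct_le_add o u (hV.rayTo u ξ i) (hV.rayTo u η i)
  obtain ⟨w, hw, hb, hb'⟩ := hV.le_gromovProduct_iff.1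
    (by linarith : (k : ℝ) ≤ gromovProduct u (hV.rayTo u ξ i) (hV.rayTo u η i))
  have e1 := hV.unique ((hV.rayTo_isRayFrom u ξ).betw hk) hb
    (by rw [(hV.rayTo_isRayFrom u ξ).dist_base, hw])
  have e2 := hV.unique ((hV.rayTo_isRayFrom u η).betw hk) hb'
    (by rw [(hV.rayTo_isRayFrom u η).dist_base, hw])
  rw [e1, e2]

/-- A large boundary product forces rays to agree up to a high level, and conversely. Basic visual
neighbourhoods and sets given by a common prefix therefore refine each other. -/
theorem isInducing_rayTo (u : V) : IsInducing (hV.rayTo u) := by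
  have := hV.discreteTopology
  refine ⟨le_antisymm ?_ ?_⟩
  · rw [← continuous_iff_le_induced]
    refine continuous_pi fun k => continuous_discrete_rng.2 fun v => ?_
    intro ξ hξ o
    refine ⟨k + dist o u, by positivity, fun η hη => ?_⟩
    have hξ' : hV.rayTo u ξ k = v := hξ
    show hV.rayTo u η k = v
    rw [← hξ']
    exact (hV.rayTo_eq_of_lt_boundaryProduct u o hη).symm
  · intro U hU
    refine isOpen_induced_iff.2 ⟨⋃ ξ ∈ U, ⋃ k ∈ {k | {η | hV.rayTo u η k = hV.rayTo u ξ k} ⊆ U},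
      {r | r k = hV.rayTo u ξ k}, ?_, ?_⟩
    · refine isOpen_biUnion fun ξ _ => isOpen_biUnion fun k _ => ?_
      exact (isOpen_discrete ({hV.rayTo u ξ k} : Set V)).preimage
        (continuous_apply (A := fun _ : ℕ => V) k)
    · ext ζ
      simp only [mem_preimage, mem_iUnion, mem_ofPred_eq, exists_prop]
      constructor
      · rintro ⟨ξ, hξ, k, hk, h⟩
        exact hk h
      · intro hζ
        obtain ⟨R, hR, hRU⟩ := hU ζ hζ u
        obtain ⟨k, hk⟩ := exists_nat_gt R
        refine ⟨ζ, hζ, k, fun η hη => hRU ?_, rfl⟩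
        have h1 := hV.le_boundaryProduct u u (show hV.rayTo u ζ k = hV.rayTo u η k from Eq.symm hη)
        rw [dist_self, sub_zero] at h1
        exact lt_of_lt_of_le (EReal.coe_lt_coe_iff.2 hk) h1

end IsTreeMetric

end TreeGeometry

/-! ### Limits of geodesics -/

section Limits

variable {Y : Type*} [MetricSpace Y]

/-- Geodesics of growing length in a proper space subconverge to a geodesic ray. -/
theorem exists_limit_ray {ι : Type*} (F : Ultrafilter ι) {o : Y}
    (hprop : ∀ R, IsCompact (Metric.closedBall o R)) {a : ι → ℝ → Y} {L : ι → ℝ} {D : ℝ}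
    (ha : ∀ n, GeodOn (a n) (L n)) (h0 : ∀ n, dist o (a n 0) ≤ D) (hL : ∀ T, ∀ᶠ n in F, T ≤ L n) :
    ∃ α : ℝ → Y, GRay α ∧ dist o (α 0) ≤ D ∧
      ∀ S, ∀ᶠ n in F, ∀ s ∈ Icc 0 S, dist (a n s) (α s) ≤ 3 := by
  have hlim : ∀ s : ℝ, ∃ y, 0 ≤ s → Tendsto (fun n => a n s) F (𝓝 y) := by
    intro s
    by_cases hs : 0 ≤ s
    · have hmem : ∀ᶠ n in F, a n s ∈ Metric.closedBall o (D + s) := by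
        filter_upwards [hL s] with n hn
        have h1 := ha n 0 ⟨le_rfl, hs.trans hn⟩ s ⟨hs, hn⟩
        rw [abs_sub_comm, sub_zero, abs_of_nonneg hs] at h1
        rw [Metric.mem_closedBall, dist_comm]
        linarith [dist_triangle o (a n 0) (a n s), h0 n]
      obtain ⟨y, -, hy⟩ := (hprop (D + s)).ultrafilter_le_nhds' (F.map fun n => a n s) hmem
      exact ⟨y, fun _ => hy⟩
    · exact ⟨o, fun h => absurd h hs⟩
  choose α hα using hlim
  have hray : GRay α := by
    intro s hs t ht
    have h1 := (hα s hs).dist (hα t ht)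
    have h2 : Tendsto (fun n => dist (a n s) (a n t)) F (𝓝 |s - t|) := by
      refine tendsto_const_nhds.congr' ?_
      filter_upwards [hL s, hL t] with n h3 h4
      exact (ha n s ⟨hs, h3⟩ t ⟨ht, h4⟩).symm
    exact tendsto_nhds_unique h1 h2
  refine ⟨α, hray, ?_, fun S => ?_⟩
  · exact le_of_tendsto (tendsto_const_nhds.dist (hα 0 le_rfl)) (Eventually.of_forall h0)
  -- The limit is only pointwise. It is uniform up to one at the finitely many integer times in `[0,
  -- S]`, and rounding a time down costs at most one on each of the two geodesics.
  · have h1 : ∀ j ∈ Finset.range (⌈S⌉₊ + 1), ∀ᶠ n in F, dist (a n j) (α j) ≤ 1 := by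
      intro j _
      have := (hα j (Nat.cast_nonneg j)).dist (tendsto_const_nhds (x := α j))
      rw [dist_self] at this
      exact this.eventually_le_const one_pos
    have h2 := (Finset.eventually_all _).2 h1
    filter_upwards [h2, hL S] with n hn hS s hs
    set j := ⌊s⌋₊ with hj
    have hj1 : (j : ℝ) ≤ s := Nat.floor_le hs.1
    have hj2 : s < j + 1 := Nat.lt_floor_add_one s
    have hj3 : j ∈ Finset.range (⌈S⌉₊ + 1) := by
      rw [Finset.mem_range]
      exact Nat.lt_succ_of_le ((Nat.floor_le_ceil s).trans (Nat.ceil_le_ceil hs.2))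
    have h3 := hn j hj3
    have h4 := ha n s ⟨hs.1, hs.2.trans hS⟩ j ⟨Nat.cast_nonneg j, hj1.trans (hs.2.trans hS)⟩
    have h5 := hray j (Nat.cast_nonneg j) s hs.1
    rw [abs_of_nonneg (by linarith)] at h4
    rw [abs_sub_comm, abs_of_nonneg (by linarith)] at h5
    linarith [dist_triangle4 (a n s) (a n j) (α j) (α s)]

end Limits

/-! ### The setting -/

section Setting

variable {G Y V : Type*} [Group G] [MetricSpace Y] [MulAction G Y] [MetricSpace V] [MulAction G V]

/-- The standing assumptions. -/
structure MorseSetting (G : Type*) {Y V : Type*} [Group G] [MetricSpace Y] [MulAction G Y]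
    [MetricSpace V] [MulAction G V] (κ : ℝ → ℝ) (o : Y) (p : Y → V) : Prop where
  geodesic : IsGeodesicSpace Y
  geometric : IsGeometricAction G Y
  tree : IsTreeMetric V
  cobounded : IsCoboundedAction G V
  sublinear : IsSublinear κ
  pos : 0 < κ 1
  proj : IsProjection G p
  inj : KappaInjective κ o p

/-- A Morse quasi-geodesic ray. -/
def IsMorse (k : ℝ → ℝ) (o : Y) (σ : ℝ → Y) : Prop :=
  ∃ K, 1 ≤ K ∧ (∀ t, QG K 0 t σ) ∧ ∃ M, WG k o (σ '' Ici 0) M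

/-- The ray `r` from `w` points to the end of `p ∘ σ`. -/
def HasEnd (p : Y → V) (w : V) (r : ℕ → V) (σ : ℝ → Y) : Prop :=
  IsRayFrom w r ∧ TendsTo w r atTop (fun t : ℝ => p (σ t))

/-- `σ` is contained in a sublinear neighbourhood of `τ`. -/
def Near (k : ℝ → ℝ) (o : Y) (σ τ : ℝ → Y) : Prop :=
  ∃ n, 0 ≤ n ∧ ∀ x, 0 ≤ x → ∃ s, 0 ≤ s ∧ dist (σ x) (τ s) ≤ n * k (dist o (σ x))

theorem GRay.isMorse {k : ℝ → ℝ} {o : Y} {α : ℝ → Y} (h : GRay α) {M : ℝ → ℝ}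
    (hM : WG k o (α '' Ici 0) M) : IsMorse k o α :=
  ⟨1, le_rfl, fun t => (h.geodOn t).qg, M, hM⟩

/-- Each Morse ray that follows a geodesic Morse ray is near it, and conversely. -/
theorem near_of_follows (hY : IsGeodesicSpace Y) {k : ℝ → ℝ} (hk : IsGauge k) {o : Y}
    {α σ : ℝ → Y} (hα : GRay α) {M : ℝ → ℝ} (hM : WG k o (α '' Ici 0) M) (hσ : IsMorse k o σ)
    {n : ℝ} (hn : 0 ≤ n)
    (hf : ∀ X, ∃ x, X ≤ x ∧ ∃ s, 0 ≤ s ∧ dist (σ x) (α s) ≤ n * k (dist o (σ x))) :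
    Near k o σ α ∧ Near k o α σ := by
  obtain ⟨K, hK, hqg, -⟩ := hσ
  have hl := one_le_lossConst hK
  set δ := dist (σ 0) (α 0) with hδ
  have hδ0 : 0 ≤ δ := dist_nonneg
  have h1 := hM.near_of_follows hY hk hK hqg le_rfl hn hf
  have h2 : ∀ x, 0 ≤ x → (∃ s, 0 ≤ s ∧ dist (σ x) (α s) ≤ |M (9 * K)| * k (dist o (σ x))) ∨
      dist (σ x) (σ 0) ≤ lossConst K * (δ + 1) := fun x hx => (h1 x hx).imp_left
    fun ⟨s, hs, h⟩ => ⟨s, hs, h.trans (mul_le_mul_of_nonneg_right (le_abs_self _) (hk.pos _).le)⟩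
  obtain ⟨U, C₀, hU, hC₀, h3⟩ := GRay.near_follower hk K |M (9 * K)| (dist o (α 0)) hK
    (abs_nonneg _) dist_nonneg
  have h4 := h3 o α σ δ hα le_rfl hqg le_rfl h2
  constructor
  · refine ⟨|M (9 * K)| + (lossConst K * (δ + 1) + δ), by positivity, fun x hx => ?_⟩
    have p := hk.one_le (dist o (σ x))
    rcases h2 x hx with ⟨s, hs, h⟩ | h
    · refine ⟨s, hs, h.trans ?_⟩
      have : 0 ≤ lossConst K * (δ + 1) + δ := by positivity
      nlinarith
    · refine ⟨0, le_rfl, ?_⟩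
      have t := dist_triangle (σ x) (σ 0) (α 0)
      have h5 : 0 ≤ lossConst K * (δ + 1) + δ := by positivity
      have h6 := mul_nonneg (abs_nonneg (M (9 * K))) (hk.pos (dist o (σ x))).le
      nlinarith
  · refine ⟨U + (C₀ * (δ + 1) + δ), by positivity, fun t ht => ?_⟩
    have p := hk.one_le (dist o (α t))
    rcases le_total (C₀ * (δ + 1)) t with h | h
    · obtain ⟨x, hx, hd⟩ := h4 t h
      refine ⟨x, hx, hd.trans ?_⟩
      have : 0 ≤ C₀ * (δ + 1) + δ := by positivity
      nlinarith
    · refine ⟨0, le_rfl, ?_⟩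
      have t1 := dist_triangle (α t) (α 0) (σ 0)
      have t2 := hα t ht 0 le_rfl
      rw [sub_zero, abs_of_nonneg ht] at t2
      rw [dist_comm (α 0) (σ 0)] at t1
      have h5 : 0 ≤ C₀ * (δ + 1) + δ := by positivity
      have h6 := mul_nonneg hU (hk.pos (dist o (α t))).le
      nlinarith

namespace MorseSetting

variable {κ : ℝ → ℝ} {o : Y} {p : Y → V} (h : MorseSetting G κ o p)
include h

theorem isGauge : IsGauge (gaugeOf κ) := h.sublinear.isGauge

theorem gaugeOf_dist (x y : Y) : gaugeOf κ (dist x y) = κ (dist x y) + 1 := by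
  unfold gaugeOf; rw [max_eq_left dist_nonneg]

theorem exists_covering : ∃ D, 0 ≤ D ∧ ∀ y : Y, ∃ g : G, dist y (g • o) ≤ D := by
  obtain ⟨K, hK, hc⟩ := h.geometric.cocompact
  obtain ⟨D, hD⟩ := hK.isBounded.subset_closedBall o
  refine ⟨max D 0, le_max_right _ _, fun y => ?_⟩
  obtain ⟨g, z, hz, rfl⟩ := hc y
  refine ⟨g, ?_⟩
  rw [h.geometric.isometric]
  exact (Metric.mem_closedBall.1 (hD hz)).trans (le_max_left _ _)

/-- A ball is covered by those translates of a compact fundamental set that meet it, and properness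
of the action leaves only finitely many. -/
theorem proper (R : ℝ) : IsCompact (Metric.closedBall o R) := by
  obtain ⟨K, hK, hc⟩ := h.geometric.cocompact
  obtain ⟨D, hD⟩ := hK.isBounded.subset_closedBall o
  have hfin := h.geometric.proper o (R + D)
  have hcpt : IsCompact (⋃ g ∈ {g : G | dist o (g • o) ≤ R + D}, (fun y : Y => g • y) '' K) := by
    refine hfin.isCompact_biUnion fun g _ => hK.image ?_
    exact (Isometry.of_dist_eq (h.geometric.isometric g)).continuous
  refine hcpt.of_isClosed_subset Metric.isClosed_closedBall fun y hy => ?_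
  obtain ⟨g, z, hz, rfl⟩ := hc y
  refine mem_iUnion₂.2 ⟨g, ?_, z, hz, rfl⟩
  have h1 := dist_triangle o (g • z) (g • o)
  rw [h.geometric.isometric] at h1
  have h2 := Metric.mem_closedBall.1 (hD hz)
  have h3 := Metric.mem_closedBall'.1 hy
  show dist o (g • o) ≤ R + D
  linarith

/-- Returns from the gauge `κ + 1` to `κ`. At norms of at least one the summand one is absorbed by
`κ / κ 1`. At smaller norms the base point `o ∈ Z` is close enough, because concavity gives `κ t ≥ t
* κ 1`; this is why rays are made to start at `o`. -/
theorem infDist_le {Z : Set Y} (hZ : o ∈ Z) {A : ℝ} (hA : 0 ≤ A) {y z : Y} (hz : z ∈ Z)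
    (hd : dist y z ≤ A * gaugeOf κ (dist o y)) :
    Metric.infDist y Z ≤ (A * (1 + 1 / κ 1) + 1 / κ 1) * κ (dist o y) := by
  have hp := h.pos
  rw [h.gaugeOf_dist] at hd
  rcases le_total 1 (dist o y) with h1 | h1
  · have h2 := h.sublinear.monotone (mem_Ici.2 zero_le_one) (mem_Ici.2 dist_nonneg) h1
    refine (Metric.infDist_le_dist_of_mem hz).trans (hd.trans ?_)
    have h3 : 1 ≤ 1 / κ 1 * κ (dist o y) := by
      rw [one_div, ← div_eq_inv_mul, le_div_iff₀ hp]; linarith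
    have h4 := mul_le_mul_of_nonneg_left h3 hA
    nlinarith
  · refine (Metric.infDist_le_dist_of_mem hZ).trans ?_
    have h2 := h.sublinear.concave.2 (mem_Ici.2 (zero_le_one (α := ℝ))) (mem_Ici.2 (le_refl (0 : ℝ)))
      (dist_nonneg (x := o) (y := y)) (by linarith : 0 ≤ 1 - dist o y) (by ring)
    simp only [smul_eq_mul, mul_one, mul_zero, add_zero] at h2
    have h3 := mul_nonneg (by linarith : 0 ≤ 1 - dist o y) (h.sublinear.nonneg 0 le_rfl)
    have h4 : dist o y ≤ 1 / κ 1 * κ (dist o y) := by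
      rw [one_div, ← div_eq_inv_mul, le_div_iff₀ hp]; linarith
    have h5 := h.sublinear.nonneg (dist o y) dist_nonneg
    have h6 : 0 ≤ A * (1 + 1 / κ 1) * κ (dist o y) := by positivity
    rw [dist_comm]; linarith

/-- A Morse quasi-geodesic ray, with its starting point replaced by the base point. -/
theorem exists_morseRay {σ : ℝ → Y} (hσ : IsMorse (gaugeOf κ) o σ) :
    ∃ γ : MorseRay κ o, γ.1 0 = o ∧ ∀ t : ℝ≥0, 0 < t → γ.1 t = σ t := by
  obtain ⟨K, hK, hqg, M, hM⟩ := hσ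
  have hk := h.isGauge
  set γ : ℝ≥0 → Y := fun t => if t = 0 then o else σ t with hγ
  have hγ0 : γ 0 = o := by simp [hγ]
  have hγt : ∀ t : ℝ≥0, 0 < t → γ t = σ t := fun t ht => by simp [hγ, ht.ne']
  set d := dist o (σ 0) with hd
  have hd0 : 0 ≤ d := dist_nonneg
  have hclose : ∀ t : ℝ≥0, dist (γ t) (σ t) ≤ d := by
    intro t
    rcases eq_or_ne t 0 with rfl | ht
    · rw [hγ0]; exact le_rfl
    · rw [hγt t (pos_iff_ne_zero.2 ht), dist_self]; exact hd0
  have hqi' : ∀ x y : ℝ≥0, x ≤ y → 1 / K * dist x y - (K + 2 * d) ≤ dist (γ x) (γ y) ∧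
      dist (γ x) (γ y) ≤ K * dist x y + (K + 2 * d) := by
    intro x y hxy
    have hxy' : (x : ℝ) ≤ y := by exact_mod_cast hxy
    have e : dist x y = (y : ℝ) - x := by
      rw [NNReal.dist_eq, abs_sub_comm, abs_of_nonneg (by linarith)]
    obtain ⟨h1, h2⟩ := hqg y x ⟨x.2, hxy'⟩ y ⟨y.2, le_rfl⟩ hxy'
    have h3 := dist_triangle4 (γ x) (σ x) (σ y) (γ y)
    have h4 := dist_triangle4 (σ x) (γ x) (γ y) (σ y)
    have h5 := hclose x
    have h6 := hclose y
    rw [e, one_div, ← div_eq_inv_mul]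
    rw [dist_comm (σ y) (γ y)] at h3
    rw [dist_comm (σ x) (γ x)] at h4
    constructor <;> linarith
  have hqi : IsQuasiIsometricEmbedding K (K + 2 * d) γ := by
    intro x y
    rcases le_total x y with hxy | hxy
    · exact hqi' x y hxy
    · rw [dist_comm x y, dist_comm (γ x)]; exact hqi' y x hxy
  obtain ⟨M', hM'⟩ := WG.transfer h.geodesic hk M (d + 2 * K) (by positivity)
  have hle : ∀ c y, 0 ≤ c → c ≤ d + 2 * K → c ≤ (d + 2 * K) * gaugeOf κ (dist o y) := by
    intro c y hc hcd
    have := hk.one_le (dist o y)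
    nlinarith
  have hWG : WG (gaugeOf κ) o (range γ) M' := by
    refine hM' o _ _ hM ?_ ?_
    · rintro _ ⟨t, rfl⟩
      exact ⟨σ t, ⟨t, t.2, rfl⟩, (hclose t).trans (hle d _ hd0 (by linarith))⟩
    · rintro _ ⟨t, ht, rfl⟩
      rcases eq_or_lt_of_le (mem_Ici.1 ht) with rfl | ht
      -- The value `σ 0` has been overwritten by `o`, so `γ 1` stands in for it.
      · refine ⟨γ 1, ⟨1, rfl⟩, ?_⟩
        rw [hγt 1 one_pos]
        have := (hqg 1).dist_le_two hK ⟨le_rfl, zero_le_one⟩ ⟨zero_le_one, le_rfl⟩ zero_le_one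
          (by norm_num)
        exact hle _ _ dist_nonneg (by simpa using this.trans (by linarith))
      · refine ⟨γ (NNReal.mk t ht.le), ⟨_, rfl⟩, ?_⟩
        rw [hγt (NNReal.mk t ht.le) ht, NNReal.coe_mk, dist_self]
        exact hle 0 _ le_rfl (by positivity)
  refine ⟨⟨γ, ⟨K, K + 2 * d, hK, by positivity, hqi⟩, fun K C =>
    ⟨|M' (max K C)| * (1 + 1 / κ 1) + 1 / κ 1, by have := h.pos; positivity⟩, ?_⟩, hγ0, hγt⟩
  intro K' C' hK' hC' s t hst β hβ hs ht u
  set K₁ := max K' C' with hK₁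
  have hK₁K : K' ≤ K₁ := le_max_left _ _
  have hK₁C : C' ≤ K₁ := le_max_right _ _
  have hq : QG K₁ s t (fun x => β (projIcc s t hst x)) := by
    intro x hx y hy hxy
    obtain ⟨h1, h2⟩ := hβ ⟨x, hx⟩ ⟨y, hy⟩
    simp only [projIcc_of_mem hst hx, projIcc_of_mem hst hy]
    have e : dist (⟨x, hx⟩ : Icc s t) ⟨y, hy⟩ = y - x := by
      rw [Subtype.dist_eq, Real.dist_eq, abs_sub_comm, abs_of_nonneg (by linarith)]
    rw [e] at h1 h2
    have h3 : (y - x) / K₁ ≤ (y - x) / K' :=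
      div_le_div_of_nonneg_left (by linarith) (by linarith) hK₁K
    have h4 : K' * (y - x) ≤ K₁ * (y - x) := mul_le_mul_of_nonneg_right hK₁K (by linarith)
    rw [one_div, ← div_eq_inv_mul] at h1
    constructor <;> linarith
  obtain ⟨z, hz, hdz⟩ := hWG K₁ (by linarith) s t _ hst hq (by simpa using hs) (by simpa using ht)
    u.1 u.2
  simp only [projIcc_val] at hdz
  exact h.infDist_le (Z := range γ) ⟨0, hγ0⟩ (abs_nonneg _) hz
    (hdz.trans (mul_le_mul_of_nonneg_right (le_abs_self _) (hk.pos _).le))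

theorem tendsTo_iff {σ : ℝ → Y} {γ : ℝ≥0 → Y} (hγ : ∀ t : ℝ≥0, 0 < t → γ t = σ t) (w : V) (r : ℕ → V) :
    TendsTo w r atTop (p ∘ γ) ↔ TendsTo w r atTop (fun t : ℝ => p (σ t)) := by
  constructor
  · intro h1 k
    have h2 := tendsto_real_toNNReal_atTop.eventually (h1 k)
    filter_upwards [h2, eventually_gt_atTop 0] with t h3 h4
    rw [Function.comp, hγ _ (Real.toNNReal_pos.2 h4), Real.coe_toNNReal _ h4.le] at h3
    exact h3
  · intro h1 k
    have h2 := NNReal.tendsto_coe_atTop.2 tendsto_id |>.eventually (h1 k)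
    filter_upwards [h2, eventually_gt_atTop 0] with t h3 h4
    rw [Function.comp, hγ _ h4]
    exact h3

theorem exists_hasEnd {σ : ℝ → Y} (hσ : IsMorse (gaugeOf κ) o σ) (w : V) :
    ∃ r, HasEnd p w r σ := by
  obtain ⟨γ, -, hγ⟩ := h.exists_morseRay hσ
  obtain ⟨ξ, hξ⟩ := h.inj.definesPoint γ
  refine ⟨_, h.tree.rayTo_isRayFrom w ξ, ?_⟩
  exact (h.tendsTo_iff hγ _ _).1 ((h.tree.definesPoint_iff w _ ξ).1 hξ)

omit h in
theorem hasEnd_unique (hV : IsTreeMetric V) {σ : ℝ → Y} {w : V} {r s : ℕ → V}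
    (h1 : HasEnd p w r σ) (h2 : HasEnd p w s σ) : r = s :=
  hV.tendsTo_unique h1.1 h2.1 h1.2 h2.2

/-- One direction of `κ`-injectivity, for rays that may start anywhere and with the gauge `κ + 1`,
which allows an infimum of distances to be replaced by an actual point. -/
theorem near_of_hasEnd {σ τ : ℝ → Y} (hσ : IsMorse (gaugeOf κ) o σ) (hτ : IsMorse (gaugeOf κ) o τ)
    {w : V} {r : ℕ → V} (h1 : HasEnd p w r σ) (h2 : HasEnd p w r τ) : Near (gaugeOf κ) o σ τ := by
  obtain ⟨γ, hγ0, hγ⟩ := h.exists_morseRay hσ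
  obtain ⟨δ, hδ0, hδ⟩ := h.exists_morseRay hτ
  obtain ⟨ξ, hξ⟩ := h.tree.exists_rayTo_eq w h1.1
  have hc := (h.inj.close_iff γ δ).2 ⟨ξ, (h.tree.definesPoint_iff w _ ξ).2
    (by rw [hξ]; exact (h.tendsTo_iff hγ _ _).2 h1.2), (h.tree.definesPoint_iff w _ ξ).2
    (by rw [hξ]; exact (h.tendsTo_iff hδ _ _).2 h2.2)⟩
  obtain ⟨n, hn, -⟩ := hc
  obtain ⟨K, hK, hqg, -⟩ := hσ
  have hk := h.isGauge
  set c := |n| + 1 + dist o (τ 0) + (dist o (σ 0)) with hcdef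
  refine ⟨c, by positivity, fun x hx => ?_⟩
  have p1 := hk.one_le (dist o (σ x))
  rcases eq_or_lt_of_le hx with rfl | hx
  · refine ⟨0, le_rfl, ?_⟩
    have := dist_triangle_left (σ 0) (τ 0) o
    have h3 : 0 ≤ |n| := abs_nonneg n
    have h4 := dist_nonneg (x := o) (y := σ 0)
    have h5 := dist_nonneg (x := o) (y := τ 0)
    nlinarith
  · have h3 := hn (mem_range_self (NNReal.mk x hx.le))
    rw [hγ (NNReal.mk x hx.le) hx, NNReal.coe_mk] at h3
    have h4 : Metric.infDist (σ x) (range δ.1) < n * κ (dist o (σ x)) + 1 :=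
      lt_of_le_of_lt h3 (lt_add_one _)
    obtain ⟨_, ⟨t, rfl⟩, h5⟩ := (Metric.infDist_lt_iff (range_nonempty _)).1 h4
    have h6 : n * κ (dist o (σ x)) + 1 ≤ (|n| + 1) * gaugeOf κ (dist o (σ x)) := by
      rw [h.gaugeOf_dist]
      have := h.sublinear.nonneg (dist o (σ x)) dist_nonneg
      have := mul_le_mul_of_nonneg_right (le_abs_self n) this
      nlinarith [abs_nonneg n]
    rcases eq_or_ne t 0 with rfl | ht
    · rw [hδ0] at h5
      refine ⟨0, le_rfl, ?_⟩
      have := dist_triangle (σ x) o (τ 0)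
      have h7 := dist_nonneg (x := o) (y := σ 0)
      have h8 := dist_nonneg (x := o) (y := τ 0)
      nlinarith
    · rw [hδ t (pos_iff_ne_zero.2 ht)] at h5
      refine ⟨t, t.2, ?_⟩
      have h7 := dist_nonneg (x := o) (y := σ 0)
      have h8 := dist_nonneg (x := o) (y := τ 0)
      nlinarith

/-- The other direction of `κ`-injectivity. The starting points are replaced by `o` before it is
applied. -/
theorem hasEnd_of_near {σ τ : ℝ → Y} (hσ : IsMorse (gaugeOf κ) o σ) (hτ : IsMorse (gaugeOf κ) o τ)
    (h1 : Near (gaugeOf κ) o σ τ) (h2 : Near (gaugeOf κ) o τ σ) {w : V} {r : ℕ → V}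
    (hr : HasEnd p w r τ) : HasEnd p w r σ := by
  have key : ∀ {σ τ : ℝ → Y}, IsMorse (gaugeOf κ) o τ → Near (gaugeOf κ) o σ τ → ∀ γ δ : MorseRay κ o,
      γ.1 0 = o → δ.1 0 = o → (∀ t : ℝ≥0, 0 < t → γ.1 t = σ t) → (∀ t : ℝ≥0, 0 < t → δ.1 t = τ t) →
      ∃ n, ∀ m, n ≤ m → range γ.1 ⊆ kappaNeighborhood κ o (range δ.1) m := by
    rintro σ τ ⟨K, hK, hqg, -⟩ ⟨n, hn, hnear⟩ γ δ hγ0 hδ0 hγ hδ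
    refine ⟨(n + dist o (τ 0) + 2 * K) * (1 + 1 / κ 1) + 1 / κ 1, fun m hm => ?_⟩
    have hp := h.pos
    rintro _ ⟨t, rfl⟩
    have hκ := h.sublinear.nonneg (dist o (γ.1 t)) dist_nonneg
    refine le_trans ?_ (mul_le_mul_of_nonneg_right hm hκ)
    rcases eq_or_ne t 0 with rfl | ht
    · rw [hγ0]
      rw [hγ0] at hκ
      rw [Metric.infDist_zero_of_mem (mem_range.2 ⟨0, hδ0⟩)]
      positivity
    · rw [hγ t (pos_iff_ne_zero.2 ht)]
      obtain ⟨s, hs, hd⟩ := hnear t t.2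
      have p1 := h.isGauge.one_le (dist o (σ t))
      have h7 := dist_nonneg (x := o) (y := τ 0)
      rcases eq_or_lt_of_le hs with rfl | hs
      · refine h.infDist_le (Z := range δ.1) ⟨0, hδ0⟩ (by positivity) (z := δ.1 1) ⟨1, rfl⟩ ?_
        rw [hδ 1 one_pos]
        have h8 := (hqg 1).dist_le_two hK ⟨le_rfl, zero_le_one⟩ ⟨zero_le_one, le_rfl⟩ zero_le_one
          (by norm_num)
        have h9 := dist_triangle (σ t) (τ 0) (τ 1)
        simp only [NNReal.coe_one]
        nlinarith
      · refine h.infDist_le (Z := range δ.1) ⟨0, hδ0⟩ (by positivity) (z := δ.1 (NNReal.mk s hs.le)) ⟨_, rfl⟩ ?_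
        rw [hδ (NNReal.mk s hs.le) hs, NNReal.coe_mk]
        nlinarith
  obtain ⟨γ, hγ0, hγ⟩ := h.exists_morseRay hσ
  obtain ⟨δ, hδ0, hδ⟩ := h.exists_morseRay hτ
  obtain ⟨n₁, hn₁⟩ := key hτ h1 γ δ hγ0 hδ0 hγ hδ
  obtain ⟨n₂, hn₂⟩ := key hσ h2 δ γ hδ0 hγ0 hδ hγ
  obtain ⟨ξ, hξ1, hξ2⟩ := (h.inj.close_iff γ δ).1
    ⟨max n₁ n₂, hn₁ _ (le_max_left _ _), hn₂ _ (le_max_right _ _)⟩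
  have e1 := (h.tendsTo_iff hγ _ _).1 ((h.tree.definesPoint_iff w _ ξ).1 hξ1)
  have e2 := (h.tendsTo_iff hδ _ _).1 ((h.tree.definesPoint_iff w _ ξ).1 hξ2)
  have e3 := h.tree.tendsTo_unique hr.1 (h.tree.rayTo_isRayFrom w ξ) hr.2 e2
  exact ⟨hr.1, by rw [e3]; exact e1⟩

/-- A Morse ray that follows a geodesic Morse ray has the same end. -/
theorem hasEnd_of_follows {α σ : ℝ → Y} (hα : GRay α) {M : ℝ → ℝ}
    (hM : WG (gaugeOf κ) o (α '' Ici 0) M) (hσ : IsMorse (gaugeOf κ) o σ) {n : ℝ} (hn : 0 ≤ n)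
    (hf : ∀ X, ∃ x, X ≤ x ∧ ∃ s, 0 ≤ s ∧ dist (σ x) (α s) ≤ n * gaugeOf κ (dist o (σ x))) {w : V}
    {r : ℕ → V} (hr : HasEnd p w r α) : HasEnd p w r σ := by
  obtain ⟨h1, h2⟩ := near_of_follows h.geodesic h.isGauge hα hM hσ hn hf
  exact h.hasEnd_of_near hσ (hα.isMorse hM) h1 h2 hr

/-! ### Equivariance -/

omit h in
theorem _root_.CantorChain.GRay.smul (hiso : ∀ (g : G) (x y : Y), dist (g • x) (g • y) = dist x y)
    {α : ℝ → Y} (hα : GRay α) (g : G) : GRay (fun t => g • α t) :=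
  fun s hs t ht => by rw [hiso]; exact hα s hs t ht

omit h in
theorem _root_.CantorChain.WG.smul (hiso : ∀ (g : G) (x y : Y), dist (g • x) (g • y) = dist x y)
    {k : ℝ → ℝ} {o : Y} {α : ℝ → Y} {S : Set ℝ} {M : ℝ → ℝ} (hM : WG k o (α '' S) M) (g : G) :
    WG k (g • o) ((fun t => g • α t) '' S) M := by
  rintro K hK s t β hst hβ ⟨a, ha, hs⟩ ⟨b, hb, ht⟩ x hx
  have hq : QG K s t (fun y => g⁻¹ • β y) := by
    intro y hy z hz hyz
    rw [hiso]; exact hβ y hy z hz hyz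
  obtain ⟨_, ⟨c, hc, rfl⟩, h1⟩ := hM K hK s t _ hst hq ⟨a, ha, by rw [← hs, inv_smul_smul]⟩
    ⟨b, hb, by rw [← ht, inv_smul_smul]⟩ x hx
  refine ⟨_, ⟨c, hc, rfl⟩, ?_⟩
  rw [← hiso g, smul_inv_smul, ← hiso g o, smul_inv_smul] at h1
  exact h1

theorem isMorse_smul {σ : ℝ → Y} (hσ : IsMorse (gaugeOf κ) o σ) (g : G) :
    IsMorse (gaugeOf κ) o (fun t => g • σ t) := by
  obtain ⟨K, hK, hqg, M, hM⟩ := hσ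
  refine ⟨K, hK, fun t x hx y hy hxy => ?_, _, (hM.smul h.geometric.isometric g).change_base h.isGauge
    (le_refl (dist (g • o) o))⟩
  rw [h.geometric.isometric]
  exact hqg t x hx y hy hxy

theorem betw_smul (g : G) {u v w : V} : Betw (g • u) (g • v) (g • w) ↔ Betw u v w := by
  unfold Betw
  rw [h.cobounded.isometric, h.cobounded.isometric, h.cobounded.isometric]

theorem isRayFrom_smul (g : G) {w : V} {r : ℕ → V} (hr : IsRayFrom w r) :
    IsRayFrom (g • w) (fun i => g • r i) :=
  ⟨congrArg (g • ·) hr.1, fun i j => by rw [h.cobounded.isometric]; exact hr.2 i j⟩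

theorem hasEnd_smul (g : G) {w : V} {r : ℕ → V} {σ : ℝ → Y} (hr : HasEnd p w r σ) :
    HasEnd p (g • w) (fun i => g • r i) (fun t => g • σ t) := by
  obtain ⟨C, hC⟩ := h.proj.coarselyEquivariant
  refine ⟨h.isRayFrom_smul g hr.1, ?_⟩
  have h1 : TendsTo (g • w) (fun i => g • r i) atTop (fun t : ℝ => g • p (σ t)) := by
    intro k
    filter_upwards [hr.2 k] with t ht
    exact (h.betw_smul g).2 ht
  exact IsTreeMetric.TendsTo.perturb h.tree (h.isRayFrom_smul g hr.1) h1
    (fun t => by rw [dist_comm]; exact hC g (σ t))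

end MorseSetting

end Setting

section Representatives

variable {G Y V : Type*} [Group G] [MetricSpace Y] [MulAction G Y] [MetricSpace V] [MulAction G V]

/-! ### Geodesic representatives -/

/-- A geodesic ray from `o`, all of whose initial segments are Morse. -/
def MorseGeod (k : ℝ → ℝ) (o : Y) (M : ℝ → ℝ) (α : ℝ → Y) : Prop :=
  GRay α ∧ α 0 = o ∧ ∀ ℓ, 0 ≤ ℓ → WG k o (α '' Icc 0 ℓ) M

theorem MorseGeod.wg {k : ℝ → ℝ} {o : Y} {M : ℝ → ℝ} {α : ℝ → Y} (h : MorseGeod k o M α) :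
    WG k o (α '' Ici 0) M := by
  rintro K hK s t β hst hβ ⟨a, ha, hs⟩ ⟨b, hb, ht⟩ x hx
  obtain ⟨z, hz, hd⟩ := h.2.2 (max a b) (le_max_of_le_left ha) K hK s t β hst hβ
    ⟨a, ⟨ha, le_max_left _ _⟩, hs⟩ ⟨b, ⟨hb, le_max_right _ _⟩, ht⟩ x hx
  exact ⟨z, image_mono Icc_subset_Ici_self hz, hd⟩

theorem MorseGeod.isMorse {k : ℝ → ℝ} {o : Y} {M : ℝ → ℝ} {α : ℝ → Y} (h : MorseGeod k o M α) :
    IsMorse k o α := h.1.isMorse h.wg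

theorem MorseGeod.norm {k : ℝ → ℝ} {o : Y} {M : ℝ → ℝ} {α : ℝ → Y} (h : MorseGeod k o M α) {t : ℝ}
    (ht : 0 ≤ t) : dist o (α t) = t := by
  have := h.1 0 le_rfl t ht
  rwa [h.2.1, abs_sub_comm, sub_zero, abs_of_nonneg ht] at this

namespace MorseSetting

variable {κ : ℝ → ℝ} {o : Y} {p : Y → V} (h : MorseSetting G κ o p)
include h

/-- Limits of uniformly Morse geodesic segments from a Morse set to itself. -/
theorem exists_geodesic_near (M : ℝ → ℝ) (m : ℝ) (hm : 1 ≤ m) :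
    ∃ D, 0 ≤ D ∧ ∀ σ : ℝ → Y, σ 0 = o → (∀ t, QG m 0 t σ) → WG (gaugeOf κ) o (σ '' Ici 0) M →
      ∃ α, GRay α ∧ α 0 = o ∧
        (∀ t, 0 ≤ t → ∃ x, 0 ≤ x ∧ dist (α t) (σ x) ≤ D * gaugeOf κ (dist o (α t))) ∧
        (∀ x, 0 ≤ x → ∃ t, 0 ≤ t ∧ dist (σ x) (α t) ≤ D * gaugeOf κ (dist o (σ x))) := by
  have hk := h.isGauge
  set k := gaugeOf κ with hkdef
  set m₀ := |M 1| with hm₀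
  have hm₀0 : 0 ≤ m₀ := abs_nonneg _
  obtain ⟨B, hB, hb⟩ := hk.comp_dist 3 (by norm_num)
  set A := m * (m * (1 + m₀ * (1 + B) + m)) + m + m₀ with hA
  have hA0 : 0 ≤ A := by positivity
  obtain ⟨B₂, hB₂, hb₂⟩ := hk.comp_dist A hA0
  refine ⟨3 + m₀ * B + (A * B₂ + 3), by positivity, fun σ hσ0 hσ hM => ?_⟩
  have hgeo : ∀ n : ℕ, ∃ a : ℝ → Y, a 0 = o ∧ a (dist o (σ n)) = σ n ∧ GeodOn a (dist o (σ n)) :=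
    fun n => exists_geodesic h.geodesic o (σ n)
  choose a ha0 ha1 hag using hgeo
  have hnn : ∀ n : ℕ, (0 : ℝ) ≤ n := fun n => Nat.cast_nonneg n
  have hL : ∀ T : ℝ, ∀ᶠ n : ℕ in (hyperfilter ℕ : Filter ℕ), T ≤ dist o (σ n) := by
    intro T
    obtain ⟨N, hN⟩ := exists_nat_ge (m * (T + m))
    refine Nat.hyperfilter_le_atTop ((eventually_ge_atTop N).mono fun n hn => ?_)
    have h1 := (hσ n 0 ⟨le_rfl, hnn n⟩ n ⟨hnn n, le_rfl⟩ (hnn n)).1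
    rw [hσ0, sub_zero] at h1
    have h2 : (N : ℝ) ≤ n := by exact_mod_cast hn
    have h3 : T + m ≤ n / m := by
      rw [le_div_iff₀ (by linarith), mul_comm]; linarith
    linarith
  obtain ⟨α, hα, hα0, hlim⟩ := exists_limit_ray (hyperfilter ℕ) (h.proper) hag
    (D := 0) (fun n => by rw [ha0, dist_self]) hL
  have hα0' : α 0 = o := (dist_le_zero.1 hα0).symm
  have hnear : ∀ n : ℕ, ∀ s ∈ Icc 0 (dist o (σ n)), ∃ y, 0 ≤ y ∧
      dist (a n s) (σ y) ≤ m₀ * k (dist o (a n s)) := by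
    intro n s hs
    obtain ⟨_, ⟨y, hy, rfl⟩, hd⟩ := hM 1 le_rfl 0 (dist o (σ n)) (a n) dist_nonneg (hag n).qg
      ⟨0, mem_Ici.2 le_rfl, by rw [hσ0, ha0]⟩ ⟨n, hnn n, (ha1 n).symm⟩ s hs
    exact ⟨y, hy, hd.trans (mul_le_mul_of_nonneg_right (le_abs_self _) (hk.pos _).le)⟩
  refine ⟨α, hα, hα0', fun t ht => ?_, fun x hx => ?_⟩
  · obtain ⟨n, h1, h2⟩ := ((hlim t).and (hL t)).exists
    have h3 := h1 t ⟨ht, le_rfl⟩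
    obtain ⟨y, hy, h4⟩ := hnear n t ⟨ht, h2⟩
    refine ⟨y, hy, ?_⟩
    have p1 := hk.one_le (dist o (α t))
    have h5 := (hb o (α t) (a n t) (by rw [dist_comm]; linarith)).2
    have h6 := dist_triangle_left (α t) (σ y) (a n t)
    have h7 := mul_le_mul_of_nonneg_left h5 hm₀0
    have h8 : 0 ≤ (A * B₂ + 3) * k (dist o (α t)) := by positivity
    linarith
  -- Each point of a long segment `a n` is near `σ`, at a time before or after `x`. Where this
  -- changes, `a n` passes near `σ x`. The bound `S` on the parameter of this place allows passing
  -- to the limit `α`.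
  · set S := dist o (σ x) + A * B₂ * k (dist o (σ x)) with hS
    obtain ⟨n, h1, h2⟩ := ((hlim S).and (Nat.hyperfilter_le_atTop
      (eventually_ge_atTop ⌈x⌉₊))).exists
    have hxn : x ≤ n := (Nat.le_ceil x).trans (by exact_mod_cast h2)
    let P : ℝ → Prop := fun s => ∃ y, 0 ≤ y ∧ y ≤ x ∧ dist (a n s) (σ y) ≤ m₀ * k (dist o (a n s))
    set L := dist o (σ n) with hLdef
    have hL0 : 0 ≤ L := dist_nonneg
    have hcross : ∃ s ∈ Icc 0 L, ∃ s' ∈ Icc 0 L, s ≤ s' ∧ s' ≤ s + 1 ∧ P s ∧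
        ∃ y', x ≤ y' ∧ dist (a n s') (σ y') ≤ m₀ * k (dist o (a n s')) := by
      by_cases hPL : P L
      · refine ⟨L, ⟨hL0, le_rfl⟩, L, ⟨hL0, le_rfl⟩, le_rfl, by linarith, hPL, n, hxn, ?_⟩
        rw [ha1, dist_self]
        exact mul_nonneg hm₀0 (hk.pos _).le
      · have hP0 : P 0 := ⟨0, le_rfl, hx, by
          rw [ha0, hσ0, dist_self]; exact mul_nonneg hm₀0 (hk.pos _).le⟩
        obtain ⟨s, hs, s', hs', c1, c2, c3, c4⟩ := exists_crossing hL0 hP0 hPL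
        refine ⟨s, hs, s', hs', c1, c2, c3, ?_⟩
        obtain ⟨y, hy, hd⟩ := hnear n s' hs'
        refine ⟨y, ?_, hd⟩
        by_contra hc
        exact c4 ⟨y, hy, (not_le.1 hc).le, hd⟩
    obtain ⟨s, hs, s', hs', c1, c2, ⟨y, hy0, hyx, hy⟩, y', hxy', hy'⟩ := hcross
    have e1 := hag n s hs s' hs'
    rw [abs_sub_comm, abs_of_nonneg (by linarith)] at e1
    have p1 := hk.one_le (dist o (a n s))
    have e2 := (hb o (a n s) (a n s') (by rw [e1]; linarith)).2
    have e3 := (hσ y' y ⟨hy0, hyx.trans hxy'⟩ y' ⟨hx.trans hxy', le_rfl⟩ (hyx.trans hxy')).1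
    have e4 := (hσ y' y ⟨hy0, hyx.trans hxy'⟩ x ⟨hx, hxy'⟩ hyx).2
    have e5 := dist_triangle4 (σ y) (a n s) (a n s') (σ y')
    rw [dist_comm (σ y) (a n s)] at e5
    have e6 := mul_le_mul_of_nonneg_left e2 hm₀0
    have e7 : (y' - y) / m ≤ (1 + m₀ * (1 + B) + m) * k (dist o (a n s)) := by
      have : (1 + m) ≤ (1 + m) * k (dist o (a n s)) := le_mul_of_one_le_right (by linarith) p1
      linarith
    rw [div_le_iff₀ (by linarith)] at e7
    have e8 : dist (a n s) (σ x) ≤ A * k (dist o (a n s)) := by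
      have f1 := dist_triangle (a n s) (σ y) (σ x)
      have f2 : m * (x - y) ≤ m * ((1 + m₀ * (1 + B) + m) * k (dist o (a n s)) * m) :=
        mul_le_mul_of_nonneg_left (by linarith) (by linarith)
      have f3 : m ≤ m * k (dist o (a n s)) := le_mul_of_one_le_right (by linarith) p1
      rw [hA]; linarith
    have e9 := mul_le_mul_of_nonneg_left (hb₂ o _ _ e8).1 hA0
    have e10 := hag n 0 ⟨le_rfl, hL0⟩ s hs
    rw [ha0, abs_sub_comm, sub_zero, abs_of_nonneg hs.1] at e10
    have e11 := dist_triangle_right o (a n s) (σ x)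
    have e12 := h1 s ⟨hs.1, by rw [hS]; linarith⟩
    refine ⟨s, hs.1, ?_⟩
    have e13 := dist_triangle_left (σ x) (α s) (a n s)
    have p2 := hk.one_le (dist o (σ x))
    have : 0 ≤ (3 + m₀ * B) * k (dist o (σ x)) := by positivity
    linarith

/-- Rays with uniform constants and gauge have uniformly Morse geodesic representatives. -/
theorem exists_representative (u : V) (N : ℝ → ℝ → ℝ≥0) (m : ℝ) (hm : 1 ≤ m) :
    ∃ M, ∀ γ : MorseRay κ o, IsQuasiIsometricEmbedding m m γ.1 → γ.1 0 = o →
      HasMorseGauge κ o (range γ.1) N → ∃ α, MorseGeod (gaugeOf κ) o M α ∧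
        HasEnd p u (h.tree.rayTo u (boundaryMap h.inj (Quot.mk _ γ))) α := by
  have hk := h.isGauge
  -- The added one pays for choosing a point that realises the distance to the ray only up to one.
  set M₀ : ℝ → ℝ := fun K => N K K + 1 with hM₀
  obtain ⟨D, hD, hgeo⟩ := h.exists_geodesic_near M₀ m hm
  obtain ⟨M₁, hM₁⟩ := WG.transfer h.geodesic hk M₀ D hD
  obtain ⟨M, hM⟩ := WG.segment (Y := Y) hk M₁
  refine ⟨M, fun γ hqi hγ0 hN => ?_⟩
  set σ : ℝ → Y := fun t => γ.1 t.toNNReal with hσ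
  have hσγ : ∀ t : ℝ≥0, γ.1 t = σ t := fun t => by simp [hσ]
  have hσ0 : σ 0 = o := by simpa [hσ] using hγ0
  have hqg : ∀ t, QG m 0 t σ := by
    intro t x hx y hy hxy
    obtain ⟨h1, h2⟩ := hqi x.toNNReal y.toNNReal
    rw [NNReal.dist_eq, Real.coe_toNNReal _ hx.1, Real.coe_toNNReal _ hy.1, abs_sub_comm,
      abs_of_nonneg (by linarith)] at h1 h2
    rw [one_div, ← div_eq_inv_mul] at h1
    exact ⟨h1, h2⟩
  have himg : σ '' Ici 0 = range γ.1 := by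
    ext z
    constructor
    · rintro ⟨t, _, rfl⟩; exact ⟨_, rfl⟩
    · rintro ⟨t, rfl⟩; exact ⟨t, t.2, (hσγ t).symm⟩
  have hWG : WG (gaugeOf κ) o (σ '' Ici 0) M₀ := by
    rw [himg]
    intro K hK s t β hst hβ hs ht x hx
    have h1 := hN K K hK (by linarith) s t hst (fun x => β x.1) (by
      have key : ∀ x y : Icc s t, x ≤ y → 1 / K * dist x y - K ≤ dist (β x) (β y) ∧
          dist (β x) (β y) ≤ K * dist x y + K := by
        intro x y hxy
        have hxy' : x.1 ≤ y.1 := hxy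
        have := hβ x x.2 y y.2 hxy'
        rw [Subtype.dist_eq, Real.dist_eq, abs_sub_comm, abs_of_nonneg (by linarith), one_div,
          ← div_eq_inv_mul]
        exact this
      intro x y
      rcases le_total x y with hxy | hxy
      · exact key x y hxy
      · rw [dist_comm x y, dist_comm (β x)]; exact key y x hxy) hs ht ⟨x, hx⟩
    have h2 : Metric.infDist (β x) (range γ.1) < N K K * κ (dist o (β x)) + 1 :=
      lt_of_le_of_lt h1 (lt_add_one _)
    obtain ⟨z, hz, hd⟩ := (Metric.infDist_lt_iff (range_nonempty _)).1 h2
    refine ⟨z, hz, hd.le.trans ?_⟩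
    rw [h.gaugeOf_dist]
    have h3 := h.sublinear.nonneg (dist o (β x)) dist_nonneg
    have h4 : (0 : ℝ) ≤ N K K := (N K K).2
    simp only [hM₀]
    nlinarith
  obtain ⟨α, hα, hα0, hn1, hn2⟩ := hgeo σ hσ0 hqg hWG
  have hα1 : WG (gaugeOf κ) o (α '' Ici 0) M₁ := by
    refine hM₁ o _ _ hWG ?_ ?_
    · rintro _ ⟨t, ht, rfl⟩
      obtain ⟨x, hx, hd⟩ := hn1 t ht
      exact ⟨_, ⟨x, hx, rfl⟩, hd⟩
    · rintro _ ⟨t, ht, rfl⟩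
      obtain ⟨x, hx, hd⟩ := hn2 t ht
      exact ⟨_, ⟨x, hx, rfl⟩, hd⟩
  refine ⟨α, ⟨hα, hα0, fun ℓ hℓ => hM o α hα hα1 ℓ hℓ⟩, ?_⟩
  refine h.hasEnd_of_near (hα.isMorse hα1) ⟨m, hm, hqg, _, hWG⟩ ⟨D, hD, hn1⟩ ⟨D, hD, hn2⟩
    ⟨h.tree.rayTo_isRayFrom u _, ?_⟩
  refine (h.tendsTo_iff (fun t _ => hσγ t) _ _).1 ((h.tree.definesPoint_iff u _ _).1 ?_)
  exact (h.inj.definesPoint γ).choose_spec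

theorem exists_boundaryMap_eq {σ : ℝ → Y} (hσ : IsMorse (gaugeOf κ) o σ) {u : V} {r : ℕ → V}
    (hr : HasEnd p u r σ) : ∃ ξ, h.tree.rayTo u (boundaryMap h.inj ξ) = r := by
  obtain ⟨γ, -, hγ⟩ := h.exists_morseRay hσ
  refine ⟨Quot.mk _ γ, ?_⟩
  have h1 : TendsTo u (h.tree.rayTo u (boundaryMap h.inj (Quot.mk _ γ))) atTop (p ∘ γ.1) :=
    (h.tree.definesPoint_iff u _ _).1 (h.inj.definesPoint γ).choose_spec
  exact h.tree.tendsTo_unique (h.tree.rayTo_isRayFrom u _) hr.1 ((h.tendsTo_iff hγ _ _).1 h1) hr.2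

/-! ### Building Morse rays -/

/-- Diverging rays do not follow each other. -/
theorem exists_lt_dist {φ₁ φ₂ : ℝ → Y} {M₁ M₂ : ℝ → ℝ} (h₁ : GRay φ₁)
    (hM₁ : WG (gaugeOf κ) o (φ₁ '' Ici 0) M₁) (h₂ : GRay φ₂)
    (hM₂ : WG (gaugeOf κ) o (φ₂ '' Ici 0) M₂) {w : V} {r s : ℕ → V} (hr : HasEnd p w r φ₁)
    (hs : HasEnd p w s φ₂) (hrs : r ≠ s) (n : ℝ) :
    ∃ X, ∀ x, X ≤ x → ∀ t, 0 ≤ t → n * gaugeOf κ (dist o (φ₁ x)) < dist (φ₁ x) (φ₂ t) := by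
  by_contra hcon
  push Not at hcon
  refine hrs (hasEnd_unique h.tree hr (h.hasEnd_of_follows h₂ hM₂ (h₁.isMorse hM₁)
    (le_max_right n 0) (fun X => ?_) hs))
  obtain ⟨x, hx, t, ht, hd⟩ := hcon X
  exact ⟨x, hx, t, ht, hd.trans (mul_le_mul_of_nonneg_right (le_max_left _ _) (h.isGauge.pos _).le)⟩

/-- Concatenations of long Morse segments that start along one of three diverging rays, where the
next ray can be chosen subject to one further restriction. -/
theorem exists_concatenation {φ : Fin 3 → ℝ → Y} {M : ℝ → ℝ} {D : ℝ} (hD : 0 ≤ D)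
    (hφ : ∀ j, GRay (φ j)) (h0 : ∀ j, dist o (φ j 0) ≤ D)
    (hM : ∀ j, WG (gaugeOf κ) o (φ j '' Ici 0) M) {w : V} {R : Fin 3 → ℕ → V}
    (hR : ∀ j, HasEnd p w (R j) (φ j)) (hinj : Function.Injective R) (S : Set G)
    (hfam : ∀ j L, ∃ (A : ℝ → Y) (ℓ : ℝ) (g : G), L ≤ ℓ ∧ GeodOn A ℓ ∧ dist o (A 0) ≤ D ∧
      dist (g • o) (A ℓ) ≤ D ∧ WG (gaugeOf κ) o (A '' Icc 0 ℓ) M ∧ g ∈ S ∧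
      ∀ s ∈ Icc 0 L, dist (A s) (φ j s) ≤ 3) :
    ∃ K, 1 ≤ K ∧ ∀ (bad : ℕ → G → Fin 3 → G → Fin 3 → Prop) (dem : ℕ → G → Fin 3 → ℝ),
      (∀ i b j b' j₁ j₂, bad i b j b' j₁ → bad i b j b' j₂ → j₁ = j₂) →
      ∃ (σ : ℝ → Y) (b : ℕ → G) (j : ℕ → Fin 3) (τ : ℕ → ℝ), (∀ t, QG K 0 t σ) ∧
        IsMorse (gaugeOf κ) o σ ∧ b 0 = 1 ∧ (∀ i : ℕ, (i : ℝ) ≤ τ i) ∧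
        (∀ i, (b i)⁻¹ * b (i + 1) ∈ S) ∧ (∀ i, ¬ bad i (b i) (j i) (b (i + 1)) (j (i + 1))) ∧
        ∀ i s, 0 ≤ s → s ≤ dem i (b i) (j i) → dist (σ (τ i + s)) (b i • φ (j i) s) ≤ 3 := by
  have hk := h.isGauge
  have hiso := h.geometric.isometric
  have hdiv : ∀ i j : Fin 3, ∃ E, 0 ≤ E ∧ (i ≠ j → ∀ E', E ≤ E' → ∀ (A : ℝ → Y) (ℓ : ℝ), GeodOn A ℓ →
      dist o (A ℓ) ≤ D →
      (∀ s ∈ Icc 0 ℓ, ∀ r, 0 ≤ r → (1 / 1000) * (ℓ - s + r) - E' ≤ dist (A s) (φ i r)) ∨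
      (∀ s ∈ Icc 0 ℓ, ∀ r, 0 ≤ r → (1 / 1000) * (ℓ - s + r) - E' ≤ dist (A s) (φ j r))) := by
    intro i j
    by_cases hij : i = j
    · exact ⟨0, le_rfl, fun hc => absurd hij hc⟩
    · obtain ⟨E, hE, hE'⟩ := exists_divergent h.geodesic hk hD (hφ i) (hφ j) (h0 i) (h0 j) (hM i) (hM j)
        (h.exists_lt_dist (hφ i) (hM i) (hφ j) (hM j) (hR i) (hR j) (fun hc => hij (hinj hc)))
      exact ⟨E, hE, fun _ => hE'⟩
  choose Ef hEf0 hEf using hdiv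
  set E₀ := ∑ i, ∑ j, Ef i j with hE₀
  have hE₀0 : 0 ≤ E₀ := Finset.sum_nonneg fun i _ => Finset.sum_nonneg fun j _ => hEf0 i j
  have hEle : ∀ i j, Ef i j ≤ E₀ := fun i j =>
    (Finset.single_le_sum (f := fun j => Ef i j) (fun j _ => hEf0 i j) (Finset.mem_univ j)).trans
      (Finset.single_le_sum (f := fun i => ∑ j, Ef i j)
        (fun i _ => Finset.sum_nonneg fun j _ => hEf0 i j) (Finset.mem_univ i))
  set E := E₀ + 3 + 2 * D with hE
  have hE0 : 0 ≤ E := by positivity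
  choose Af lf gf hl hgeod hst hsp hWG hS hnear using hfam
  -- The constant is fixed before `bad` and `dem`, since in the diagonal argument the demanded
  -- lengths depend on it.
  refine ⟨2 / (1 / 1000) + 5 * D + E + 2, by linarith, fun bad dem hbad => ?_⟩
  -- Of any two directions one diverges from the current segment, so at most one of the three does
  -- not. At most one is bad, hence an admissible direction remains.
  have hnext : ∀ i b j L, ∃ j', ¬ bad i b j (b * gf j L) j' ∧ ∀ s ∈ Icc 0 (lf j L), ∀ r, 0 ≤ r →
      (1 / 1000) * (lf j L - s + r) - E₀ ≤ dist (Af j L s) (gf j L • φ j' r) := by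
    intro i b j L
    let good : Fin 3 → Prop := fun j' => ∀ s ∈ Icc 0 (lf j L), ∀ r, 0 ≤ r →
      (1 / 1000) * (lf j L - s + r) - E₀ ≤ dist (Af j L s) (gf j L • φ j' r)
    have hgood : ∀ j₁ j₂, j₁ ≠ j₂ → good j₁ ∨ good j₂ := by
      intro j₁ j₂ hne
      have hd : ∀ s j' r, dist ((gf j L)⁻¹ • Af j L s) (φ j' r) = dist (Af j L s) (gf j L • φ j' r) := by
        intro s j' r
        rw [← hiso (gf j L), smul_inv_smul]
      have := hEf j₁ j₂ hne E₀ (hEle j₁ j₂) (fun s => (gf j L)⁻¹ • Af j L s) (lf j L)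
        (fun s hs t ht => by rw [hiso]; exact hgeod j L s hs t ht)
        (by rw [← hiso (gf j L), smul_inv_smul]; exact hsp j L)
      simp only [hd] at this
      exact this
    by_contra hcon
    push Not at hcon
    have hcon' : ∀ j', bad i b j (b * gf j L) j' ∨ ¬ good j' := by
      intro j'
      by_cases hb : bad i b j (b * gf j L) j'
      · exact Or.inl hb
      · right
        intro hg
        obtain ⟨s, hs, r, hr, hlt⟩ := hcon j' hb
        exact absurd (hg s hs r hr) (not_le.2 hlt)
    have hb := hbad i b j (b * gf j L)
    have h01 : (0 : Fin 3) ≠ 1 := by decide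
    have h02 : (0 : Fin 3) ≠ 2 := by decide
    have h12 : (1 : Fin 3) ≠ 2 := by decide
    rcases hcon' 0 with b0 | g0
    · rcases hcon' 1 with b1 | g1
      · exact h01 (hb _ _ b0 b1)
      · rcases hcon' 2 with b2 | g2
        · exact h02 (hb _ _ b0 b2)
        · exact (hgood 1 2 h12).elim g1 g2
    · rcases hcon' 1 with b1 | g1
      · rcases hcon' 2 with b2 | g2
        · exact h12 (hb _ _ b1 b2)
        · exact (hgood 0 2 h02).elim g0 g2
      · exact (hgood 0 1 h01).elim g0 g1
  choose jn hjn hjn' using hnext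
  -- The length has to exceed the demand as well as the growth condition of `Concat`; the factor
  -- `1000` is the inverse of the rate of divergence.
  let Lf : ℕ → G → Fin 3 → ℝ → ℝ := fun i b j c =>
    max (dem i b j + 1) (1000 * (4 * (E + 4 * D + 3) * (i + 1) ^ 3 * (c + 1)))
  let st : ℕ → G × Fin 3 × ℝ := fun i => Nat.rec (1, 0, 0) (fun i s =>
    (s.1 * gf s.2.1 (Lf i s.1 s.2.1 s.2.2), jn i s.1 s.2.1 (Lf i s.1 s.2.1 s.2.2),
      s.2.2 + lf s.2.1 (Lf i s.1 s.2.1 s.2.2))) i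
  set b : ℕ → G := fun i => (st i).1 with hb
  set j : ℕ → Fin 3 := fun i => (st i).2.1 with hj
  set c : ℕ → ℝ := fun i => (st i).2.2 with hc
  set L : ℕ → ℝ := fun i => Lf i (b i) (j i) (c i) with hLdef
  have hb1 : ∀ i, b (i + 1) = b i * gf (j i) (L i) := fun i => rfl
  have hj1 : ∀ i, j (i + 1) = jn i (b i) (j i) (L i) := fun i => rfl
  have hc1 : ∀ i, c (i + 1) = c i + lf (j i) (L i) := fun i => rfl
  set ℓ : ℕ → ℝ := fun i => lf (j i) (L i) with hℓ
  have hcl : ∀ i, c i = partialLength ℓ i := by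
    intro i
    induction i with
    | zero => simp [partialLength, hc, st]
    | succ i ih => rw [hc1, ih, partialLength_succ]
  have hL1 : ∀ i, dem i (b i) (j i) + 1 ≤ L i := fun i => le_max_left _ _
  have hL2 : ∀ i : ℕ, 1000 * (4 * (E + 4 * D + 3) * (i + 1) ^ 3 * (c i + 1)) ≤ L i :=
    fun i => le_max_right _ _
  have hc0 : ∀ i, 0 ≤ c i := by
    intro i
    induction i with
    | zero => simp [hc, st]
    | succ i ih =>
      rw [hc1]
      have := hL2 i
      have h2 : 0 ≤ 1000 * (4 * (E + 4 * D + 3) * ((i : ℝ) + 1) ^ 3 * (c i + 1)) := by positivity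
      linarith [hl (j i) (L i)]
  set X : ℕ → ℝ → Y := fun i t => b i • Af (j i) (L i) t with hX
  have hconcat : Concat (gaugeOf κ) X (fun i => b i • o) ℓ (1 / 1000) D E M := by
    refine ⟨by norm_num, by norm_num, hD, hE0, ?_, ?_, ?_, ?_, ?_, ?_⟩
    · intro i s hs t ht
      rw [hX, hiso]; exact hgeod _ _ s hs t ht
    · intro i
      rw [hX, hiso]; exact hst _ _
    · intro i
      rw [hX]
      simp only [hb1, mul_smul]
      rw [hiso]; exact hsp _ _
    · intro i
      exact (hWG (j i) (L i)).smul hiso (b i)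
    · intro i s hs r hr
      have e1 : dist (X i s) (X (i + 1) r) =
          dist (Af (j i) (L i) s) (gf (j i) (L i) • Af (j (i + 1)) (L (i + 1)) r) := by
        rw [hX]
        simp only [hb1 i, mul_smul]
        rw [hiso]
      rw [e1]
      rcases le_total r (L (i + 1)) with hrL | hrL
      · have h1 := hjn' i (b i) (j i) (L i) s hs r hr.1
        have h2 := hnear (j (i + 1)) (L (i + 1)) r ⟨hr.1, hrL⟩
        have h3 := dist_triangle_right (Af (j i) (L i) s) (gf (j i) (L i) • φ (j (i + 1)) r)
          (gf (j i) (L i) • Af (j (i + 1)) (L (i + 1)) r)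
        rw [hiso, dist_comm (φ (j (i + 1)) r)] at h3
        rw [← hj1] at h1
        have : ℓ i = lf (j i) (L i) := rfl
        have h4 := dist_triangle (Af (j i) (L i) s) (gf (j i) (L i) • Af (j (i + 1)) (L (i + 1)) r)
          (gf (j i) (L i) • φ (j (i + 1)) r)
        rw [hiso] at h4
        linarith
      -- Beyond the length `L (i + 1)` the segment need no longer follow `φ`. But there `r` is at
      -- least twelve times `ℓ i`, so the divergence follows from the triangle inequality.
      · have h1 := hL2 (i + 1)
        have h2 := hgeod (j i) (L i) s hs (lf (j i) (L i)) ⟨hs.1.trans hs.2, le_rfl⟩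
        rw [abs_sub_comm, abs_of_nonneg (by linarith [hs.2])] at h2
        have h3 := hgeod (j (i + 1)) (L (i + 1)) 0 ⟨le_rfl, hr.1.trans hr.2⟩ r hr
        rw [abs_sub_comm, sub_zero, abs_of_nonneg hr.1] at h3
        have h4 := dist_triangle4 (gf (j i) (L i) • Af (j (i + 1)) (L (i + 1)) 0)
          (gf (j i) (L i) • o) (Af (j i) (L i) (lf (j i) (L i)))
          (gf (j i) (L i) • Af (j (i + 1)) (L (i + 1)) r)
        rw [hiso, hiso, h3] at h4
        have h5 := hst (j (i + 1)) (L (i + 1))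
        rw [dist_comm] at h5
        have h6 := hsp (j i) (L i)
        have h7 := dist_triangle_left (Af (j i) (L i) (lf (j i) (L i)))
          (gf (j i) (L i) • Af (j (i + 1)) (L (i + 1)) r) (Af (j i) (L i) s)
        have h8 : ℓ i = lf (j i) (L i) := rfl
        have h9 : 12 * ℓ i ≤ L (i + 1) := by
          have h10 : (1 : ℝ) ≤ ((i + 1 : ℕ) + 1) ^ 3 :=
            one_le_pow₀ (by linarith [Nat.cast_nonneg (α := ℝ) (i + 1)])
          have h11 : 12 * 1 * (c (i + 1) + 1) ≤
              4 * (E + 4 * D + 3) * ((i + 1 : ℕ) + 1) ^ 3 * (c (i + 1) + 1) := by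
            have := hc0 (i + 1)
            gcongr
            linarith
          have h12 : c (i + 1) = c i + ℓ i := hc1 i
          have := hc0 i
          have := hc0 (i + 1)
          linarith
        have h10 : 0 ≤ ℓ i := hs.1.trans hs.2
        linarith [hs.1]
    · intro i
      rw [← hcl]
      have h1 := hL2 i
      have h2 := hl (j i) (L i)
      have h3 : ℓ i = lf (j i) (L i) := rfl
      rw [h3]
      linarith
  obtain ⟨σ, hσ1, ⟨M', hM'⟩, hσ3⟩ := hconcat.exists_morse_ray h.geodesic hk
  have hb0 : b 0 = 1 := rfl
  refine ⟨σ, b, j, partialLength ℓ, hσ1, ⟨_, by linarith, hσ1, M', ?_⟩, hb0,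
    hconcat.le_partialLength, ?_, ?_, ?_⟩
  · simpa only [hb0, one_smul] using hM'
  · intro i
    rw [hb1, inv_mul_cancel_left]
    exact hS _ _
  · intro i
    rw [hb1, hj1]
    exact hjn _ _ _ _
  · intro i s hs hsd
    have h1 := hL1 i
    have h2 := hl (j i) (L i)
    have h3 : ℓ i = lf (j i) (L i) := rfl
    rw [hσ3 i s hs (by linarith), hX, hiso]
    exact hnear _ _ s ⟨hs, by linarith⟩

end MorseSetting

end Representatives

section EndStabilizers

variable {G Y V : Type*} [Group G] [MetricSpace Y] [MulAction G Y] [MetricSpace V] [MulAction G V]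

/-! ### Limits of Morse geodesics -/

theorem MorseGeod.mono {k : ℝ → ℝ} (hk : IsGauge k) {o : Y} {M M' : ℝ → ℝ} {α : ℝ → Y}
    (h : MorseGeod k o M α) (hM : ∀ K, M K ≤ M' K) : MorseGeod k o M' α := by
  refine ⟨h.1, h.2.1, fun ℓ hℓ K hK s t β hst hβ hs ht x hx => ?_⟩
  obtain ⟨z, hz, hd⟩ := h.2.2 ℓ hℓ K hK s t β hst hβ hs ht x hx
  exact ⟨z, hz, hd.trans (mul_le_mul_of_nonneg_right (hM K) (hk.pos _).le)⟩

theorem IsTreeMetric.finite_interval (hV : IsTreeMetric V) (u x : V) : {v | Betw u v x}.Finite := by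
  refine Set.Finite.of_finite_image (f := fun v => dist u v) (Set.Finite.subset
    ((Set.finite_Iic ⌊dist u x⌋₊).image (fun n : ℕ => (n : ℝ))) ?_) ?_
  · rintro _ ⟨v, hv, rfl⟩
    obtain ⟨n, hn⟩ := hV.exists_nat u v
    refine ⟨n, ?_, hn.symm⟩
    have h1 : dist u v + dist v x = dist u x := hv
    exact Nat.le_floor (by rw [← hn]; linarith [dist_nonneg (x := v) (y := x)])
  · intro v hv v' hv' he
    exact hV.unique hv hv' he

theorem IsRayFrom.tail {u : V} {r : ℕ → V} (h : IsRayFrom u r) (l : ℕ) :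
    IsRayFrom (r l) (fun i => r (l + i)) := by
  refine ⟨by simp, fun i j => ?_⟩
  rw [h.2]
  push_cast
  congr 1
  ring

theorem IsRayFrom.injective {u : V} {r : ℕ → V} (h : IsRayFrom u r) : Function.Injective r := by
  intro i j hij
  have h1 := h.dist_base i
  rw [hij, h.dist_base j] at h1
  exact_mod_cast h1.symm

theorem HasEnd.tail {p : Y → V} {u : V} {r : ℕ → V} {σ : ℝ → Y} (h : HasEnd p u r σ) (l : ℕ) :
    HasEnd p (r l) (fun i => r (l + i)) σ :=
  ⟨h.1.tail l, fun i => (h.2 (l + i)).mono fun _ ht => (h.1.betw (Nat.le_add_right l i)).trans_right ht⟩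

namespace MorseSetting

variable {κ : ℝ → ℝ} {o : Y} {p : Y → V} (h : MorseSetting G κ o p)
include h

theorem exists_lipschitz : ∃ A, 0 ≤ A ∧ ∀ x y, dist (p x) (p y) ≤ A * dist x y + A := by
  obtain ⟨K, C, hKC⟩ := h.proj.coarselyLipschitz
  refine ⟨max 0 (max K C), le_max_left _ _, fun x y => (hKC x y).trans ?_⟩
  have h1 : K ≤ max 0 (max K C) := (le_max_left _ _).trans (le_max_right _ _)
  have h2 : C ≤ max 0 (max K C) := (le_max_right _ _).trans (le_max_right _ _)
  have := mul_le_mul_of_nonneg_right h1 (dist_nonneg (x := x) (y := y))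
  linarith

/-- Points near an orbit point project near the corresponding orbit point of the tree. -/
theorem exists_dist_orbit_le : ∃ A, 0 ≤ A ∧ ∀ (y z : Y) (g : G),
    dist (p y) (g • p z) ≤ A * dist y (g • z) + A := by
  obtain ⟨A, hA, hlip⟩ := h.exists_lipschitz
  obtain ⟨C, hC⟩ := h.proj.coarselyEquivariant
  refine ⟨A + max C 0, by positivity, fun y z g => ?_⟩
  have h1 := dist_triangle (p y) (p (g • z)) (g • p z)
  have h2 := hlip y (g • z)
  have h3 := hC g z
  have h4 := le_max_left C 0
  have h5 : 0 ≤ max C 0 * dist y (g • z) := by positivity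
  linarith

/-- An initial segment of the limit is within 3 of the corresponding segment of some `a n`, so
`WG.transfer` provides a gauge that depends on `M` alone. -/
theorem exists_limit (M : ℝ → ℝ) : ∃ M₁, (∀ K, M K ≤ M₁ K) ∧ ∀ {ι : Type} (F : Ultrafilter ι)
    (a : ι → ℝ → Y), (∀ n, MorseGeod (gaugeOf κ) o M (a n)) →
    ∃ α, MorseGeod (gaugeOf κ) o M₁ α ∧ ∀ S, ∀ᶠ n in F, ∀ s ∈ Icc 0 S, dist (a n s) (α s) ≤ 3 := by
  have hk := h.isGauge
  obtain ⟨M₁, hM₁⟩ := WG.transfer h.geodesic hk M 3 (by norm_num)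
  refine ⟨fun K => max (M K) (M₁ K), fun K => le_max_left _ _, fun {ι} F a ha => ?_⟩
  have hkey : ∃ α, GRay α ∧ α 0 = o ∧ ∀ S, ∀ᶠ n in F, ∀ s ∈ Icc 0 S, dist (a n s) (α s) ≤ 3 := by
    by_cases hF : ∃ n, (pure n : Ultrafilter ι) = F
    · obtain ⟨n, rfl⟩ := hF
      refine ⟨a n, (ha n).1, (ha n).2.1, fun S => ?_⟩
      rw [Ultrafilter.coe_pure, eventually_pure]
      intro s _
      rw [dist_self]; norm_num
    -- The `a n` are infinite; a factor `ℕ` supplies the lengths tending to infinity that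
    -- `exists_limit_ray` asks for.
    · obtain ⟨α, hα, hα0, hlim⟩ := exists_limit_ray (ι := ι × ℕ) (D := 0)
        (L := fun q => q.2) (a := fun q => a q.1) (Ultrafilter.of ((F : Filter ι) ×ˢ atTop)) h.proper
        (fun q => (ha q.1).1.geodOn _) (fun q => by rw [(ha q.1).2.1, dist_self]) (fun T =>
          Ultrafilter.of_le _ ((tendsto_snd.eventually
            ((tendsto_natCast_atTop_atTop (R := ℝ)).eventually_ge_atTop T))))
      refine ⟨α, hα, (dist_le_zero.1 hα0).symm, fun S => ?_⟩
      by_contra hcon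
      rw [← Ultrafilter.eventually_not] at hcon
      have h1 : ∀ᶠ q in (Ultrafilter.of ((F : Filter ι) ×ˢ (atTop : Filter ℕ)) : Filter (ι × ℕ)),
          ¬ ∀ s ∈ Icc 0 S, dist (a q.1 s) (α s) ≤ 3 :=
        Ultrafilter.of_le _ (tendsto_fst.eventually hcon)
      obtain ⟨q, hq1, hq2⟩ := (h1.and (hlim S)).exists
      exact hq1 hq2
  obtain ⟨α, hα, hα0, hlim⟩ := hkey
  refine ⟨α, MorseGeod.mono hk (M := M₁) ⟨hα, hα0, fun ℓ hℓ => ?_⟩ (fun K => le_max_right _ _), hlim⟩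
  obtain ⟨n, hn⟩ := (hlim ℓ).exists
  refine hM₁ o _ _ ((ha n).2.2 ℓ hℓ) ?_ ?_
  · rintro _ ⟨s, hs, rfl⟩
    refine ⟨_, ⟨s, hs, rfl⟩, ?_⟩
    have := hk.one_le (dist o (α s))
    rw [dist_comm (α s)]
    linarith [hn s hs]
  · rintro _ ⟨s, hs, rfl⟩
    refine ⟨_, ⟨s, hs, rfl⟩, ?_⟩
    have := hk.one_le (dist o (a n s))
    linarith [hn s hs]

/-! ### Rays with a common end -/

/-- Rays with the same end as seen from one point have the same end as seen from every point. -/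
theorem hasEnd_transfer {σ τ : ℝ → Y} (hσ : IsMorse (gaugeOf κ) o σ) (hτ : IsMorse (gaugeOf κ) o τ)
    {w : V} {r : ℕ → V} (h1 : HasEnd p w r σ) (h2 : HasEnd p w r τ) {v : V} {s : ℕ → V}
    (hs : HasEnd p v s σ) : HasEnd p v s τ :=
  h.hasEnd_of_near hτ hσ (h.near_of_hasEnd hτ hσ h2 h1) (h.near_of_hasEnd hσ hτ h1 h2) hs

/-- The elements that fix the end of a Morse ray. -/
def endStabilizer {α : ℝ → Y} (hα : IsMorse (gaugeOf κ) o α) {w : ℕ → V} {u : V}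
    (hw : HasEnd p u w α) : Subgroup G where
  carrier := {g | HasEnd p u w (fun t => g • α t)}
  one_mem' := by simpa using hw
  mul_mem' := by
    intro a b ha hb
    obtain ⟨s, hs⟩ := h.exists_hasEnd (h.isMorse_smul hα (a * b)) u
    have h1 := h.hasEnd_smul a hb
    have h2 := h.hasEnd_smul a hw
    have h3 := h.hasEnd_transfer (h.isMorse_smul hα a) (h.isMorse_smul (h.isMorse_smul hα b) a) h2 h1 ha
    simpa [mul_smul] using h3
  inv_mem' := by
    intro a ha
    have h1 := h.hasEnd_smul a⁻¹ ha
    have h2 := h.hasEnd_smul a⁻¹ hw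
    simp only [inv_smul_smul] at h1
    exact h.hasEnd_transfer hα (h.isMorse_smul hα a⁻¹) h1 h2 hw

theorem mem_endStabilizer {α : ℝ → Y} (hα : IsMorse (gaugeOf κ) o α) {w : ℕ → V} {u : V}
    (hw : HasEnd p u w α) {g : G} :
    g ∈ h.endStabilizer hα hw ↔ HasEnd p u w (fun t => g • α t) := Iff.rfl

theorem inv_mul_mem_endStabilizer {α : ℝ → Y} (hα : IsMorse (gaugeOf κ) o α) {w : ℕ → V} {u : V}
    (hw : HasEnd p u w α) {a b : G} {r : ℕ → V} (ha : HasEnd p u r (fun t => a • α t))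
    (hb : HasEnd p u r (fun t => b • α t)) : a⁻¹ * b ∈ h.endStabilizer hα hw := by
  have h1 := h.hasEnd_smul a⁻¹ ha
  have h2 := h.hasEnd_smul a⁻¹ hb
  simp only [inv_smul_smul] at h1
  rw [mem_endStabilizer]
  simp only [mul_smul]
  exact h.hasEnd_transfer hα (h.isMorse_smul (h.isMorse_smul hα b) a⁻¹) h1 h2 hw

/-- An element fixing the end of `α` shifts the rays towards this end. -/
theorem endStabilizer_shift {α : ℝ → Y} (hα : IsMorse (gaugeOf κ) o α) {w : ℕ → V} {u : V}
    (hw : HasEnd p u w α) {g : G} (hg : g ∈ h.endStabilizer hα hw) {l k : ℕ} (hlk : g • w l = w k)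
    (i : ℕ) : g • w (l + i) = w (k + i) := by
  have h1 := h.hasEnd_smul g (hw.tail l)
  rw [hlk] at h1
  have h2 := h.hasEnd_transfer hα (h.isMorse_smul hα g) hw hg (hw.tail k)
  exact congrFun (hasEnd_unique h.tree h1 h2) i

/-- Rays that follow a Morse geodesic `α` come close to all points of `α`, except possibly near
the start of `α`. -/
theorem exists_follower (M : ℝ → ℝ) : ∃ U C₀, 0 ≤ U ∧ 0 ≤ C₀ ∧ ∀ α σ : ℝ → Y,
    MorseGeod (gaugeOf κ) o M α → GRay σ → (∃ n, 0 ≤ n ∧ ∀ X, ∃ x, X ≤ x ∧ ∃ s, 0 ≤ s ∧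
      dist (σ x) (α s) ≤ n * gaugeOf κ (dist o (σ x))) → ∀ δ, dist (σ 0) o ≤ δ →
    ∀ t, C₀ * (δ + 1) ≤ t → ∃ x, 0 ≤ x ∧ dist (α t) (σ x) ≤ U * gaugeOf κ t := by
  have hk := h.isGauge
  obtain ⟨U, C₀, hU, hC₀, H⟩ := GRay.near_follower hk 1 |M (9 * 1)| 0 le_rfl (abs_nonneg _) le_rfl
  refine ⟨U, C₀, hU, hC₀, fun α σ hα hσ ⟨n, hn, hf⟩ δ hδ t ht => ?_⟩
  have hδ0 : 0 ≤ δ := dist_nonneg.trans hδ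
  have hqg : ∀ t, QG 1 0 t σ := fun t => (hσ.geodOn t).qg
  have ht0 : 0 ≤ t := le_trans (by positivity) ht
  obtain ⟨x, hx, hd⟩ := H o α σ δ hα.1 (by rw [hα.2.1, dist_self]) hqg (by rwa [hα.2.1])
    (fun x hx => by
      rcases WG.near_of_follows (δ := δ) h.geodesic hk hα.wg le_rfl hqg (by rwa [hα.2.1]) hn hf x hx
        with ⟨s, hs, hd⟩ | hd
      · exact Or.inl ⟨s, hs, hd.trans (mul_le_mul_of_nonneg_right (le_abs_self _) (hk.pos _).le)⟩
      · exact Or.inr hd) t ht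
  rw [hα.norm ht0] at hd
  exact ⟨x, hx, hd⟩

/-- An infinite product of elements that fix a point of the tree does not converge, so that there are
no three diverging families of Morse segments along such elements. -/
theorem not_three_families {φ : Fin 3 → ℝ → Y} {M : ℝ → ℝ} {D : ℝ} (hD : 0 ≤ D)
    (hφ : ∀ j, GRay (φ j)) (h0 : ∀ j, dist o (φ j 0) ≤ D)
    (hM : ∀ j, WG (gaugeOf κ) o (φ j '' Ici 0) M) {w : V} {R : Fin 3 → ℕ → V}
    (hR : ∀ j, HasEnd p w (R j) (φ j)) (hinj : Function.Injective R)
    (hfam : ∀ j L, ∃ (A : ℝ → Y) (ℓ : ℝ) (g : G), L ≤ ℓ ∧ GeodOn A ℓ ∧ dist o (A 0) ≤ D ∧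
      dist (g • o) (A ℓ) ≤ D ∧ WG (gaugeOf κ) o (A '' Icc 0 ℓ) M ∧ g • w = w ∧
      ∀ s ∈ Icc 0 L, dist (A s) (φ j s) ≤ 3) : False := by
  obtain ⟨L, hL⟩ : ∃ L, Function.Injective fun j => R j L := by
    have h1 : ∀ i j, ∃ L, i ≠ j → R i L ≠ R j L := by
      intro i j
      by_cases hij : i = j
      · exact ⟨0, fun hc => absurd hij hc⟩
      · obtain ⟨L, hL⟩ := Function.ne_iff.1 (hinj.ne hij)
        exact ⟨L, fun _ => hL⟩
    choose Lf hLf using h1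
    obtain ⟨L, hL⟩ := ((eventually_all.2 fun i => eventually_all.2 fun j =>
      eventually_ge_atTop (Lf i j) : ∀ᶠ L : ℕ in atTop, ∀ i j, Lf i j ≤ L)).exists
    refine ⟨L, fun i j hij => ?_⟩
    by_contra hne
    exact hLf i j hne (h.tree.ray_eq_of_le (hR i).1 (hR j).1 (hL i j) hij)
  obtain ⟨A, hA, horb⟩ := h.exists_dist_orbit_le
  obtain ⟨m, hm⟩ := exists_nat_gt (A * 3 + A)
  obtain ⟨t, ht0, ht⟩ : ∃ t : ℝ, 0 ≤ t ∧ ∀ j, Betw w (R j (L + m)) (p (φ j t)) :=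
    ((eventually_ge_atTop 0).and (eventually_all.2 fun j => (hR j).2 (L + m))).exists
  -- All `b i` fix `w`, so the vertices `b i • R (j i) L` have distance `L` from `w`, and the
  -- restriction makes consecutive ones different. The projection of `σ` runs behind each of them in
  -- turn, which contradicts the existence of its end.
  obtain ⟨K, hK, H⟩ := h.exists_concatenation hD hφ h0 hM hR hinj {g | g • w = w} hfam
  obtain ⟨σ, b, j, τ, -, hσ, hb0, hτ, hb, hgood, hdem⟩ := H
    (fun _ b j b' j' => b • R j L = b' • R j' L) (fun _ _ _ => t)
    (fun i b j b' j₁ j₂ h1 h2 => hL (smul_left_cancel b' (h1.symm.trans h2)))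
  have hbw : ∀ i, b i • w = w := by
    intro i
    induction i with
    | zero => rw [hb0, one_smul]
    | succ i ih =>
      have h1 : ((b i)⁻¹ * b (i + 1)) • w = w := hb i
      rw [mul_smul, inv_smul_eq_iff, ih] at h1
      exact h1
  obtain ⟨r, hr⟩ := h.exists_hasEnd hσ w
  have hpass : ∀ i, Betw w (b i • R (j i) L) (p (σ (τ i + t))) := by
    intro i
    have h1 := h.betw_smul (b i) |>.2 (ht (j i))
    have h2 := h.betw_smul (b i) |>.2 ((hR (j i)).1.betw (Nat.le_add_right L m))
    rw [hbw] at h1 h2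
    refine h.tree.betw_of_dist_lt h2 h1 ?_
    have h3 := h2.trans_right h1
    have h4 : dist (b i • R (j i) L) (b i • R (j i) (L + m)) = m := by
      rw [h.cobounded.isometric, (hR (j i)).1.2]
      push_cast
      rw [show (L : ℝ) - (L + m) = -m by ring, abs_neg, abs_of_nonneg (Nat.cast_nonneg m)]
    have h5 : dist (b i • R (j i) L) (b i • R (j i) (L + m)) +
      dist (b i • R (j i) (L + m)) (b i • p (φ (j i) t)) = dist (b i • R (j i) L) (b i • p (φ (j i) t)) := h3
    have h6 := horb (σ (τ i + t)) (φ (j i) t) (b i)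
    have h7 := hdem i t ht0 le_rfl
    have h8 := mul_le_mul_of_nonneg_left h7 hA
    rw [dist_comm] at h6
    linarith [dist_nonneg (x := b i • R (j i) (L + m)) (y := b i • p (φ (j i) t))]
  have htend : Tendsto (fun i => τ i + t) atTop atTop :=
    tendsto_atTop_mono (fun i => by linarith [hτ i]) (tendsto_natCast_atTop_atTop (R := ℝ))
  obtain ⟨i, hi, hi'⟩ := ((htend.eventually (hr.2 L)).and
    ((tendsto_add_atTop_nat 1).eventually (htend.eventually (hr.2 L)))).exists
  have heq : ∀ i, Betw w (r L) (p (σ (τ i + t))) → b i • R (j i) L = r L := by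
    intro i hi
    refine h.tree.unique (hpass i) hi ?_
    rw [hr.1.dist_base]
    conv_lhs => rw [← hbw i]
    rw [h.cobounded.isometric, (hR (j i)).1.dist_base]
  exact hgood i ((heq i hi).trans (heq (i + 1) hi').symm)

end MorseSetting

end EndStabilizers

section Axes

variable {G Y V : Type*} [Group G] [MetricSpace Y] [MulAction G Y] [MetricSpace V] [MulAction G V]

/-! ### Elements that fix the end of a Morse ray -/

theorem dist_pow_smul_le (hiso : ∀ (g : G) (x y : Y), dist (g • x) (g • y) = dist x y) (g : G) (o : Y)
    (a b : ℕ) : dist (g ^ a • o) (g ^ b • o) ≤ |(a : ℝ) - b| * dist o (g • o) := by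
  have key : ∀ n a : ℕ, dist (g ^ a • o) (g ^ (a + n) • o) ≤ n * dist o (g • o) := by
    intro n a
    induction n with
    | zero => simp
    | succ n ih =>
      have h1 := dist_triangle (g ^ a • o) (g ^ (a + n) • o) (g ^ (a + (n + 1)) • o)
      rw [← add_assoc, pow_succ g (a + n), mul_smul, hiso] at h1
      rw [← add_assoc, pow_succ g (a + n), mul_smul]
      push_cast
      linarith
  rcases le_total a b with hab | hab
  · obtain ⟨n, rfl⟩ := Nat.exists_eq_add_of_le hab
    have := key n a
    push_cast
    rwa [show (a : ℝ) - (a + n) = -n by ring, abs_neg, abs_of_nonneg (Nat.cast_nonneg n)]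
  · obtain ⟨n, rfl⟩ := Nat.exists_eq_add_of_le hab
    have := key n b
    push_cast
    rwa [show (b : ℝ) + n - b = n by ring, abs_of_nonneg (Nat.cast_nonneg n), dist_comm]

namespace MorseSetting

variable {κ : ℝ → ℝ} {o : Y} {p : Y → V} (h : MorseSetting G κ o p)
include h

/-- If `g` fixes the end of the Morse geodesic `α` and moves its starting point far along `α`, then
the powers of `g` move it along `α`. -/
theorem exists_axis (M : ℝ → ℝ) : ∃ ε L₀, 0 < ε ∧ ∀ (α : ℝ → Y) (hα : MorseGeod (gaugeOf κ) o M α)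
    (u : V) (w : ℕ → V) (hw : HasEnd p u w α) (g : G), g ∈ h.endStabilizer hα.isMorse hw →
    ∀ t, 0 ≤ t → L₀ ≤ dist o (g • o) → dist (g • o) (α t) ≤ ε * dist o (g • o) →
    ∀ m : ℕ, ∃ s, 0 ≤ s ∧ dist (g ^ m • o) (α s) ≤ dist o (g • o) := by
  have hk := h.isGauge
  have hiso := h.geometric.isometric
  obtain ⟨U, C₀, hU, hC₀, H⟩ := h.exists_follower M
  -- Small enough that a ray starting within `c * r` of `o` already follows `α` closely at the
  -- parameter `t`, which is at least `r / 2`.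
  set c : ℝ := 1 / (4 * (C₀ + 1)) with hc
  have hc0 : 0 < c := by positivity
  have hc1 : C₀ * c ≤ 1 / 4 := by
    rw [hc, mul_one_div, div_le_div_iff₀ (by positivity) (by norm_num)]; linarith
  have hc2 : c ≤ 1 / 4 := by
    rw [hc, div_le_div_iff₀ (by positivity) (by norm_num)]; linarith
  obtain ⟨L₁, hL₁⟩ := eventually_atTop.1 (hk.eventually_le (4 * U / c) 0 (by positivity))
  refine ⟨c / 2, max L₁ (4 * C₀), by positivity, fun α hα u w hw g hg t ht hr hgt m => ?_⟩
  set r := dist o (g • o) with hrdef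
  have hr0 : 0 ≤ r := dist_nonneg
  have hr1 := hL₁ r ((le_max_left _ _).trans hr)
  have hr2 := (le_max_right _ _).trans hr
  have hUk : U * gaugeOf κ (2 * r) ≤ c / 2 * r := by
    have h1 := mul_le_mul_of_nonneg_left (hk.double_le hr0) hU
    have h2 : c / 2 * (4 * U / c * gaugeOf κ r) ≤ c / 2 * r :=
      mul_le_mul_of_nonneg_left (by linarith) (by positivity)
    have h3 : c / 2 * (4 * U / c * gaugeOf κ r) = U * (2 * gaugeOf κ r) := by field_simp; ring
    linarith
  have hcr : c * r ≤ 1 / 4 * r := mul_le_mul_of_nonneg_right hc2 hr0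
  have htn := hα.norm ht
  have ht1 : r / 2 ≤ t := by
    have := dist_triangle_right o (g • o) (α t)
    linarith
  have ht2 : t ≤ 2 * r := by
    have := dist_triangle o (g • o) (α t)
    linarith
  have ht3 : C₀ * (c * r + 1) ≤ t := by
    have : C₀ * c * r ≤ 1 / 4 * r := mul_le_mul_of_nonneg_right hc1 hr0
    linarith
  -- The error does not accumulate. The tail of `α` from `s`, moved back by `g ^ m`, starts within
  -- `c * r` of `o` and has the same end as `α`, so it passes near `α t` and hence within `c * r` of
  -- `g • o`.
  have key : ∃ s, 0 ≤ s ∧ dist (g ^ m • o) (α s) ≤ c * r := by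
    induction m with
    | zero => exact ⟨0, le_rfl, by rw [hα.2.1, pow_zero, one_smul, dist_self]; positivity⟩
    | succ m ih =>
      obtain ⟨s, hs, hd⟩ := ih
      have hmem := (h.endStabilizer hα.isMorse hw).inv_mem ((h.endStabilizer hα.isMorse hw).pow_mem hg m)
      obtain ⟨n, hn, hnear⟩ := h.near_of_hasEnd (h.isMorse_smul hα.isMorse (g ^ m)⁻¹) hα.isMorse hmem hw
      obtain ⟨x, hx, hx'⟩ := H α (fun x => (g ^ m)⁻¹ • α (s + x)) hα
        (fun x hx y hy => by
          rw [hiso, hα.1 _ (add_nonneg hs hx) _ (add_nonneg hs hy)]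
          congr 1; ring)
        ⟨n, hn, fun X => by
          have h0 := le_max_right X 0
          obtain ⟨y, hy, hd⟩ := hnear (s + max X 0) (by positivity)
          exact ⟨max X 0, le_max_left _ _, y, hy, hd⟩⟩ (c * r)
        (by rw [← hiso (g ^ m), smul_inv_smul, add_zero, dist_comm]; exact hd) t ht3
      refine ⟨s + x, add_nonneg hs hx, ?_⟩
      have h1 : dist (g ^ (m + 1) • o) (α (s + x)) = dist (g • o) ((g ^ m)⁻¹ • α (s + x)) := by
        rw [← hiso (g ^ m) (g • o), smul_inv_smul, pow_succ, mul_smul]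
      have h2 := dist_triangle (g • o) (α t) ((g ^ m)⁻¹ • α (s + x))
      have h3 := mul_le_mul_of_nonneg_left (hk.mono ht2) hU
      rw [h1]
      linarith
  obtain ⟨s, hs, hd⟩ := key
  exact ⟨s, hs, by linarith⟩

/-- If some element translates along the Morse geodesic `α`, then only finitely many elements fix a
ray in the tree that points to the end of `α`. -/
theorem finite_of_axis {M : ℝ → ℝ} {α : ℝ → Y} (hα : MorseGeod (gaugeOf κ) o M α) {u : V} {w : ℕ → V}
    (hw : HasEnd p u w α) {g : G} (hg : g ∈ h.endStabilizer hα.isMorse hw) {l τ : ℕ} (hτ : 1 ≤ τ)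
    (hgl : g • w l = w (l + τ))
    (hax : ∀ m : ℕ, ∃ s, 0 ≤ s ∧ dist (g ^ m • o) (α s) ≤ dist o (g • o)) :
    {x | x ∈ h.endStabilizer hα.isMorse hw ∧ x • w l = w l}.Finite := by
  have hk := h.isGauge
  have hiso := h.geometric.isometric
  have hisoV := h.cobounded.isometric
  obtain ⟨U, C₀, hU, hC₀, H⟩ := h.exists_follower M
  obtain ⟨A, hA, horb⟩ := h.exists_dist_orbit_le
  set H₀ := h.endStabilizer hα.isMorse hw with hH₀
  set D : Set G := {x | x ∈ H₀ ∧ x • w l = w l} with hD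
  set r := dist o (g • o) with hr
  have hr0 : 0 ≤ r := dist_nonneg
  set q := dist (p o) (w l) with hq
  choose T hT0 hT using hax
  have hgm : ∀ m : ℕ, g ^ m • w l = w (l + m * τ) := by
    intro m
    induction m with
    | zero => simp
    | succ m ih =>
      rw [pow_succ', mul_smul, ih, h.endStabilizer_shift hα.isMorse hw hg hgl]
      congr 1; ring
  have hpo : ∀ b : G, dist (p (b • o)) (b • p o) ≤ A := by
    intro b
    have := horb (b • o) o b
    rwa [dist_self, mul_zero, zero_add] at this
  have hTnorm : ∀ m, dist o (g ^ m • o) ≤ T m + r := by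
    intro m
    have h1 := dist_triangle_right o (g ^ m • o) (α (T m))
    rw [hα.norm (hT0 m)] at h1
    linarith [hT m]
  have hT00 : T 0 ≤ r := by
    have h1 := hT 0
    rwa [pow_zero, one_smul, hα.norm (hT0 0)] at h1
  have hTstep : ∀ m, T (m + 1) ≤ T m + 3 * r := by
    intro m
    have h1 := dist_triangle4 (α (T m)) (g ^ m • o) (g ^ (m + 1) • o) (α (T (m + 1)))
    rw [hα.1 _ (hT0 m) _ (hT0 (m + 1)), dist_comm (α (T m))] at h1
    have h2 := dist_pow_smul_le hiso g o m (m + 1)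
    have h3 : |(m : ℝ) - (m + 1 : ℕ)| = 1 := by
      push_cast; rw [sub_add_cancel_left, abs_neg, abs_one]
    rw [h3, one_mul] at h2
    have h4 := neg_abs_le (T m - T (m + 1))
    linarith [hT m, hT (m + 1)]
  have hTunb : ∀ a, ∃ m, a ≤ T m := by
    intro a
    obtain ⟨m, hm⟩ := exists_nat_gt (dist u (p o) + A * (a + r) + A + q)
    refine ⟨m, ?_⟩
    by_contra hlt
    push Not at hlt
    have h2 := dist_triangle4 u (p o) (g ^ m • p o) (g ^ m • w l)
    rw [hisoV, hgm, hw.1.dist_base] at h2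
    have h3 := horb o o (g ^ m)
    have h4 := mul_le_mul_of_nonneg_left (hTnorm m) hA
    have h5 : A * (T m + r) ≤ A * (a + r) := mul_le_mul_of_nonneg_left (by linarith) hA
    have h6 : (m : ℝ) ≤ ((l + m * τ : ℕ) : ℝ) := by
      have : m ≤ l + m * τ := by nlinarith
      exact_mod_cast this
    linarith
  have hTex : ∀ a, 0 ≤ a → ∃ m, a ≤ T m ∧ T m ≤ a + 3 * r := by
    intro a ha
    classical
    refine ⟨Nat.find (hTunb a), Nat.find_spec (hTunb a), ?_⟩
    rcases hn : Nat.find (hTunb a) with _ | n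
    · linarith
    · have h1 := Nat.find_min (hTunb a) (m := n) (by omega)
      push Not at h1
      linarith [hTstep n]
  have hconjmem : ∀ m x, x ∈ D → (g ^ m)⁻¹ * x * g ^ m ∈ D := by
    intro m x hx
    have hgm' := H₀.pow_mem hg m
    refine ⟨H₀.mul_mem (H₀.mul_mem (H₀.inv_mem hgm') hx.1) hgm', ?_⟩
    have h1 : x • w (l + m * τ) = w (l + m * τ) :=
      h.endStabilizer_shift hα.isMorse hw hx.1 hx.2 (m * τ)
    rw [mul_smul, mul_smul, hgm, h1, ← hgm, inv_smul_smul]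
  set c₀ := 5 * r + r * (2 * q + 2 * A + A * (5 * r)) with hc₀
  -- Conjugation by a power of `g` moves the place where the displacement of `x` is measured far
  -- along `α`. There `x • α` is sublinearly close to `α`, so the displacement becomes sublinear in
  -- `R`.
  have hest : ∀ R, 0 ≤ R → ∃ m : ℕ, ∀ x ∈ D, dist o (x • o) ≤ R →
      dist o (((g ^ m)⁻¹ * x * g ^ m) • o) ≤
        (1 + r * A) * (U * gaugeOf κ (C₀ * (R + 1) + 3 * r)) + c₀ := by
    intro R hR
    obtain ⟨m, hm1, hm2⟩ := hTex (C₀ * (R + 1)) (by positivity)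
    refine ⟨m, fun x hx hxR => ?_⟩
    obtain ⟨n, hn, hnear⟩ := h.near_of_hasEnd (h.isMorse_smul hα.isMorse x) hα.isMorse hx.1 hw
    obtain ⟨y, hy, hd⟩ := H α (fun t => x • α t) hα (hα.1.smul hiso x)
      ⟨n, hn, fun X => by
        have h0 := le_max_right X 0
        obtain ⟨y, hy, hd⟩ := hnear (max X 0) h0
        exact ⟨max X 0, le_max_left _ _, y, hy, hd⟩⟩ R (by rw [hα.2.1, dist_comm]; exact hxR) (T m) hm1
    obtain ⟨m', hm'1, hm'2⟩ := hTex y hy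
    set E := U * gaugeOf κ (C₀ * (R + 1) + 3 * r) with hE
    have hdE : dist (α (T m)) (x • α y) ≤ E := hd.trans (mul_le_mul_of_nonneg_left (hk.mono hm2) hU)
    have e1 : dist (g ^ m' • o) (α y) ≤ 4 * r := by
      have h1 := dist_triangle (g ^ m' • o) (α (T m')) (α y)
      rw [hα.1 _ (hT0 m') _ hy, abs_of_nonneg (by linarith)] at h1
      linarith [hT m']
    have e2 : dist (g ^ m • o) (x • g ^ m' • o) ≤ E + 5 * r := by
      have h1 := dist_triangle4 (g ^ m • o) (α (T m)) (x • α y) (x • g ^ m' • o)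
      rw [hiso, dist_comm (α y)] at h1
      linarith [hT m]
    -- Since `x` fixes the tree ray beyond `w l`, it fixes `g ^ m' • w l`, at level `l + m' * τ`.
    -- Projecting to the tree bounds the difference of the levels by the distance in `Y`.
    have e3 : |(m : ℝ) - m'| ≤ 2 * q + 2 * A + A * (E + 5 * r) := by
      have h1 : x • g ^ m' • w l = w (l + m' * τ) := by
        rw [hgm]
        exact h.endStabilizer_shift hα.isMorse hw hx.1 hx.2 (m' * τ)
      have h2 : dist (g ^ m • w l) (x • g ^ m' • w l) = |(m : ℝ) - m'| * τ := by
        rw [h1, hgm, hw.1.2]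
        push_cast
        rw [show (l : ℝ) + m * τ - (l + m' * τ) = (m - m') * τ by ring, abs_mul, Nat.abs_cast]
      have h3 := dist_triangle4 (g ^ m • w l) (g ^ m • p o) (x • g ^ m' • p o) (x • g ^ m' • w l)
      rw [hisoV x, hisoV (g ^ m'), hisoV (g ^ m), dist_comm (w l)] at h3
      have h4 := dist_triangle_left (g ^ m • p o) (x • g ^ m' • p o) (p (g ^ m • o))
      have h5 := hpo (g ^ m)
      have h6 := horb (g ^ m • o) o (x * g ^ m')
      rw [mul_smul, mul_smul] at h6
      have h7 := mul_le_mul_of_nonneg_left e2 hA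
      have h8 : |(m : ℝ) - m'| * 1 ≤ |(m : ℝ) - m'| * τ :=
        mul_le_mul_of_nonneg_left (by exact_mod_cast hτ) (abs_nonneg _)
      linarith
    have e4 : dist o (((g ^ m)⁻¹ * x * g ^ m) • o) = dist (g ^ m • o) (x • g ^ m • o) := by
      rw [← hiso (g ^ m) o, mul_assoc, mul_smul, smul_inv_smul, mul_smul]
    have e5 := dist_triangle (g ^ m • o) (x • g ^ m' • o) (x • g ^ m • o)
    rw [hiso x, dist_comm (g ^ m' • o)] at e5
    have e6 := dist_pow_smul_le hiso g o m m'
    have e7 := mul_le_mul_of_nonneg_right e3 hr0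
    rw [e4, hc₀]
    linarith
  obtain ⟨R₀, hR₀, hR₀'⟩ : ∃ R₀ : ℝ, 0 ≤ R₀ ∧ ∀ R, R₀ ≤ R →
      (1 + r * A) * (U * gaugeOf κ (C₀ * (R + 1) + 3 * r)) + c₀ ≤ R - 1 := by
    set B := (1 + r * A) * U with hB
    have hB0 : 0 ≤ B := by positivity
    obtain ⟨C, hC, hkC⟩ := hk.sublin (1 / (2 * (B * C₀ + 1))) (by positivity)
    set ε := 1 / (2 * (B * C₀ + 1)) with hε
    have hε0 : 0 < ε := by positivity
    have h1 : B * ε * C₀ ≤ 1 / 2 := by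
      rw [hε, show B * (1 / (2 * (B * C₀ + 1))) * C₀ = (B * C₀) / (2 * (B * C₀ + 1)) by ring,
        div_le_div_iff₀ (by positivity) (by norm_num)]
      linarith
    have hpos : 0 ≤ c₀ := by positivity
    refine ⟨2 * (B * (ε * (C₀ + 3 * r) + C) + c₀ + 1), by positivity, fun R hR => ?_⟩
    have hR' : 0 ≤ R := le_trans (by positivity) hR
    have h2 := mul_le_mul_of_nonneg_left (hkC (C₀ * (R + 1) + 3 * r) (by positivity)) hB0
    have h3 : B * ε * C₀ * R ≤ 1 / 2 * R := mul_le_mul_of_nonneg_right h1 hR'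
    have h4 : (1 + r * A) * (U * gaugeOf κ (C₀ * (R + 1) + 3 * r)) =
      B * gaugeOf κ (C₀ * (R + 1) + 3 * r) := by rw [hB]; ring
    rw [h4]
    linarith
  have hfin : ∀ R, {x | x ∈ D ∧ dist o (x • o) ≤ R}.Finite := fun R =>
    (h.geometric.proper o R).subset fun x hx => hx.2
  -- For large `R` conjugation maps the finite set of elements of size at most `R` injectively into
  -- its subset of size at most `R - 1`, so the two sets coincide. Descending, every element has
  -- size at most `R₀`.
  have hstep : ∀ R, R₀ ≤ R → {x | x ∈ D ∧ dist o (x • o) ≤ R} ⊆ {x | x ∈ D ∧ dist o (x • o) ≤ R - 1} := by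
    intro R hR
    obtain ⟨m, hm⟩ := hest R (hR₀.trans hR)
    have hsub : {x | x ∈ D ∧ dist o (x • o) ≤ R - 1} ⊆ {x | x ∈ D ∧ dist o (x • o) ≤ R} :=
      fun x hx => ⟨hx.1, hx.2.trans (by linarith)⟩
    refine (Set.eq_of_subset_of_ncard_le hsub ?_ (hfin R)).symm.subset
    refine Set.ncard_le_ncard_of_injOn (fun x => (g ^ m)⁻¹ * x * g ^ m) (fun x hx =>
      ⟨hconjmem m x hx.1, (hm x hx.1 hx.2).trans (hR₀' R hR)⟩) (fun x _ y _ hxy => ?_) (hfin _)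
    simpa using hxy
  refine (hfin R₀).subset fun x hx => ⟨hx, ?_⟩
  have hall : ∀ n : ℕ, ∀ x ∈ D, dist o (x • o) ≤ R₀ + n → dist o (x • o) ≤ R₀ := by
    intro n
    induction n with
    | zero => intro x _ hx; simpa using hx
    | succ n ih =>
      intro x hx hd
      refine ih x hx ?_
      have := (hstep (R₀ + (n + 1 : ℕ)) (by
        have : (0 : ℝ) ≤ (n + 1 : ℕ) := Nat.cast_nonneg _
        linarith) ⟨hx, hd⟩).2
      push_cast at this
      linarith
  obtain ⟨n, hn⟩ := exists_nat_ge (dist o (x • o))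
  exact hall n x hx (by linarith)

end MorseSetting

end Axes

section Escape

variable {G Y V : Type*} [Group G] [MetricSpace Y] [MulAction G Y] [MetricSpace V] [MulAction G V]

/-! ### Uniformly Morse geodesics leave bounded sets of the tree uniformly -/

theorem _root_.Ultrafilter.exists_eventually_eq {ι β : Type*} (F : Ultrafilter ι) (f : ι → β) {s : Set β}
    (hs : s.Finite) (hf : ∀ᶠ i in F, f i ∈ s) : ∃ b ∈ s, ∀ᶠ i in F, f i = b := by
  obtain ⟨b, hb, he⟩ := Ultrafilter.eq_pure_of_finite_mem (f := F.map f) hs hf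
  refine ⟨b, hb, ?_⟩
  have h1 : ∀ᶠ x in ((F.map f : Ultrafilter β) : Filter β), x = b := by
    rw [he, Ultrafilter.coe_pure, eventually_pure]
  exact h1

namespace MorseSetting

variable {κ : ℝ → ℝ} {o : Y} {p : Y → V} (h : MorseSetting G κ o p)
include h

/-- A geodesic ray whose projection passes over the vertex `v` comes close to an orbit point `g • o`
for which `g⁻¹ • v` belongs to a fixed finite set. -/
theorem exists_crossing_orbit : ∃ (D C : ℝ) (W : Set V), 0 ≤ D ∧ 0 ≤ C ∧ W.Finite ∧ ∀ σ : ℝ → Y,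
    GRay σ → ∀ v v', Betw (p o) v v' → C < dist v v' → ∀ s t, 0 ≤ s → 0 ≤ t →
    dist (p o) (p (σ s)) + C < dist (p o) v → Betw (p o) v' (p (σ t)) →
    ∃ x, min s t ≤ x ∧ ∃ g : G, dist (σ x) (g • o) ≤ D ∧ g⁻¹ • v ∈ W := by
  obtain ⟨D, hD, hcov⟩ := h.exists_covering
  obtain ⟨A, hA, horb⟩ := h.exists_dist_orbit_le
  choose c hc using hcov
  set u := p o with hu
  have hcu : ∀ y, dist (p y) (c y • u) ≤ A * D + A := fun y =>
    (horb y o (c y)).trans (by linarith [mul_le_mul_of_nonneg_left (hc y) hA])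
  refine ⟨D, A * D + A, ⋃ g ∈ {g : G | dist o (g • o) ≤ 2 * D + 1}, {v | Betw u v (g • u)}, hD,
    by positivity, (h.geometric.proper o _).biUnion fun g _ => h.tree.finite_interval _ _, ?_⟩
  intro σ hσ v v' hv hvC s t hs ht hsv htv
  have hPs : ¬ Betw u v (c (σ s) • u) := by
    intro hb
    have h1 : dist u v + dist v (c (σ s) • u) = dist u (c (σ s) • u) := hb
    have h2 := dist_triangle u (p (σ s)) (c (σ s) • u)
    linarith [hcu (σ s), dist_nonneg (x := v) (y := c (σ s) • u)]
  have hPt : Betw u v (c (σ t) • u) := by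
    refine h.tree.betw_of_dist_lt hv htv (lt_of_le_of_lt (hcu _) (lt_of_lt_of_le hvC ?_))
    have h1 : dist v v' + dist v' (p (σ t)) = dist v (p (σ t)) := hv.trans_right htv
    linarith [dist_nonneg (x := v') (y := p (σ t))]
  -- Between times `x` and `y` the coarse projection crosses `v`, so `v` lies on the geodesic
  -- joining two orbit points of `u`. Moved back by the first element, this geodesic joins `u` to `g
  -- • u` with `g` from a finite set.
  have hfinal : ∀ x y, 0 ≤ x → 0 ≤ y → |x - y| ≤ 1 → Betw u v (c (σ x) • u) →
      ¬ Betw u v (c (σ y) • u) → (c (σ x))⁻¹ • v ∈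
        ⋃ g ∈ {g : G | dist o (g • o) ≤ 2 * D + 1}, {v | Betw u v (g • u)} := by
    intro x y hx hy hxy h1 h2
    refine mem_biUnion (x := (c (σ x))⁻¹ * c (σ y)) ?_ ?_
    · change dist o (((c (σ x))⁻¹ * c (σ y)) • o) ≤ 2 * D + 1
      rw [← h.geometric.isometric (c (σ x)), mul_smul, smul_inv_smul]
      have h3 := dist_triangle4 (c (σ x) • o) (σ x) (σ y) (c (σ y) • o)
      rw [hσ x hx y hy, dist_comm (c (σ x) • o) (σ x)] at h3
      have := hc (σ x)
      have := hc (σ y)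
      linarith
    · have h3 := h.tree.branch h1 h2
      rw [mem_ofPred_eq, ← h.betw_smul (c (σ x)), mul_smul, smul_inv_smul, smul_inv_smul]
      exact h3
  rcases le_total s t with hst | hst
  · obtain ⟨x, hx, y, hy, h1, h2, h3, h4⟩ := exists_crossing'
      (P := fun x => Betw u v (c (σ x) • u)) hst hPs hPt
    refine ⟨y, ?_, c (σ y), hc _, hfinal y x (hs.trans hy.1) (hs.trans hx.1) ?_ h4 h3⟩
    · rw [min_eq_left hst]; exact hy.1
    · rw [abs_of_nonneg (by linarith)]; linarith
  · obtain ⟨x, hx, y, hy, h1, h2, h3, h4⟩ := exists_crossing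
      (P := fun x => Betw u v (c (σ x) • u)) hst hPt hPs
    refine ⟨x, ?_, c (σ x), hc _, hfinal x y (ht.trans hx.1) (ht.trans hy.1) ?_ h3 h4⟩
    · rw [min_eq_right hst]; exact hx.1
    · rw [abs_sub_comm, abs_of_nonneg (by linarith)]; linarith

/-- Sequences of Morse geodesics that return to a bounded set of the tree at arbitrarily late times
yield Morse segments along elements that fix a vertex. -/
theorem exists_returns {M M₁ : ℝ → ℝ} {a : ℕ → ℝ → Y} (ha : ∀ n, MorseGeod (gaugeOf κ) o M (a n))
    {t : ℕ → ℝ} (ht : ∀ n : ℕ, (n : ℝ) ≤ t n) {R : ℝ} (hR : ∀ n, dist (p o) (p (a n (t n))) ≤ R)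
    {α : ℝ → Y} (hα : MorseGeod (gaugeOf κ) o M₁ α) {w : ℕ → V} (hw : HasEnd p (p o) w α)
    (hlim : ∀ S, ∀ᶠ n in hyperfilter ℕ, ∀ s ∈ Icc 0 S, dist (a n s) (α s) ≤ 3) :
    ∃ (k₀ : ℕ) (D : ℝ) (W : Set V), 0 ≤ D ∧ W.Finite ∧
      (∀ k, k₀ ≤ k → ∃ (g : G) (s : ℝ), 0 ≤ s ∧ dist (α s) (g • o) ≤ D ∧ g⁻¹ • w k ∈ W) ∧
      ∀ k, k₀ ≤ k → ∃ E, 0 ≤ E ∧ ∀ L, ∃ (n : ℕ) (s : ℝ) (x : G), L ≤ s ∧ 0 ≤ s ∧ x • w k = w k ∧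
        dist (a n s) (x • o) ≤ E ∧ ∀ s ∈ Icc 0 L, dist (a n s) (α s) ≤ 3 := by
  obtain ⟨D, C, W, hD, hC, hW, hcross⟩ := h.exists_crossing_orbit
  obtain ⟨A, hA, hlip⟩ := h.exists_lipschitz
  obtain ⟨k₀, hk₀⟩ := exists_nat_gt (max R 0 + C)
  have hR0 := le_max_left R 0
  have hR1 := le_max_right R 0
  obtain ⟨m, hm⟩ := exists_nat_gt (max C (A * 3 + A))
  have hmC := (le_max_left _ _).trans_lt hm
  have hmA := (le_max_right _ _).trans_lt hm
  have hwd : ∀ k m : ℕ, dist (w k) (w (k + m)) = m := by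
    intro k m
    rw [hw.1.2]
    push_cast
    rw [sub_add_cancel_left, abs_neg, abs_of_nonneg (Nat.cast_nonneg m)]
  refine ⟨k₀, D, W, hD, hW, fun k hk => ?_, fun k hk => ?_⟩
  · have hk' : (k₀ : ℝ) ≤ k := by exact_mod_cast hk
    obtain ⟨s, hs0, hs⟩ := ((eventually_ge_atTop (0 : ℝ)).and (hw.2 (k + m))).exists
    obtain ⟨x, hx, g, hg⟩ := hcross α hα.1 (w k) (w (k + m)) (hw.1.betw (Nat.le_add_right k m))
      (by rw [hwd]; exact hmC) 0 s le_rfl hs0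
      (by rw [hα.2.1, dist_self, hw.1.dist_base]; linarith) hs
    rw [min_eq_left hs0] at hx
    exact ⟨g, x, hx, hg⟩
  · have hk' : (k₀ : ℝ) ≤ k := by exact_mod_cast hk
    -- One element `b v` is fixed for each position `v` of `g⁻¹ • w k`. Then `g * (b v)⁻¹` fixes `w
    -- k`, and it differs from `g` boundedly because `W` is finite.
    have hpick : ∀ v : V, ∃ b : G, ∀ g : G, g⁻¹ • w k = v → b⁻¹ • w k = v := by
      intro v
      by_cases hv : ∃ g : G, g⁻¹ • w k = v
      · obtain ⟨g, hg⟩ := hv; exact ⟨g, fun _ _ => hg⟩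
      · exact ⟨1, fun g hg => absurd ⟨g, hg⟩ hv⟩
    choose b hb using hpick
    obtain ⟨B, hB⟩ := (hW.image fun v => dist (b v • o) o).bddAbove
    refine ⟨D + max B 0, by positivity, fun L => ?_⟩
    -- One margin `m` separates the two vertices in the crossing lemma; the other absorbs the
    -- replacement of `α s` by `a n s`.
    obtain ⟨s, hs0, hs⟩ := ((eventually_ge_atTop (max L 0)).and (hw.2 (k + m + m))).exists
    have hsL := (le_max_left _ _).trans hs0
    have hs0' := (le_max_right _ _).trans hs0
    obtain ⟨n, hn, hns⟩ := ((hlim s).and (Nat.hyperfilter_le_atTop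
      (eventually_ge_atTop ⌈s⌉₊))).exists
    have hst : s ≤ t n := (Nat.le_ceil s).trans (le_trans (by exact_mod_cast hns) (ht n))
    obtain ⟨x, hx, g, hg, hgW⟩ := hcross (a n) (ha n).1 (w k) (w (k + m))
      (hw.1.betw (Nat.le_add_right k m)) (by rw [hwd]; exact hmC) (t n) s (hs0'.trans hst) hs0'
      (by rw [hw.1.dist_base]; linarith [hR n]) (by
        refine h.tree.betw_of_dist_lt (hw.1.betw (Nat.le_add_right (k + m) m)) hs ?_
        have h1 := hlip (α s) (a n s)
        have h2 := hn s ⟨hs0', le_rfl⟩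
        rw [dist_comm] at h2
        have h3 := mul_le_mul_of_nonneg_left h2 hA
        have h4 : dist (w (k + m)) (w (k + m + m)) + dist (w (k + m + m)) (p (α s)) =
          dist (w (k + m)) (p (α s)) := (hw.1.betw (Nat.le_add_right (k + m) m)).trans_right hs
        rw [hwd] at h4
        linarith [dist_nonneg (x := w (k + m + m)) (y := p (α s))])
    rw [min_eq_right hst] at hx
    refine ⟨n, x, g * (b (g⁻¹ • w k))⁻¹, hsL.trans hx, hs0'.trans hx, ?_, ?_, fun s' hs' =>
      hn s' ⟨hs'.1, hs'.2.trans hsL⟩⟩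
    · rw [mul_smul, hb _ g rfl, smul_inv_smul]
    · have h1 := dist_triangle (a n x) (g • o) ((g * (b (g⁻¹ • w k))⁻¹) • o)
      rw [mul_smul, h.geometric.isometric g, ← h.geometric.isometric (b (g⁻¹ • w k)) o, smul_inv_smul] at h1
      have h2 := hB ⟨_, hgW, rfl⟩
      have h3 := le_max_left B 0
      rw [mul_smul]
      dsimp only at h2
      linarith

/-- Uniformly Morse geodesics leave the bounded sets of the tree uniformly. -/
theorem exists_escape (M : ℝ → ℝ) (R : ℝ) : ∃ T, ∀ a, MorseGeod (gaugeOf κ) o M a → ∀ t, T ≤ t →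
    R < dist (p o) (p (a t)) := by
  have hk := h.isGauge
  have hiso := h.geometric.isometric
  by_contra hcon
  push Not at hcon
  -- The failing geodesics have arbitrarily late points over a bounded set, although their limit `α`
  -- has an end in the tree.
  choose a ha t ht hR using fun n : ℕ => hcon n
  obtain ⟨M₁, hM₁, hlimit⟩ := h.exists_limit M
  obtain ⟨α, hα, hlim⟩ := hlimit (hyperfilter ℕ) a ha
  obtain ⟨w, hw⟩ := h.exists_hasEnd hα.isMorse (p o)
  obtain ⟨k₀, D, W, hD, hW, horb, hret⟩ := h.exists_returns ha ht hR hα hw hlim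
  set u := p o with hu
  have hends : ∀ g : G, ∃ r, HasEnd p u r (fun t => g • α t) :=
    fun g => h.exists_hasEnd (h.isMorse_smul hα.isMorse g) u
  choose e he using hends
  -- at most two ends occur among the translates of `α` that meet at a given vertex
  have htwo : ∀ (K : ℕ) (S : Set G), (∀ f ∈ S, ∃ l, k₀ ≤ l ∧ f • w l = w K) → (e '' S).Finite := by
    intro K S hS
    by_contra hinf
    obtain ⟨t, htS, htc⟩ := Set.Infinite.exists_subset_card_eq hinf 3
    have hmem : ∀ j : Fin 3, ∃ f ∈ S, e f = ((t.equivFinOfCardEq htc).symm j : ℕ → V) :=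
      fun j => htS ((t.equivFinOfCardEq htc).symm j).2
    choose f hfS hfe using hmem
    choose l hl hfl using fun j => hS (f j) (hfS j)
    choose R' hR' using fun j => h.exists_hasEnd (h.isMorse_smul hα.isMorse (f j)) (w K)
    choose E hE0 hE using fun j => hret (l j) (hl j)
    obtain ⟨D', hD'⟩ := (Set.finite_range fun j => dist o (f j • o) + E j).bddAbove
    have hD'j : ∀ j, dist o (f j • o) + E j ≤ D' := fun j => hD' ⟨j, rfl⟩
    have hD'0 : 0 ≤ D' := le_trans (add_nonneg dist_nonneg (hE0 0)) (hD'j 0)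
    have hfo : ∀ j, dist o (f j • o) ≤ D' := fun j => by linarith [hD'j j, hE0 j]
    have hbase : ∀ j (Z : Set Y), WG (gaugeOf κ) (f j • o) Z M₁ →
        WG (gaugeOf κ) o Z (fun K => |M₁ K| * (1 + gaugeOf κ D')) := fun j Z hZ =>
      WG.change_base hk hZ (by rw [dist_comm]; exact hfo j)
    refine h.not_three_families (φ := fun j t => f j • α t) (D := D')
      (M := fun K => |M₁ K| * (1 + gaugeOf κ D')) (w := w K) (R := R') hD'0
      (fun j => hα.1.smul hiso (f j)) (fun j => by rw [hα.2.1]; exact hfo j)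
      (fun j => hbase j _ (hα.wg.smul hiso (f j))) hR' ?_ ?_
    · intro i j hij
      have h1 := hR' i
      rw [hij] at h1
      have h2 := h.hasEnd_transfer (h.isMorse_smul hα.isMorse (f i)) (h.isMorse_smul hα.isMorse (f j)) h1
        (hR' j) (he (f i))
      have h3 := hasEnd_unique h.tree h2 (he (f j))
      rw [hfe, hfe] at h3
      exact (t.equivFinOfCardEq htc).symm.injective (Subtype.ext h3)
    · intro j L
      obtain ⟨n, s, x, hLs, hs0, hx, hd, hclose⟩ := hE j L
      refine ⟨fun t => f j • a n t, s, f j * x * (f j)⁻¹, hLs, ?_, ?_, ?_, ?_, ?_, ?_⟩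
      · exact ((ha n).1.smul hiso (f j)).geodOn s
      · change dist o (f j • a n 0) ≤ D'
        rw [(ha n).2.1]; exact hfo j
      · rw [mul_smul, mul_smul, hiso]
        have h1 := dist_triangle_right (x • (f j)⁻¹ • o) (a n s) (x • o)
        rw [hiso] at h1
        have h2 : dist ((f j)⁻¹ • o) o = dist o (f j • o) := by rw [← hiso (f j), smul_inv_smul]
        linarith [hD'j j]
      · exact hbase j _ (((MorseGeod.mono hk (ha n) hM₁).2.2 s hs0).smul hiso (f j))
      · rw [mul_smul, mul_smul, ← hfl j, inv_smul_smul, hx]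
      · intro s' hs'
        rw [hiso]
        exact hclose s' hs'
  -- Along `α` there are orbit points `g i • o` for which `(g i)⁻¹ • w (k₀ + i)` lies in a finite
  -- set. By pigeonhole this position and the end of a suitable translate of `α` agree for most `i`,
  -- and the quotients fix the end of `α` while shifting its tree ray.
  choose g s hs0 hs hgW using fun i : ℕ => horb (k₀ + i) (Nat.le_add_right k₀ i)
  obtain ⟨v, -, hv⟩ := (hyperfilter ℕ).exists_eventually_eq (fun i => (g i)⁻¹ • w (k₀ + i)) hW
    (Eventually.of_forall hgW)
  obtain ⟨i₀, hi₀⟩ := hv.exists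
  have hmap : ∀ i j, (g i)⁻¹ • w (k₀ + i) = v → (g j)⁻¹ • w (k₀ + j) = v →
      (g i * (g j)⁻¹) • w (k₀ + j) = w (k₀ + i) := by
    intro i j hi hj
    rw [mul_smul, hj, ← hi, smul_inv_smul]
  obtain ⟨r, -, hr⟩ := (hyperfilter ℕ).exists_eventually_eq (fun i => e (g i₀ * (g i)⁻¹))
    (htwo (k₀ + i₀) ((fun i => g i₀ * (g i)⁻¹) '' {i | (g i)⁻¹ • w (k₀ + i) = v}) (by
      rintro _ ⟨i, hi, rfl⟩
      exact ⟨k₀ + i, Nat.le_add_right _ _, hmap i₀ i hi₀ hi⟩))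
    (hv.mono fun i hi => ⟨_, ⟨i, hi, rfl⟩, rfl⟩)
  obtain ⟨i₁, hi₁, hi₁'⟩ := (hv.and hr).exists
  set l := k₀ + i₁ with hl
  have hstab : ∀ i, e (g i₀ * (g i)⁻¹) = r → g i * (g i₁)⁻¹ ∈ h.endStabilizer hα.isMorse hw := by
    intro i hi
    have h1 := h.inv_mul_mem_endStabilizer hα.isMorse hw (a := g i₀ * (g i)⁻¹) (b := g i₀ * (g i₁)⁻¹)
      (r := r) (by rw [← hi]; exact he _) (by rw [← hi₁']; exact he _)
    convert h1 using 1
    group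
  -- Otherwise the whole stabiliser of `w l` would be finite, because its elements send `α` to
  -- finitely many ends. But the returns give elements fixing `w l` that move `o` arbitrarily far.
  have hinf : ¬ {x | x ∈ h.endStabilizer hα.isMorse hw ∧ x • w l = w l}.Finite := by
    intro hfin
    have hS : {x : G | x • w l = w l}.Finite := by
      refine Set.Finite.of_finite_fibers e (htwo l _ fun x hx => ⟨l, Nat.le_add_right _ _, hx⟩) ?_
      rintro _ ⟨x₀, hx₀, rfl⟩
      refine (hfin.image fun x => x₀ * x).subset ?_
      rintro x ⟨hx, hxe⟩
      have hx₀' : x₀ • w l = w l := hx₀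
      have hx' : x • w l = w l := hx
      refine ⟨x₀⁻¹ * x, ⟨h.inv_mul_mem_endStabilizer hα.isMorse hw (he x₀) ?_, ?_⟩,
        mul_inv_cancel_left _ _⟩
      · have := he x
        rwa [show e x = e x₀ from hxe] at this
      · rw [mul_smul, hx', inv_smul_eq_iff, hx₀']
    obtain ⟨B, hB⟩ := (hS.image fun x => dist o (x • o)).bddAbove
    obtain ⟨E, hE0, hE⟩ := hret l (Nat.le_add_right _ _)
    obtain ⟨n, s', x, hLs, hs0', hx, hd, -⟩ := hE (B + E + 1)
    have h1 : dist o (x • o) ≤ B := hB ⟨x, hx, rfl⟩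
    have h2 := dist_triangle_right o (a n s') (x • o)
    rw [(ha n).norm hs0'] at h2
    linarith
  obtain ⟨ε, L₀, hε, haxis⟩ := h.exists_axis M₁
  set b := dist ((g i₁)⁻¹ • o) o with hb
  -- If `s i` stays bounded, then `g i` ranges over a finite set, and so does `w (k₀ + i)`, which is
  -- injective in `i`.
  have hfar : ∀ T, ∀ᶠ i : ℕ in (hyperfilter ℕ : Filter ℕ), T ≤ s i := by
    intro T
    refine hyperfilter_le_cofinite ?_
    have hfin : (⋃ x ∈ {x : G | dist o (x • o) ≤ T + D}, (fun v => x • v) '' W).Finite :=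
      (h.geometric.proper o _).biUnion fun x _ => hW.image _
    have hinj : Function.Injective fun i => w (k₀ + i) := fun i j hij => by
      have := hw.1.injective hij; omega
    refine (hfin.preimage hinj.injOn).subset fun i hi => ?_
    have hi' : s i < T := not_le.1 hi
    refine mem_biUnion (x := g i) ?_ ⟨_, hgW i, smul_inv_smul _ _⟩
    change dist o (g i • o) ≤ T + D
    have h1 := dist_triangle o (α (s i)) (g i • o)
    rw [hα.norm (hs0 i)] at h1
    linarith [hs i]
  obtain ⟨i, ⟨hi1, hi2⟩, hi3, hi4⟩ := ((hv.and hr).and ((hfar (b + D + max L₀ ((b + D) / ε))).and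
    (Nat.hyperfilter_le_atTop (eventually_gt_atTop i₁)))).exists
  have hgl := hmap i i₁ hi1 hi₁
  obtain ⟨τ, rfl⟩ := Nat.exists_eq_add_of_lt hi4
  have hmove : dist ((g (i₁ + τ + 1) * (g i₁)⁻¹) • o) (α (s (i₁ + τ + 1))) ≤ b + D := by
    have h1 := dist_triangle_right ((g (i₁ + τ + 1) * (g i₁)⁻¹) • o) (α (s (i₁ + τ + 1)))
      (g (i₁ + τ + 1) • o)
    rw [mul_smul, hiso] at h1
    rw [mul_smul]
    linarith [hs (i₁ + τ + 1)]
  have hlong : s (i₁ + τ + 1) ≤ dist o ((g (i₁ + τ + 1) * (g i₁)⁻¹) • o) + (b + D) := by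
    have h1 := dist_triangle o ((g (i₁ + τ + 1) * (g i₁)⁻¹) • o) (α (s (i₁ + τ + 1)))
    rw [hα.norm (hs0 _)] at h1
    linarith
  have hm1 := le_max_left L₀ ((b + D) / ε)
  have hm2 := le_max_right L₀ ((b + D) / ε)
  refine hinf (h.finite_of_axis hα hw (hstab _ hi2) (τ := τ + 1) (by omega)
    (by rw [show l + (τ + 1) = k₀ + (i₁ + τ + 1) by omega]; exact hgl)
    (haxis α hα u w hw _ (hstab _ hi2) (s (i₁ + τ + 1)) (hs0 _) (by linarith) (hmove.trans ?_)))
  rw [mul_comm, ← div_le_iff₀ hε]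
  linarith

/-- Ends of uniformly Morse geodesics depend continuously on the geodesics. -/
theorem eventually_end_eq {ι : Type*} {F : Ultrafilter ι} {M : ℝ → ℝ} {a : ι → ℝ → Y}
    (ha : ∀ n, MorseGeod (gaugeOf κ) o M (a n)) {α : ℝ → Y}
    (hlim : ∀ S, ∀ᶠ n in F, ∀ s ∈ Icc 0 S, dist (a n s) (α s) ≤ 3) {w : ℕ → V}
    (hw : HasEnd p (p o) w α) {r : ι → ℕ → V} (hr : ∀ n, HasEnd p (p o) (r n) (a n)) (k : ℕ) :
    ∀ᶠ n in F, r n k = w k := by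
  obtain ⟨A, hA, hlip⟩ := h.exists_lipschitz
  obtain ⟨T, hT⟩ := h.exists_escape M (k + (A + A))
  obtain ⟨m, hm⟩ := exists_nat_gt (A * 3 + A)
  obtain ⟨s, hs0, hs⟩ := ((eventually_ge_atTop (max T 0)).and (hw.2 (k + m))).exists
  have hsT := (le_max_left _ _).trans hs0
  have hs0' := (le_max_right _ _).trans hs0
  filter_upwards [hlim s] with n hn
  have h0 : Betw (p o) (w k) (p (a n s)) := by
    refine h.tree.betw_of_dist_lt (hw.1.betw (Nat.le_add_right k m)) hs ?_
    have h1 := hlip (α s) (a n s)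
    have h2 := hn s ⟨hs0', le_rfl⟩
    rw [dist_comm] at h2
    have h3 := mul_le_mul_of_nonneg_left h2 hA
    have h4 : dist (w k) (w (k + m)) + dist (w (k + m)) (p (α s)) =
      dist (w k) (p (α s)) := (hw.1.betw (Nat.le_add_right k m)).trans_right hs
    have h5 : dist (w k) (w (k + m)) = m := by
      rw [hw.1.2]
      push_cast
      rw [sub_add_cancel_left, abs_neg, abs_of_nonneg (Nat.cast_nonneg m)]
    linarith [dist_nonneg (x := w (k + m)) (y := p (α s))]
  -- At time `s` the projection of `a n` is behind `w k`, and by the choice of `T` it cannot leave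
  -- this branch later: a crossing would bring it back to the neighbourhood of `w k`.
  obtain ⟨t, hst, ht⟩ := ((eventually_ge_atTop s).and ((hr n).2 k)).exists
  have h1 : Betw (p o) (w k) (p (a n t)) := by
    by_contra hcon
    obtain ⟨x, hx, y, hy, hxy, hyx, hPx, hPy⟩ := exists_crossing
      (P := fun x => Betw (p o) (w k) (p (a n x))) hst h0 hcon
    have h2 : dist (p (a n x)) (w k) + dist (w k) (p (a n y)) = dist (p (a n x)) (p (a n y)) :=
      h.tree.branch hPx hPy
    have h3 := hlip (a n x) (a n y)
    rw [(ha n).1 x (hs0'.trans hx.1) y (hs0'.trans hy.1), abs_sub_comm,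
      abs_of_nonneg (by linarith)] at h3
    have h4 := mul_le_mul_of_nonneg_left (show y - x ≤ 1 by linarith) hA
    have h5 := hT (a n) (ha n) x (hsT.trans hx.1)
    have h6 := dist_triangle (p o) (w k) (p (a n x))
    rw [hw.1.dist_base, dist_comm (w k)] at h6
    linarith [dist_nonneg (x := w k) (y := p (a n y))]
  exact h.tree.ray_eq_of_betw (hr n).1 hw.1 ht h1

end MorseSetting

end Escape

section Ends

variable {G Y V : Type*} [Group G] [MetricSpace Y] [MulAction G Y] [MetricSpace V] [MulAction G V]

/-! ### The set of Morse ends -/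

theorem mem_closure_iff_prefix [DiscreteTopology V] {Z : Set (ℕ → V)} {r : ℕ → V} :
    r ∈ closure Z ↔ ∀ k, ∃ z ∈ Z, ∀ i < k, z i = r i := by
  rw [(PiNat.isTopologicalBasis_cylinders (fun _ => V)).mem_closure_iff]
  constructor
  · intro hr k
    obtain ⟨z, hz, hzZ⟩ := hr (PiNat.cylinder r k) ⟨r, k, rfl⟩ (PiNat.self_mem_cylinder r k)
    exact ⟨z, hzZ, hz⟩
  · rintro hr _ ⟨x, k, rfl⟩ hx
    obtain ⟨z, hz, hzk⟩ := hr k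
    exact ⟨z, fun i hi => (hzk i hi).trans (hx i hi), hz⟩

/-- The ends of the geodesic rays from `o` with a given gauge. -/
def endsOf (k : ℝ → ℝ) (o : Y) (p : Y → V) (M : ℝ → ℝ) : Set (ℕ → V) :=
  {r | ∃ a, MorseGeod k o M a ∧ HasEnd p (p o) r a}

namespace MorseSetting

variable {κ : ℝ → ℝ} {o : Y} {p : Y → V} (h : MorseSetting G κ o p)
include h

/-- The rays in the tree that point to the image of the boundary map. -/
def ends : Set (ℕ → V) := range fun ξ => h.tree.rayTo (p o) (boundaryMap h.inj ξ)

theorem isRayFrom_of_mem_ends {r : ℕ → V} (hr : r ∈ h.ends) : IsRayFrom (p o) r := by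
  obtain ⟨ξ, rfl⟩ := hr
  exact h.tree.rayTo_isRayFrom _ _

theorem endsOf_subset (M : ℝ → ℝ) : endsOf (gaugeOf κ) o p M ⊆ h.ends := by
  rintro r ⟨a, ha, hr⟩
  exact h.exists_boundaryMap_eq ha.isMorse hr

/-- A stratum bounds the Morse gauge but not the quasi-geodesic constants. Each stratum is therefore
divided further by an integer bound for these, and every pair has its own gauge of representatives.
-/
theorem exists_cover {N : ℕ → ℝ → ℝ → ℝ≥0} (hN : (⋃ i, stratum κ o (N i)) = univ) :
    ∃ M : ℕ → ℝ → ℝ, h.ends = ⋃ i, endsOf (gaugeOf κ) o p (M i) := by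
  choose M hM using fun q : ℕ × ℕ => h.exists_representative (p o) (N q.1) ((q.2 : ℝ) + 1)
    (by linarith [Nat.cast_nonneg (α := ℝ) q.2])
  refine ⟨fun i => M i.unpair, subset_antisymm ?_ (iUnion_subset fun i => h.endsOf_subset _)⟩
  rintro _ ⟨ξ, rfl⟩
  have hξ : ξ ∈ ⋃ i, stratum κ o (N i) := hN ▸ mem_univ ξ
  obtain ⟨i, γ, hγ0, hγN, rfl⟩ := mem_iUnion.1 hξ
  obtain ⟨⟨K, C, hK, hC, hqi⟩, -⟩ := γ.2
  obtain ⟨m, hm⟩ := exists_nat_ge (max K C)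
  have hKm := (le_max_left _ _).trans hm
  have hCm := (le_max_right _ _).trans hm
  obtain ⟨a, ha, hae⟩ := hM (i, m) γ (fun x y => by
    obtain ⟨h1, h2⟩ := hqi x y
    have h3 : 1 / ((m : ℝ) + 1) * dist x y ≤ 1 / K * dist x y :=
      mul_le_mul_of_nonneg_right (one_div_le_one_div_of_le (by linarith) (by linarith)) dist_nonneg
    have h4 : K * dist x y ≤ ((m : ℝ) + 1) * dist x y :=
      mul_le_mul_of_nonneg_right (by linarith) dist_nonneg
    constructor <;> dsimp only <;> linarith) hγ0 hγN
  refine mem_iUnion.2 ⟨Nat.pair i m, a, ?_, hae⟩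
  simpa only [Nat.unpair_pair] using ha

/-- Geodesics realising better and better approximations of `r` have a Morse limit, and by
continuity of ends `r` is the end of this limit. -/
theorem exists_closure_subset (M : ℝ → ℝ) :
    ∃ M₁, closure (endsOf (gaugeOf κ) o p M) ⊆ endsOf (gaugeOf κ) o p M₁ := by
  have := h.tree.discreteTopology
  obtain ⟨M₁, -, hlimit⟩ := h.exists_limit M
  refine ⟨M₁, fun r hr => ?_⟩
  choose z hz hzr using mem_closure_iff_prefix.1 hr
  choose a ha haz using hz
  obtain ⟨α, hα, hlim⟩ := hlimit (hyperfilter ℕ) a ha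
  obtain ⟨w, hw⟩ := h.exists_hasEnd hα.isMorse (p o)
  suffices r = w by rw [this]; exact ⟨α, hα, hw⟩
  funext k
  obtain ⟨n, hn, hkn⟩ := ((h.eventually_end_eq ha hlim hw haz k).and
    (Nat.hyperfilter_le_atTop (eventually_gt_atTop k))).exists
  rw [← hn, hzr n k hkn]

/-- Infinitely many values at level `k` would give geodesics with pairwise different values there,
whereas continuity of ends makes the values equal along an ultrafilter. -/
theorem finite_level_endsOf (M : ℝ → ℝ) (k : ℕ) : ((fun r => r k) '' endsOf (gaugeOf κ) o p M).Finite := by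
  by_contra hinf
  have hinf' : ((fun r => r k) '' endsOf (gaugeOf κ) o p M).Infinite := hinf
  have hmem : ∀ n, ∃ r ∈ endsOf (gaugeOf κ) o p M, r k = hinf'.natEmbedding _ n := fun n =>
    (hinf'.natEmbedding _ n).2
  choose r hr hrk using hmem
  choose a ha har using hr
  obtain ⟨M₁, -, hlimit⟩ := h.exists_limit M
  obtain ⟨α, hα, hlim⟩ := hlimit (hyperfilter ℕ) a ha
  obtain ⟨w, hw⟩ := h.exists_hasEnd hα.isMorse (p o)
  have h1 := h.eventually_end_eq ha hlim hw har k
  obtain ⟨n, hn⟩ := h1.exists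
  obtain ⟨n', hn', hlt⟩ := (h1.and (Nat.hyperfilter_le_atTop (eventually_gt_atTop n))).exists
  have h2 : r n k = r n' k := hn.trans hn'.symm
  rw [hrk, hrk] at h2
  exact hlt.ne ((hinf'.natEmbedding _).injective (Subtype.ext h2))

/-- There are uncountably many Morse ends if there are at least three. -/
theorem not_countable_ends {M : ℕ → ℝ → ℝ} (hM : h.ends = ⋃ i, endsOf (gaugeOf κ) o p (M i))
    {R : Fin 3 → ℕ → V} (hR : ∀ j, R j ∈ h.ends) (hinj : Function.Injective R) :
    ¬ h.ends.Countable := by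
  intro hcount
  have hk := h.isGauge
  have hrep : ∀ r ∈ h.ends, ∃ (M' : ℝ → ℝ) (a : ℝ → Y), MorseGeod (gaugeOf κ) o M' a ∧ HasEnd p (p o) r a := by
    intro r hr
    rw [hM] at hr
    obtain ⟨i, a, ha⟩ := mem_iUnion.1 hr
    exact ⟨_, a, ha⟩
  obtain ⟨q, hq⟩ := hcount.exists_eq_range ⟨_, hR 0⟩
  have hqm : ∀ i, q i ∈ h.ends := fun i => hq ▸ mem_range_self i
  -- Through `Nat.unpair` each end of the list returns at arbitrarily late stages, so that it can be
  -- avoided outside the uncontrolled initial part of the new ray.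
  choose M' ρ hρ hρq using fun i : ℕ => hrep (q i.unpair.1) (hqm _)
  choose M'' φ hφ hφR using fun j => hrep (R j) (hR j)
  obtain ⟨D, hD, hcov⟩ := h.exists_covering
  set M₀ : ℝ → ℝ := fun K => ∑ j, |M'' j K| with hM₀
  have hφ' : ∀ j, MorseGeod (gaugeOf κ) o M₀ (φ j) := fun j => (hφ j).mono hk fun K =>
    (le_abs_self _).trans (Finset.single_le_sum (f := fun j => |M'' j K|) (fun _ _ => abs_nonneg _)
      (Finset.mem_univ j))
  obtain ⟨K, hK, H⟩ := h.exists_concatenation hD (fun j => (hφ j).1)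
    (fun j => by rw [(hφ j).2.1, dist_self]; exact hD) (fun j => (hφ' j).wg) hφR hinj univ
    (fun j L => by
      obtain ⟨g, hg⟩ := hcov (φ j (max L 0))
      refine ⟨φ j, max L 0, g, le_max_left _ _, (hφ j).1.geodOn _, ?_, ?_, (hφ' j).2.2 _ (le_max_right _ _),
        mem_univ g, fun s _ => by rw [dist_self]; norm_num⟩
      · rw [(hφ j).2.1, dist_self]; exact hD
      · rwa [dist_comm])
  obtain ⟨B, hB, hb⟩ := hk.comp_dist 3 (by norm_num)
  have hφg : ∀ (b : G) j, IsMorse (gaugeOf κ) o (fun t => b • φ j t) := fun b j =>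
    h.isMorse_smul (hφ j).isMorse b
  -- A direction that does not point to the listed end leaves the neighbourhood of `ρ i` at some
  -- time `X`. The bound allows for the deviation 3 of the new ray and for the gauge of a
  -- `K`-quasi-geodesic that follows `ρ i`.
  have hdem : ∀ (i : ℕ) (b : G) (j : Fin 3), ∃ X, 0 ≤ X ∧ (¬ HasEnd p (p o) (q i.unpair.1) (fun t => b • φ j t) →
      ∀ t, 0 ≤ t → (3 + |M' i (9 * K)| * B) * gaugeOf κ (dist o (b • φ j X)) < dist (b • φ j X) (ρ i t)) := by
    intro i b j
    by_cases hend : HasEnd p (p o) (q i.unpair.1) (fun t => b • φ j t)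
    · exact ⟨0, le_rfl, fun hc => absurd hend hc⟩
    · obtain ⟨r, hr⟩ := h.exists_hasEnd (hφg b j) (p o)
      obtain ⟨X, hX⟩ := h.exists_lt_dist ((hφ j).1.smul h.geometric.isometric b)
        (WG.change_base (z₁ := o) hk ((hφ j).wg.smul h.geometric.isometric b) le_rfl) (hρ i).1 (hρ i).wg hr (hρq i)
        (fun hc => hend (hc ▸ hr)) (3 + |M' i (9 * K)| * B)
      exact ⟨max X 0, le_max_right _ _, fun _ t ht => hX _ (le_max_left _ _) t ht⟩
  choose X hX0 hX using hdem
  -- The direction used at stage `i + 1` is chosen against the `i`-th entry, hence the shift in the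
  -- demand; its value at stage zero is irrelevant.
  obtain ⟨σ, b, j, τ, hqg, hσ, -, hτ, -, hgood, hclose⟩ := H
    (fun i _ _ b' j' => HasEnd p (p o) (q i.unpair.1) (fun t => b' • φ j' t)) (fun i b j => X (i - 1) b j)
    (fun i b j b' j₁ j₂ h1 h2 => by
      have h3 := h.hasEnd_smul b'⁻¹ h1
      have h4 := h.hasEnd_smul b'⁻¹ h2
      simp only [inv_smul_smul] at h3 h4
      have h5 := h.hasEnd_transfer (hφ j₁).isMorse (hφ j₂).isMorse h3 h4 (hφR j₁)
      exact hinj (hasEnd_unique h.tree h5 (hφR j₂)))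
  obtain ⟨r, hr⟩ := h.exists_hasEnd hσ (p o)
  have hrm : r ∈ h.ends := h.exists_boundaryMap_eq hσ hr
  rw [hq] at hrm
  obtain ⟨n, rfl⟩ := hrm
  set δ := dist (σ 0) o with hδ
  obtain ⟨m, hm⟩ := exists_nat_gt (K * (lossConst K * (δ + 1) + K))
  set i := Nat.pair n m with hi
  have hin : i.unpair.1 = n := by rw [hi, Nat.unpair_pair]
  have him : (m : ℝ) ≤ i := by exact_mod_cast Nat.right_le_pair n m
  have hend := hρq i
  rw [hin] at hend
  obtain ⟨c, hc0, hc⟩ := h.near_of_hasEnd hσ (hρ i).isMorse hr hend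
  have hXi := hX i (b (i + 1)) (j (i + 1)) (hgood i)
  have hXi0 := hX0 i (b (i + 1)) (j (i + 1))
  have hcl := hclose (i + 1) _ hXi0 le_rfl
  set x := τ (i + 1) + X i (b (i + 1)) (j (i + 1)) with hx
  set y := b (i + 1) • φ (j (i + 1)) (X i (b (i + 1)) (j (i + 1))) with hy
  have hxi : (m : ℝ) + 1 ≤ x := by
    have := hτ (i + 1)
    push_cast at this
    linarith
  have hx0 : 0 ≤ x := by linarith [Nat.cast_nonneg (α := ℝ) m]
  change dist (σ x) y ≤ 3 at hcl
  rcases WG.near_of_follows (δ := δ) (n := c) h.geodesic hk (hρ i).wg hK hqg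
    (by rw [(hρ i).2.1]) hc0
    (fun X => ⟨max X 0, le_max_left _ _, hc _ (le_max_right _ _)⟩) x hx0 with ⟨s, hs, hd⟩ | hd
  · have p1 := hk.one_le (dist o y)
    have h1 := hXi s hs
    have h2 := (hb o y (σ x) (by rw [dist_comm]; linarith)).2
    have h3 := dist_triangle_left y (ρ i s) (σ x)
    have h4 : M' i (9 * K) * gaugeOf κ (dist o (σ x)) ≤ |M' i (9 * K)| * (B * gaugeOf κ (dist o y)) :=
      (mul_le_mul_of_nonneg_right (le_abs_self _) (hk.pos _).le).trans
        (mul_le_mul_of_nonneg_left h2 (abs_nonneg _))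
    linarith
  · have h1 := (hqg x 0 ⟨le_rfl, hx0⟩ x ⟨hx0, le_rfl⟩ hx0).1
    rw [sub_zero, dist_comm] at h1
    have h2 : x / K ≤ lossConst K * (δ + 1) + K := by linarith
    rw [div_le_iff₀ (by linarith)] at h2
    linarith

/-- If there are uncountably many Morse ends, then there are uncountably many behind every vertex. -/
theorem not_countable_shadow {M : ℕ → ℝ → ℝ} (hM : h.ends = ⋃ i, endsOf (gaugeOf κ) o p (M i))
    (hunc : ¬ h.ends.Countable) (hdense : ∀ v, ∃ r ∈ h.ends, ∃ n, r n = v) (v : V) (n : ℕ)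
    (hv : dist (p o) v = n) : ¬ {r ∈ h.ends | r n = v}.Countable := by
  intro hcount
  set u := p o with hu
  have hrep : ∀ r ∈ h.ends, ∃ (a : ℝ → Y), IsMorse (gaugeOf κ) o a ∧ HasEnd p u r a := by
    intro r hr
    rw [hM] at hr
    obtain ⟨i, a, ha, hra⟩ := mem_iUnion.1 hr
    exact ⟨a, ha.isMorse, hra⟩
  have : Nonempty (ℝ → Y) := ⟨fun _ => o⟩
  choose! α hα hαr using hrep
  obtain ⟨x, c, hc⟩ := h.cobounded.cobounded
  -- A translation `g` is chosen so that `v` separates `u` from `g • u` and is at least `m` away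
  -- from the latter. An end whose translate does not run behind `v` must leave `g • u` towards `v`,
  -- so its vertex at level `m` is determined. As translation is injective on ends, all but
  -- countably many ends have this vertex; collecting all `m`, only countably many ends exist.
  have hbig : ∀ m : ℕ, ∃ b, {r ∈ h.ends | r m ≠ b}.Countable := by
    intro m
    obtain ⟨r, hr, n', hrn⟩ := hdense v
    have hray := h.isRayFrom_of_mem_ends hr
    have hn : n' = n := by
      have := hray.dist_base n'
      rw [hrn, hv] at this
      exact_mod_cast this.symm
    subst hn
    obtain ⟨l, hl⟩ := exists_nat_gt (m + (c + dist x u))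
    obtain ⟨g, hg⟩ := hc (r (n' + l))
    have hgu : dist (r (n' + l)) (g • u) ≤ c + dist x u := by
      have := dist_triangle (r (n' + l)) (g • x) (g • u)
      rw [h.cobounded.isometric] at this
      linarith
    have hc0 : 0 ≤ c + dist x u := dist_nonneg.trans hgu
    have hvl : dist v (r (n' + l)) = l := by
      rw [← hrn, hray.2]
      push_cast
      rw [sub_add_cancel_left, abs_neg, abs_of_nonneg (Nat.cast_nonneg l)]
    have hbet : Betw u v (g • u) := by
      refine h.tree.betw_of_dist_lt (w := v) (x := r (n' + l)) (betw_self_right _ _) ?_ ?_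
      · rw [← hrn]; exact hray.betw (Nat.le_add_right _ _)
      · rw [hvl]; linarith [Nat.cast_nonneg (α := ℝ) m]
    have hfar : (m : ℝ) ≤ dist (g • u) v := by
      have := dist_triangle_right v (r (n' + l)) (g • u)
      rw [hvl, dist_comm v] at this
      linarith
    obtain ⟨e, he, hev⟩ := h.tree.exists_point (g • u) v m hfar
    refine ⟨g⁻¹ • e, ?_⟩
    choose! f hf using fun (r : ℕ → V) (hr : r ∈ h.ends) =>
      h.exists_hasEnd (h.isMorse_smul (hα r hr) g) u
    refine Set.MapsTo.countable_of_injOn (f := f) (t := {r ∈ h.ends | r n' = v}) ?_ ?_ hcount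
    · rintro s ⟨hs, hsm⟩
      refine ⟨h.exists_boundaryMap_eq (h.isMorse_smul (hα s hs) g) (hf s hs), ?_⟩
      have h1 := (h.hasEnd_smul g (hαr s hs)).2 m
      obtain ⟨t, ht1, ht2⟩ := (h1.and ((hf s hs).2 n')).exists
      have h3 : Betw u v (p (g • α s t)) := by
        by_contra hcon
        have h4 : Betw (g • u) e (p (g • α s t)) := hev.trans (h.tree.branch hbet hcon)
        have h5 := h.tree.unique h4 ht1 (by
          rw [he, h.cobounded.isometric, (h.isRayFrom_of_mem_ends hs).dist_base])
        exact hsm (by rw [h5, inv_smul_smul])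
      refine h.tree.unique ht2 h3 ?_
      rw [(hf s hs).1.dist_base, hv]
    · rintro s ⟨hs, -⟩ s' ⟨hs', -⟩ hss
      have h1 := h.hasEnd_smul g⁻¹ (hf s hs)
      have h2 := h.hasEnd_smul g⁻¹ (hf s' hs')
      rw [← hss] at h2
      simp only [inv_smul_smul] at h1 h2
      have h3 := h.hasEnd_transfer (hα s hs) (hα s' hs') h1 h2 (hαr s hs)
      exact hasEnd_unique h.tree h3 (hαr s' hs')
  choose b hb using hbig
  refine hunc (((countable_iUnion hb).union (countable_singleton b)).mono fun r hr => ?_)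
  by_cases hrb : r = b
  · exact Or.inr hrb
  · obtain ⟨m, hm⟩ := Function.ne_iff.1 hrb
    exact Or.inl (mem_iUnion.2 ⟨m, hr, hm⟩)

end MorseSetting

end Ends

/-! ### Degenerate gauges and convex hulls -/

section Degenerate

variable {Y : Type*} [MetricSpace Y] {κ : ℝ → ℝ}

/-- Monotonicity settles `t ≤ 1`; beyond that, concavity gives `κ t / t ≤ κ 1`. -/
theorem IsSublinear.eq_zero (h : IsSublinear κ) (h1 : κ 1 = 0) {t : ℝ} (ht : 0 ≤ t) : κ t = 0 := by
  refine le_antisymm ?_ (h.nonneg t ht)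
  rcases le_total t 1 with h2 | h2
  · exact (h.monotone ht (mem_Ici.2 zero_le_one) h2).trans h1.le
  · have ht' : 0 < t := by linarith
    have h3 : 1 / t ≤ 1 := by rw [div_le_one ht']; exact h2
    have h4 := h.concave.2 (x := 0) (y := t) (mem_Ici.2 le_rfl) (mem_Ici.2 ht)
      (show 0 ≤ 1 - 1 / t by linarith) (show 0 ≤ 1 / t by positivity) (by ring)
    simp only [smul_eq_mul, mul_zero, zero_add] at h4
    rw [one_div_mul_cancel ht'.ne', h1] at h4
    have h5 : 0 ≤ (1 - 1 / t) * κ 0 := mul_nonneg (by linarith) (h.nonneg 0 le_rfl)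
    by_contra hlt
    have h6 : 0 < 1 / t * κ t := mul_pos (by positivity) (not_le.1 hlt)
    linarith

/-- For the zero function every Morse set is dense. -/
theorem HasMorseGauge.infDist_eq_zero (h : IsSublinear κ) (h1 : κ 1 = 0) {o : Y} {Z : Set Y}
    {N : ℝ → ℝ → ℝ≥0} (hN : HasMorseGauge κ o Z N) (hZ : Z.Nonempty) (y : Y) :
    Metric.infDist y Z = 0 := by
  classical
  obtain ⟨z, hz⟩ := hZ
  -- Quasi-geodesics may jump: a path resting at `z` with a single excursion to `y` is one, with a
  -- large additive constant.
  have h2 := hN 1 (1 + dist y z) le_rfl (by positivity) 0 1 zero_le_one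
    (fun x => if x.1 = 1 / 2 then y else z) (fun a b => by
      have h3 : dist a b ≤ 1 := by
        rw [Subtype.dist_eq, Real.dist_eq, abs_le]
        constructor <;> linarith [a.2.1, a.2.2, b.2.1, b.2.2]
      have h4 : dist (if a.1 = 1 / 2 then y else z) (if b.1 = 1 / 2 then y else z) ≤ dist y z := by
        split_ifs <;> simp [dist_comm]
      have h5 := dist_nonneg (x := y) (y := z)
      have h6 := dist_nonneg (x := a) (y := b)
      have h7 := dist_nonneg (x := if a.1 = 1 / 2 then y else z) (y := if b.1 = 1 / 2 then y else z)
      constructor <;> linarith) (by simpa using hz) (by norm_num; exact hz) ⟨1 / 2, by norm_num, by norm_num⟩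
  have h3 : Metric.infDist y Z ≤ N 1 (1 + dist y z) * κ (dist o y) := by simpa [kappaNeighborhood] using h2
  rw [h.eq_zero h1 dist_nonneg, mul_zero] at h3
  exact le_antisymm h3 Metric.infDist_nonneg

/-- Excludes the degenerate case `κ 1 = 0`: a one-point boundary spans no bi-infinite geodesic, but
the trees of the chain are nonempty. -/
theorem subsingleton_kappaBoundary (h : IsSublinear κ) (h1 : κ 1 = 0) (o : Y) :
    Subsingleton (KappaBoundary κ o) := by
  refine ⟨fun ξ η => ?_⟩
  obtain ⟨α, rfl⟩ := Quot.exists_rep ξ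
  obtain ⟨β, rfl⟩ := Quot.exists_rep η
  refine Quot.sound ⟨0, fun y _ => ?_, fun y _ => ?_⟩
  · obtain ⟨-, N, hN⟩ := β.2
    rw [kappaNeighborhood, mem_ofPred_eq, hN.infDist_eq_zero h h1 (range_nonempty _), zero_mul]
  · obtain ⟨-, N, hN⟩ := α.2
    rw [kappaNeighborhood, mem_ofPred_eq, hN.infDist_eq_zero h h1 (range_nonempty _), zero_mul]

end Degenerate

section Hulls

variable {V : Type*} [MetricSpace V]

theorem IsTreeMetric.betw_or_betw_of_betw (hV : IsTreeMetric V) (u : V) {x v y : V} (h : Betw x v y) :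
    Betw u v x ∨ Betw u v y := by
  by_contra hcon
  push Not at hcon
  have h1 : ¬ Betw x v u := fun hc => hcon.1 hc.symm
  exact hcon.2 (hV.branch h h1).symm

theorem betw_of_isometry {ℓ : ℤ → V} (hℓ : ∀ i j : ℤ, dist (ℓ i) (ℓ j) = |(i : ℝ) - j|) {a b c : ℤ}
    (hab : a ≤ b) (hbc : b ≤ c) : Betw (ℓ a) (ℓ b) (ℓ c) := by
  have h1 : (a : ℝ) ≤ b := by exact_mod_cast hab
  have h2 : (b : ℝ) ≤ c := by exact_mod_cast hbc
  rw [Betw, hℓ, hℓ, hℓ, abs_of_nonpos (by linarith), abs_of_nonpos (by linarith),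
    abs_of_nonpos (by linarith)]
  ring

/-- If both halves of a line had the same end, they would share their first edge at `ℓ 0`. -/
theorem geodesicHull_eq_empty (hV : IsTreeMetric V) {Λ : Set (GromovBoundary V)} (hΛ : Λ.Subsingleton) :
    geodesicHull Λ = ∅ := by
  rw [eq_empty_iff_forall_notMem]
  rintro v ⟨ℓ, hℓ, ⟨ξ, hξ, h1⟩, ⟨η, hη, h2⟩, -⟩
  rw [hΛ hη hξ] at h2
  have h3 := (hV.represents_iff (ℓ 0) _ ξ).1 h1 1
  have h4 := (hV.represents_iff (ℓ 0) _ ξ).1 h2 1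
  obtain ⟨n, h5, h6⟩ := (h3.and h4).exists
  have h7 := (hV.rayTo_isRayFrom (ℓ 0) ξ).dist_base 1
  have hn : (0 : ℝ) ≤ n := Nat.cast_nonneg n
  have h8 := dist_triangle_left (ℓ n) (ℓ (-n)) (hV.rayTo (ℓ 0) ξ 1)
  rw [Betw, hℓ, h7] at h5 h6
  rw [hℓ] at h8
  push_cast at h5 h6 h8
  rw [abs_of_nonpos (by linarith)] at h5
  rw [abs_of_nonneg (by linarith)] at h6
  rw [abs_of_nonneg (by linarith)] at h8
  linarith

/-- Behind every vertex of the convex hull there is an end. -/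
theorem exists_end_of_mem_geodesicHull (hV : IsTreeMetric V) (u : V) {Λ : Set (GromovBoundary V)} {v : V}
    (hv : v ∈ geodesicHull Λ) : ∃ ξ ∈ Λ, ∃ n, hV.rayTo u ξ n = v := by
  obtain ⟨ℓ, hℓ, ⟨ξ, hξ, h1⟩, ⟨η, hη, h2⟩, ⟨j, rfl⟩⟩ := hv
  obtain ⟨n, hn⟩ := hV.exists_nat u (ℓ j)
  have key : ∀ᶠ m : ℕ in atTop, Betw u (ℓ j) (ℓ m) ∨ Betw u (ℓ j) (ℓ (-m)) := by
    filter_upwards [eventually_ge_atTop j.natAbs] with m hm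
    exact (hV.betw_or_betw_of_betw u (betw_of_isometry hℓ (show -(m : ℤ) ≤ j by omega)
      (show j ≤ (m : ℤ) by omega))).symm
  rcases frequently_or_distrib.1 key.frequently with hf | hf
  · refine ⟨ξ, hξ, n, ?_⟩
    obtain ⟨m, h3, h4⟩ := (hf.and_eventually ((hV.represents_iff u _ ξ).1 h1 n)).exists
    exact hV.unique h4 h3 (by rw [(hV.rayTo_isRayFrom u ξ).dist_base, hn])
  · refine ⟨η, hη, n, ?_⟩
    obtain ⟨m, h3, h4⟩ := (hf.and_eventually ((hV.represents_iff u _ η).1 h2 n)).exists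
    exact hV.unique h4 h3 (by rw [(hV.rayTo_isRayFrom u η).dist_base, hn])

end Hulls

/-! ### Neighbours in the tree as seen from a base vertex -/

section Children

variable {V : Type*} [MetricSpace V] {T : SimpleGraph V}

theorem countable_of_tree (hT : IsCountablyInfiniteValenceTree T) : Countable V := by
  obtain ⟨u⟩ := hT.isTree.connected.nonempty
  have hlev : ∀ n : ℕ, {v | T.dist u v = n}.Countable := by
    intro n
    induction n with
    | zero =>
      refine (countable_singleton u).mono fun v hv => ?_
      exact ((hT.isTree.connected.dist_eq_zero_iff).1 hv).symm
    | succ n ih =>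
      refine (ih.biUnion fun v _ => hT.countable v).mono fun v hv => ?_
      obtain ⟨q, hq⟩ := hT.isTree.connected.exists_walk_length_eq_dist v u
      rw [SimpleGraph.dist_comm, show T.dist u v = n + 1 from hv] at hq
      cases q with
      | nil => simp at hq
      | cons hadj q =>
        rename_i w
        rw [SimpleGraph.Walk.length_cons] at hq
        refine mem_biUnion (x := w) ?_ hadj.symm
        have h1 : T.dist w u ≤ n := (SimpleGraph.dist_le q).trans (by omega)
        have h2 := hT.isTree.connected.dist_triangle (u := u) (v := w) (w := v)
        rw [SimpleGraph.dist_eq_one_iff_adj.2 hadj.symm] at h2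
        have hv' : T.dist u v = n + 1 := hv
        rw [SimpleGraph.dist_comm] at h1
        change T.dist u w = n
        omega
  exact countable_univ_iff.1 ((countable_iUnion hlev).mono fun v _ => mem_iUnion.2
    ⟨T.dist u v, rfl⟩)

/-- The neighbours of `v` that are farther from `u` than `v`. -/
def children (T : SimpleGraph V) (u v : V) : Set V := {w | T.Adj v w ∧ Betw u v w}

variable (hT : T.IsTree) (hdist : ∀ u v : V, dist u v = (T.dist u v : ℝ))
include hT hdist

theorem dist_eq_one_iff {v w : V} : dist v w = 1 ↔ T.Adj v w := by
  rw [hdist, Nat.cast_eq_one, SimpleGraph.dist_eq_one_iff_adj]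

theorem betw_or_betw_of_adj (u : V) {v w : V} (h : T.Adj v w) : Betw u v w ∨ Betw u w v := by
  have h1 := (dist_eq_one_iff hT hdist).2 h
  have h2 := hT.dist_ne_of_adj u h
  have h3 := dist_triangle u v w
  have h4 := dist_triangle_right u v w
  rw [Betw, Betw, dist_comm w v, h1]
  rw [h1, hdist, hdist] at h3 h4
  rw [hdist, hdist]
  have h5 : T.dist u w ≤ T.dist u v + 1 := by exact_mod_cast h3
  have h6 : T.dist u v ≤ T.dist u w + 1 := by exact_mod_cast h4
  rcases lt_or_gt_of_ne h2 with h7 | h7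
  · left; exact_mod_cast (show T.dist u v + 1 = T.dist u w by omega)
  · right; exact_mod_cast (show T.dist u w + 1 = T.dist u v by omega)

theorem dist_of_mem_children {u v w : V} (hw : w ∈ children T u v) : dist u w = dist u v + 1 := by
  rw [← (dist_eq_one_iff hT hdist).2 hw.1]
  exact Eq.symm hw.2

/-- Only one neighbour of `v` can be closer to `u`. -/
theorem infinite_children (hinf : (T.neighborSet v).Infinite) (u : V) : (children T u v).Infinite := by
  have hV := isTreeMetric hT hdist
  intro hfin
  refine hinf ((hfin.union (s := children T u v) (t := {w | T.Adj v w ∧ Betw u w v}) ?_).subset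
    fun w hw => ?_)
  · refine Set.Subsingleton.finite ?_
    rintro w ⟨hw, hb⟩ w' ⟨hw', hb'⟩
    refine hV.unique hb hb' ?_
    have h1 : dist u w + dist w v = dist u v := hb
    have h2 : dist u w' + dist w' v = dist u v := hb'
    rw [(dist_eq_one_iff hT hdist).2 hw.symm] at h1
    rw [(dist_eq_one_iff hT hdist).2 hw'.symm] at h2
    linarith
  · exact (betw_or_betw_of_adj hT hdist u hw).imp (fun hb => ⟨hw, hb⟩) fun hb => ⟨hw, hb⟩

end Children

section Exhaustion

variable {V : Type*} [MetricSpace V] {T : SimpleGraph V}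

/-! ### Exhaustion by perfect sets -/

/-- Closed sets of sequences with finitely many values at each index. -/
structure IsLevelFinite (Z : Set (ℕ → V)) : Prop where
  isClosed : IsClosed Z
  finite_level : ∀ k, ((fun r => r k) '' Z).Finite

theorem IsLevelFinite.isCompact {Z : Set (ℕ → V)} (hZ : IsLevelFinite Z) : IsCompact Z :=
  (isCompact_univ_pi fun k : ℕ => (hZ.finite_level k).isCompact).of_isClosed_subset hZ.isClosed
    fun r hr _ _ => ⟨r, hr, rfl⟩

theorem IsLevelFinite.union {Z Z' : Set (ℕ → V)} (hZ : IsLevelFinite Z) (hZ' : IsLevelFinite Z') :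
    IsLevelFinite (Z ∪ Z') :=
  ⟨hZ.isClosed.union hZ'.isClosed, fun k => by
    rw [image_union]; exact (hZ.finite_level k).union (hZ'.finite_level k)⟩

theorem IsLevelFinite.subset {Z Z' : Set (ℕ → V)} (hZ : IsLevelFinite Z) (hZ' : IsClosed Z')
    (hsub : Z' ⊆ Z) : IsLevelFinite Z' :=
  ⟨hZ', fun k => (hZ.finite_level k).subset (image_mono hsub)⟩

theorem isLevelFinite_singleton (r : ℕ → V) : IsLevelFinite {r} :=
  ⟨isClosed_singleton, fun _ => (finite_singleton r).image _⟩

/-- The hypotheses on the set of Morse ends. -/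
structure IsEndSet (T : SimpleGraph V) (u : V) (I : Set (ℕ → V)) (C : ℕ → Set (ℕ → V)) : Prop where
  tree : IsCountablyInfiniteValenceTree T
  dist_eq : ∀ u v : V, dist u v = (T.dist u v : ℝ)
  ray : ∀ r ∈ I, IsRayFrom u r
  levelFinite : ∀ j, IsLevelFinite (C j)
  union : I = ⋃ j, C j
  not_countable : ∀ v (n : ℕ), dist u v = n → ¬ {r ∈ I | r n = v}.Countable

namespace IsEndSet

variable {u : V} {I : Set (ℕ → V)} {C : ℕ → Set (ℕ → V)} (h : IsEndSet T u I C)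
include h

theorem treeMetric : IsTreeMetric V := isTreeMetric h.tree.isTree h.dist_eq

theorem eq_of_le {r s : ℕ → V} (hr : r ∈ I) (hs : s ∈ I) {i k : ℕ} (hik : i ≤ k) (hk : r k = s k) :
    r i = s i := h.treeMetric.ray_eq_of_le (h.ray r hr) (h.ray s hs) hik hk

/-- Behind every vertex there is a perfect set of ends that leaves a given level-finite set
immediately. -/
theorem exists_perfect {Z : Set (ℕ → V)} (hZ : IsLevelFinite Z) {v : V} {n : ℕ} (hv : dist u v = n) :
    ∃ D, IsLevelFinite D ∧ D ⊆ I ∧ D.Nonempty ∧ Preperfect D ∧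
      ∀ r ∈ D, r n = v ∧ ∀ z ∈ Z, z (n + 1) ≠ r (n + 1) := by
  have := h.treeMetric.discreteTopology
  have := countable_of_tree h.tree
  -- `v` has infinitely many children, but `Z` visits only finitely many of them. Behind an
  -- unvisited child there are uncountably many ends, so one of the closed sets `C j` contains
  -- uncountably many of these, and the Cantor-Bendixson theorem yields a perfect subset.
  obtain ⟨w, hw, hwZ⟩ := ((infinite_children h.tree.isTree h.dist_eq (h.tree.infinite v) u).sdiff
    (hZ.finite_level (n + 1))).nonempty
  have hwd : dist u w = (n + 1 : ℕ) := by
    rw [dist_of_mem_children h.tree.isTree h.dist_eq hw, hv]; push_cast; rfl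
  have h1 := h.not_countable w (n + 1) hwd
  have h2 : ∃ j, ¬ {r ∈ C j | r (n + 1) = w}.Countable := by
    by_contra hcon
    push Not at hcon
    refine h1 ((countable_iUnion hcon).mono ?_)
    rintro r ⟨hr, hrw⟩
    rw [h.union] at hr
    obtain ⟨j, hj⟩ := mem_iUnion.1 hr
    exact mem_iUnion.2 ⟨j, hj, hrw⟩
  obtain ⟨j, hj⟩ := h2
  have hclosed : IsClosed {r ∈ C j | r (n + 1) = w} :=
    (h.levelFinite j).isClosed.inter (isClosed_eq (continuous_apply (n + 1)) continuous_const)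
  obtain ⟨D, hD, hDne, hDC⟩ := exists_perfect_nonempty_of_isClosed_of_not_countable hclosed hj
  have hDI : D ⊆ I := fun r hr => h.union ▸ mem_iUnion.2 ⟨j, (hDC hr).1⟩
  refine ⟨D, (h.levelFinite j).subset hD.closed fun r hr => (hDC hr).1, hDI, hDne, hD.acc,
    fun r hr => ⟨?_, fun z hz he => hwZ ⟨z, hz, he.trans (hDC hr).2⟩⟩⟩
  have h3 := h.ray r (hDI hr)
  have h4 := h3.betw (Nat.le_succ n)
  rw [Nat.succ_eq_add_one, (hDC hr).2] at h4
  exact h.treeMetric.unique h4 hw.2 (by rw [h3.dist_base, hv])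

/-- Every level-finite set of ends is nowhere dense in a larger perfect level-finite set. -/
theorem exists_thickening {Z : Set (ℕ → V)} (hZ : IsLevelFinite Z) (hZI : Z ⊆ I) :
    ∃ P, IsLevelFinite P ∧ P ⊆ I ∧ Z ⊆ P ∧ (∀ x ∈ P, ∀ n, ∃ y ∈ P, y ≠ x ∧ y n = x n) ∧
      ∀ x ∈ Z, ∀ n, ∃ y ∈ P, y ∉ Z ∧ y n = x n := by
  have := h.treeMetric.discreteTopology
  -- At every vertex `v` that `Z` visits at level `n`, a perfect set `D n v` leaving `Z` immediately
  -- is attached.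
  set A : ℕ → Set V := fun n => (fun r => r n) '' Z with hA
  have hAd : ∀ n, ∀ v ∈ A n, dist u v = n := by
    rintro n _ ⟨r, hr, rfl⟩
    exact (h.ray r (hZI hr)).dist_base n
  choose! D hD hDI hDne hDp hDn using fun n v (hv : v ∈ A n) => h.exists_perfect hZ (hAd n v hv)
  set P : Set (ℕ → V) := Z ∪ ⋃ n, ⋃ v ∈ A n, D n v with hP
  have hDP : ∀ n, ∀ v ∈ A n, D n v ⊆ P := fun n v hv r hr =>
    Or.inr (mem_iUnion.2 ⟨n, mem_biUnion hv hr⟩)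
  have hPI : P ⊆ I := by
    refine union_subset hZI (iUnion_subset fun n => iUnion₂_subset fun v hv => hDI n v hv)
  have hstar : ∀ x ∈ Z, ∀ n, ∃ y ∈ P, y ∉ Z ∧ y n = x n := by
    intro x hx n
    have hxn : x n ∈ A n := ⟨x, hx, rfl⟩
    obtain ⟨y, hy⟩ := hDne n _ hxn
    exact ⟨y, hDP n _ hxn hy, fun hyZ => (hDn n _ hxn y hy).2 y hyZ rfl, (hDn n _ hxn y hy).1⟩
  refine ⟨P, ⟨?_, fun k => ?_⟩, hPI, subset_union_left, ?_, hstar⟩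
  -- A sequence outside `Z` leaves all prefixes of `Z` before some level `k`. Near it only those `D
  -- n v` with `n < k` occur, and these are finitely many closed sets.
  · refine isClosed_of_closure_subset fun r hr => ?_
    by_contra hrP
    have hrZ : r ∉ closure Z := fun hc => hrP (Or.inl (hZ.isClosed.closure_eq ▸ hc))
    rw [mem_closure_iff_prefix] at hr hrZ
    push Not at hrZ
    obtain ⟨k, hk⟩ := hrZ
    have hQ : IsClosed (⋃ n ∈ Iio k, ⋃ v ∈ A n, D n v) :=
      (finite_Iio k).isClosed_biUnion fun n _ => (hZ.finite_level n).isClosed_biUnion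
        fun v hv => (hD n v hv).isClosed
    have hrQ : r ∈ ⋃ n ∈ Iio k, ⋃ v ∈ A n, D n v := by
      rw [← hQ.closure_eq, mem_closure_iff_prefix]
      intro k'
      obtain ⟨z, hz, hzr⟩ := hr (max k k')
      refine ⟨z, ?_, fun i hi => hzr i (hi.trans_le (le_max_right _ _))⟩
      rcases hz with hz | hz
      · obtain ⟨i, hi, hne⟩ := hk z hz
        exact absurd (hzr i (hi.trans_le (le_max_left _ _))) hne
      · obtain ⟨n, hz⟩ := mem_iUnion.1 hz
        obtain ⟨v, hv, hz⟩ := mem_iUnion₂.1 hz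
        refine mem_biUnion (x := n) ?_ (mem_biUnion hv hz)
        by_contra hnk
        have hnk' : k ≤ n := not_lt.1 hnk
        obtain ⟨c, hc, hcv⟩ := hv
        obtain ⟨i, hi, hne⟩ := hk c hc
        refine hne ?_
        rw [← hzr i (hi.trans_le (le_max_left _ _))]
        refine h.eq_of_le (hZI hc) (hDI n v ⟨c, hc, hcv⟩ hz) (hi.le.trans hnk') ?_
        rw [(hDn n v ⟨c, hc, hcv⟩ z hz).1]
        exact hcv
    obtain ⟨n, -, hr'⟩ := mem_iUnion₂.1 hrQ
    exact hrP (Or.inr (mem_iUnion.2 ⟨n, hr'⟩))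
  · refine ((hZ.finite_level k).union ((finite_Iio k).biUnion fun n _ =>
      (hZ.finite_level n).biUnion fun v hv => (hD n v hv).finite_level k)).subset ?_
    rintro _ ⟨z, hz | hz, rfl⟩
    · exact Or.inl ⟨z, hz, rfl⟩
    · obtain ⟨n, hz⟩ := mem_iUnion.1 hz
      obtain ⟨v, hv, hz⟩ := mem_iUnion₂.1 hz
      rcases lt_or_ge n k with hnk | hnk
      · exact Or.inr (mem_biUnion (x := n) hnk (mem_biUnion hv ⟨z, hz, rfl⟩))
      · left
        obtain ⟨c, hc, hcv⟩ := hv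
        refine ⟨c, hc, h.eq_of_le (hZI hc) (hDI n v ⟨c, hc, hcv⟩ hz) hnk ?_⟩
        rw [(hDn n v ⟨c, hc, hcv⟩ z hz).1]
        exact hcv
  · rintro x (hx | hx) n
    · obtain ⟨y, hy, hyZ, hyn⟩ := hstar x hx n
      exact ⟨y, hy, fun hc => hyZ (hc ▸ hx), hyn⟩
    · obtain ⟨n', hx⟩ := mem_iUnion.1 hx
      obtain ⟨v, hv, hx⟩ := mem_iUnion₂.1 hx
      have h1 := preperfect_iff_nhds.1 (hDp n' v hv) x hx {y | y n = x n}
        (((isOpen_discrete {x n}).preimage (continuous_apply (A := fun _ => V) n)).mem_nhds rfl)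
      obtain ⟨y, ⟨hyn, hy⟩, hyx⟩ := h1
      exact ⟨y, hDP n' v hv hy, hyx, hyn⟩

/-- The set of ends is an increasing union of nonempty perfect level-finite sets, each nowhere dense
in the next one. -/
theorem exists_exhaustion : ∃ X : ℕ → Set (ℕ → V), (∀ i, IsLevelFinite (X i)) ∧ (X 0).Nonempty ∧
    Monotone X ∧ I = ⋃ i, X i ∧ (∀ i, ∀ x ∈ X i, ∀ n, ∃ y ∈ X i, y ≠ x ∧ y n = x n) ∧
    ∀ i, ∀ x ∈ X i, ∀ n, ∃ y ∈ X (i + 1), y ∉ X i ∧ y n = x n := by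
  have hCI : ∀ j, C j ⊆ I := fun j => h.union ▸ subset_iUnion C j
  obtain ⟨r₀, hr₀⟩ : I.Nonempty := by
    have h1 := h.not_countable u 0 (by simp)
    by_contra hcon
    rw [not_nonempty_iff_eq_empty] at hcon
    exact h1 (by rw [hcon]; simp)
  have hstep : ∀ Z : {Z : Set (ℕ → V) // IsLevelFinite Z ∧ Z ⊆ I}, ∃ P : {Z : Set (ℕ → V) //
      IsLevelFinite Z ∧ Z ⊆ I}, Z.1 ⊆ P.1 ∧ (∀ x ∈ P.1, ∀ n, ∃ y ∈ P.1, y ≠ x ∧ y n = x n) ∧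
      ∀ x ∈ Z.1, ∀ n, ∃ y ∈ P.1, y ∉ Z.1 ∧ y n = x n := by
    rintro ⟨Z, hZ, hZI⟩
    obtain ⟨P, hP, hPI, h1, h2, h3⟩ := h.exists_thickening hZ hZI
    exact ⟨⟨P, hP, hPI⟩, h1, h2, h3⟩
  choose F hF1 hF2 hF3 using hstep
  -- Adding `C i` before thickening ensures that the union is everything.
  let X : ℕ → {Z : Set (ℕ → V) // IsLevelFinite Z ∧ Z ⊆ I} := fun i =>
    Nat.rec (F ⟨{r₀}, isLevelFinite_singleton r₀, singleton_subset_iff.2 hr₀⟩)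
      (fun i Z => F ⟨Z.1 ∪ C i, Z.2.1.union (h.levelFinite i), union_subset Z.2.2 (hCI i)⟩) i
  have hX1 : ∀ i, X (i + 1) = F ⟨(X i).1 ∪ C i, (X i).2.1.union (h.levelFinite i),
    union_subset (X i).2.2 (hCI i)⟩ := fun i => rfl
  have hsub : ∀ i, (X i).1 ∪ C i ⊆ (X (i + 1)).1 := by
    intro i
    rw [hX1]
    exact hF1 ⟨(X i).1 ∪ C i, (X i).2.1.union (h.levelFinite i), union_subset (X i).2.2 (hCI i)⟩
  refine ⟨fun i => (X i).1, fun i => (X i).2.1, ⟨r₀, hF1 _ rfl⟩,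
    monotone_nat_of_le_succ fun i => subset_union_left.trans (hsub i), ?_, ?_, ?_⟩
  · refine subset_antisymm ?_ (iUnion_subset fun i => (X i).2.2)
    refine h.union.subset.trans ?_
    exact iUnion_subset fun j => (subset_union_right.trans (hsub j)).trans
      (subset_iUnion (fun i => (X i).1) (j + 1))
  · intro i
    cases i with
    | zero => exact hF2 _
    | succ i => exact hF2 _
  · intro i x hx n
    obtain ⟨y, hy, hyZ, hyn⟩ := hF3 ⟨(X i).1 ∪ C i, (X i).2.1.union (h.levelFinite i),
      union_subset (X i).2.2 (hCI i)⟩ x (Or.inl hx) n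
    exact ⟨y, hy, fun hc => hyZ (Or.inl hc), hyn⟩

end IsEndSet

end Exhaustion

/-! ### Partitions into clopen sets -/

section Partitions

/-- A space with a compatible sequence of locally constant functions that separate its points, and an
exhaustion by perfect sets, each nowhere dense in the next one. -/
structure IsExhausted {X W : Type*} [TopologicalSpace X] (π : ℕ → X → W) (K : ℕ → Set X) : Prop where
  clopen : ∀ n (s : Set W), IsClopen (π n ⁻¹' s)
  compat : ∀ {i k x y}, i ≤ k → π k x = π k y → π i x = π i y
  basis : ∀ x (U : Set X), IsOpen U → x ∈ U → ∃ n, ∀ y, π n y = π n x → y ∈ U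
  separates : ∀ {x y}, x ≠ y → ∃ n, π n x ≠ π n y
  isClosed : ∀ i, IsClosed (K i)
  isCompact : ∀ i, IsCompact (K i)
  nonempty : (K 0).Nonempty
  mono : Monotone K
  exhausts : ∀ x, ∃ i, x ∈ K i
  perfect : ∀ i, ∀ x ∈ K i, ∀ n, ∃ y ∈ K i, y ≠ x ∧ π n y = π n x
  nowhereDense : ∀ i, ∀ x ∈ K i, ∀ n, ∃ y ∈ K (i + 1), y ∉ K i ∧ π n y = π n x

variable {X W : Type*} [TopologicalSpace X] {π : ℕ → X → W} {K : ℕ → Set X}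

namespace IsExhausted

variable (h : IsExhausted π K)
include h

/-- Perfectness provides three points of `U ∩ K i`, and nowhere density a point of `K (i + 1)` in
`U` away from the closed set `K i`. A sufficiently fine level separates all of them. -/
theorem exists_level {i : ℕ} {U : Set X} (hU : IsClopen U) (hUK : (U ∩ K i).Nonempty) (n₀ : ℕ) :
    ∃ n, n₀ ≤ n ∧ ((U \ π n ⁻¹' (π n '' (U ∩ K i))) ∩ K (i + 1)).Nonempty ∧
      ∃ a ∈ U ∩ K i, ∃ b ∈ U ∩ K i, ∃ c ∈ U ∩ K i, π n a ≠ π n b ∧ π n a ≠ π n c ∧ π n b ≠ π n c := by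
  obtain ⟨a, haU, haK⟩ := hUK
  obtain ⟨n₁, hn₁⟩ := h.basis a U hU.isOpen haU
  obtain ⟨b, hbK, hba, hb⟩ := h.perfect i a haK n₁
  obtain ⟨n₂, hn₂⟩ := h.separates hba
  obtain ⟨c, hcK, hcb, hc⟩ := h.perfect i b hbK (max n₁ n₂)
  obtain ⟨n₃, hn₃⟩ := h.separates hcb
  obtain ⟨d, hdK, hdi, hd⟩ := h.nowhereDense i a haK n₁
  obtain ⟨n₄, hn₄⟩ := h.basis d (K i)ᶜ (h.isClosed i).isOpen_compl hdi
  have hcU : c ∈ U := hn₁ c ((h.compat (le_max_left _ _) hc).trans hb)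
  refine ⟨n₀ + n₁ + n₂ + n₃ + n₄, by omega, ⟨d, ⟨hn₁ d hd, ?_⟩, hdK⟩, a, ⟨haU, haK⟩, b, ⟨hn₁ b hb, hbK⟩, c,
    ⟨hcU, hcK⟩, ?_, ?_, ?_⟩
  · rintro ⟨z, hz, hzd⟩
    exact hn₄ z (h.compat (by omega) hzd) hz.2
  · intro hc'
    exact hn₂ (h.compat (by omega) hc').symm
  · intro hc'
    refine hn₂ ?_
    rw [← h.compat (le_max_right _ _) hc]
    exact (h.compat (by omega) hc').symm
  · intro hc'
    exact hn₃ (h.compat (by omega) hc').symm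

/-- `U` is peeled: at stage `j` the fine cells that meet `K (i₀ + j)` are removed, where `i₀` is the
first index with `U ∩ K i₀` nonempty. The removed cells are the pieces. Stage zero gives three
pieces meeting `K i₀`, and stage `j + 1` a piece that meets `K (i₀ + j + 1)` but not `K (i₀ + j)`.
-/
theorem exists_partition [Countable W] {U : Set X} (hU : IsClopen U) (hne : U.Nonempty) (n₀ : ℕ) :
    ∃ P : ℕ → Set X, (∀ m, IsClopen (P m)) ∧ (∀ m, (P m).Nonempty) ∧ (∀ m, P m ⊆ U) ∧
      (∀ x ∈ U, ∃ m, x ∈ P m) ∧ (∀ m m' x, x ∈ P m → x ∈ P m' → m = m') ∧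
      (∀ m, ∀ x ∈ P m, ∀ y ∈ P m, π n₀ x = π n₀ y) ∧
      (∀ i, (U ∩ K i).Nonempty → ∃ a b c, a ≠ b ∧ a ≠ c ∧ b ≠ c ∧ (P a ∩ K i).Nonempty ∧
        (P b ∩ K i).Nonempty ∧ (P c ∩ K i).Nonempty) ∧
      ∀ i, (U ∩ K i).Nonempty → ∃ m, (P m ∩ K (i + 1)).Nonempty ∧ P m ∩ K i = ∅ := by
  classical
  have hex : ∃ i, (U ∩ K i).Nonempty := by
    obtain ⟨x, hx⟩ := hne
    obtain ⟨i, hi⟩ := h.exhausts x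
    exact ⟨i, x, hx, hi⟩
  set i₀ := Nat.find hex with hi₀
  have hi₀U : (U ∩ K i₀).Nonempty := Nat.find_spec hex
  have hmin : ∀ i, (U ∩ K i).Nonempty → ∃ j, i = i₀ + j := fun i hi =>
    Nat.exists_eq_add_of_le (Nat.find_min' hex hi)
  choose! n hn hnK hn3 using fun (i : ℕ) (O : Set X) (hO : IsClopen O ∧ (O ∩ K i).Nonempty) =>
    h.exists_level hO.1 hO.2 n₀
  let O : ℕ → Set X := fun j => Nat.rec U
    (fun j O => O \ π (n (i₀ + j) O) ⁻¹' (π (n (i₀ + j) O) '' (O ∩ K (i₀ + j)))) j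
  set ν : ℕ → ℕ := fun j => n (i₀ + j) (O j) with hν
  have hO1 : ∀ j, O (j + 1) = O j \ π (ν j) ⁻¹' (π (ν j) '' (O j ∩ K (i₀ + j))) := fun j => rfl
  have hO : ∀ j, IsClopen (O j) ∧ (O j ∩ K (i₀ + j)).Nonempty := by
    intro j
    induction j with
    | zero => exact ⟨hU, hi₀U⟩
    | succ j ih =>
      rw [hO1]
      exact ⟨ih.1.diff (h.clopen _ _), hnK _ _ ih⟩
  have hanti : Antitone O := antitone_nat_of_succ_le fun j => by rw [hO1]; exact sdiff_subset
  have hdisj : ∀ j, O (j + 1) ∩ K (i₀ + j) = ∅ := by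
    intro j
    rw [eq_empty_iff_forall_notMem]
    rintro x ⟨hx, hxK⟩
    rw [hO1] at hx
    exact hx.2 ⟨x, ⟨hx.1, hxK⟩, rfl⟩
  -- The labels of the pieces, a stage and a cell. Every stage contributes, so they are infinite in
  -- number and can be enumerated by `ℕ`, to be matched later with the children of a vertex.
  let L : Set (ℕ × W) := {q | ∃ x ∈ O q.1 ∩ K (i₀ + q.1), π (ν q.1) x = q.2}
  have hLinf : L.Infinite := by
    choose x hx using fun j => (hO j).2
    exact Set.infinite_of_injective_forall_mem (f := fun j => (j, π (ν j) (x j)))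
      (fun j j' hjj => congrArg Prod.fst hjj) (fun j => ⟨x j, hx j, rfl⟩)
  have : Infinite L := hLinf.to_subtype
  obtain ⟨e⟩ : Nonempty (ℕ ≃ L) := nonempty_equiv_of_countable
  set P : ℕ → Set X := fun m => O (e m).1.1 ∩ π (ν (e m).1.1) ⁻¹' {(e m).1.2} with hP
  have hPmem : ∀ j, ∀ x ∈ O j ∩ K (i₀ + j), ∃ m, (e m).1 = (j, π (ν j) x) ∧ x ∈ P m := by
    intro j x hx
    refine ⟨e.symm ⟨(j, π (ν j) x), x, hx, rfl⟩, by rw [Equiv.apply_symm_apply], ?_⟩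
    simp only [hP, Equiv.apply_symm_apply]
    exact ⟨hx.1, rfl⟩
  refine ⟨P, fun m => (hO _).1.inter (h.clopen _ _), fun m => ?_, fun m x hx => hanti (Nat.zero_le _) hx.1,
    fun x hx => ?_, ?_, fun m x hx y hy => ?_, fun i hi => ?_, fun i hi => ?_⟩
  · obtain ⟨x, hx, hxe⟩ := (e m).2
    exact ⟨x, hx.1, hxe⟩
  · have hout : ∃ j, x ∉ O (j + 1) := by
      obtain ⟨i, hi⟩ := h.exhausts x
      obtain ⟨j, rfl⟩ := hmin i ⟨x, hx, hi⟩
      exact ⟨j, fun hc => (hdisj j).subset ⟨hc, hi⟩⟩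
    obtain ⟨j, hj, hjm⟩ := wellFounded_lt.has_min {j | x ∉ O (j + 1)} hout
    rw [mem_ofPred_eq] at hj
    have hxO : x ∈ O j := by
      cases j with
      | zero => exact hx
      | succ j => exact not_not.1 fun hc => hjm j hc (Nat.lt_succ_self j)
    rw [hO1] at hj
    have hxN : x ∈ π (ν j) ⁻¹' (π (ν j) '' (O j ∩ K (i₀ + j))) := by
      by_contra hc
      exact hj ⟨hxO, hc⟩
    obtain ⟨y, hy, hyx⟩ := hxN
    obtain ⟨m, hm, -⟩ := hPmem _ y hy
    refine ⟨m, ?_⟩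
    simp only [hP, hm]
    exact ⟨hxO, hyx.symm⟩
  · have key : ∀ m m' x, x ∈ P m → x ∈ P m' → (e m).1.1 ≤ (e m').1.1 → m = m' := by
      intro m m' x hx hx' hle
      rcases hle.lt_or_eq with hlt | heq
      · exfalso
        have h1 : x ∈ O ((e m).1.1 + 1) := hanti hlt hx'.1
        rw [hO1] at h1
        obtain ⟨y, hy, hye⟩ := (e m).2
        exact h1.2 ⟨y, hy, hye.trans hx.2.symm⟩
      · refine e.injective (Subtype.ext (Prod.ext heq ?_))
        have h1 : π (ν (e m).1.1) x = (e m).1.2 := hx.2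
        have h2 : π (ν (e m').1.1) x = (e m').1.2 := hx'.2
        rw [← h1, ← h2, heq]
    intro m m' x hx hx'
    rcases le_total (e m).1.1 (e m').1.1 with hle | hle
    · exact key m m' x hx hx' hle
    · exact (key m' m x hx' hx hle).symm
  · have h1 : π (ν (e m).1.1) x = (e m).1.2 := hx.2
    have h2 : π (ν (e m).1.1) y = (e m).1.2 := hy.2
    exact h.compat (hn _ _ (hO _)) (h1.trans h2.symm)
  · obtain ⟨j, rfl⟩ := hmin i hi
    obtain ⟨a, ha, b, hb, c, hc, hab, hac, hbc⟩ := hn3 _ _ (hO 0)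
    obtain ⟨ma, hma, hma'⟩ := hPmem 0 a ha
    obtain ⟨mb, hmb, hmb'⟩ := hPmem 0 b hb
    obtain ⟨mc, hmc, hmc'⟩ := hPmem 0 c hc
    have hK : K (i₀ + 0) ⊆ K (i₀ + j) := h.mono (by omega)
    refine ⟨ma, mb, mc, ?_, ?_, ?_, ⟨a, hma', hK ha.2⟩, ⟨b, hmb', hK hb.2⟩, ⟨c, hmc', hK hc.2⟩⟩
    · rintro rfl; exact hab (congrArg Prod.snd (hma.symm.trans hmb))
    · rintro rfl; exact hac (congrArg Prod.snd (hma.symm.trans hmc))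
    · rintro rfl; exact hbc (congrArg Prod.snd (hmb.symm.trans hmc))
  · obtain ⟨j, rfl⟩ := hmin i hi
    obtain ⟨x, hx⟩ := (hO (j + 1)).2
    obtain ⟨m, hm, hxm⟩ := hPmem (j + 1) x hx
    refine ⟨m, ⟨x, hxm, hx.2⟩, ?_⟩
    rw [eq_empty_iff_forall_notMem]
    rintro y ⟨hy, hyK⟩
    simp only [hP, hm] at hy
    exact (hdisj j).subset ⟨hy.1, hyK⟩

end IsExhausted

end Partitions

/-! ### Coding by a Cantor chain -/

section Coding

variable {V : Type*} [MetricSpace V] {T : SimpleGraph V}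
variable {X W : Type*} [TopologicalSpace X] [Countable W] {π : ℕ → X → W} {K : ℕ → Set X}

/-- A space with an exhaustion by perfect sets, each nowhere dense in the next one, is homeomorphic to
the union of the boundaries of the trees in a strongly entwined filling chain. -/
theorem IsExhausted.exists_chain (h : IsExhausted π K) (hT : IsCountablyInfiniteValenceTree T)
    (hdist : ∀ u v : V, dist u v = (T.dist u v : ℝ)) : ∃ S, IsStronglyEntwinedFillingChain T S ∧
      Nonempty (X ≃ₜ ↥(⋃ i, boundaryOf (S i))) := by
  classical
  have hV := isTreeMetric hT.isTree hdist
  have := hV.discreteTopology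
  have := countable_of_tree hT
  obtain ⟨u⟩ := hT.isTree.connected.nonempty
  have hadj : ∀ {v w : V}, dist v w = 1 ↔ T.Adj v w := dist_eq_one_iff hT.isTree hdist
  choose! P hPc hPne hPU hPcov hPdis hPpre hP3 hPnew using
    fun (U : Set X) (n : ℕ) (hU : IsClopen U ∧ U.Nonempty) => h.exists_partition hU.1 hU.2 n
  have henum : ∀ v, Nonempty (ℕ ≃ children T u v) := fun v => by
    have := (infinite_children hT.isTree hdist (hT.infinite v) u).to_subtype
    exact nonempty_equiv_of_countable
  let ε : ∀ v, ℕ ≃ children T u v := fun v => (henum v).some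
  -- `lab` is the index of the piece containing `x`. The code of `x` descends in the tree by passing
  -- at each level to the child with this index; the value 0 outside all pieces never occurs along a
  -- code.
  let lab : Set X → ℕ → X → ℕ := fun U n x => if hx : ∃ m, x ∈ P U n m then hx.choose else 0
  let st : X → ℕ → V × Set X := fun x n => Nat.rec (u, univ)
    (fun n s => ((ε s.1 (lab s.2 n x) : V), P s.2 n (lab s.2 n x))) n
  set code : X → ℕ → V := fun x n => (st x n).1 with hcode
  set cell : X → ℕ → Set X := fun x n => (st x n).2 with hcell
  have hcode1 : ∀ x n, code x (n + 1) = ε (code x n) (lab (cell x n) n x) := fun x n => rfl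
  have hcell1 : ∀ x n, cell x (n + 1) = P (cell x n) n (lab (cell x n) n x) := fun x n => rfl
  have hcells : ∀ n x, (IsClopen (cell x n) ∧ (cell x n).Nonempty) ∧ x ∈ cell x n := by
    intro n
    induction n with
    | zero => exact fun x => ⟨⟨isClopen_univ, x, trivial⟩, trivial⟩
    | succ n ih =>
      intro x
      have hx := hPcov _ n (ih x).1 x (ih x).2
      have hl : x ∈ P (cell x n) n (lab (cell x n) n x) := by
        simp only [lab, dif_pos hx]; exact hx.choose_spec
      rw [hcell1]
      exact ⟨⟨hPc _ n (ih x).1 _, x, hl⟩, hl⟩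
  have hlab : ∀ x n m y, y ∈ P (cell x n) n m → lab (cell x n) n y = m := by
    intro x n m y hy
    have hx : ∃ m, y ∈ P (cell x n) n m := ⟨m, hy⟩
    simp only [lab, dif_pos hx]
    exact hPdis _ n (hcells n x).1 _ _ y hx.choose_spec hy
  have hcellst : ∀ n x y, y ∈ cell x n → st y n = st x n := by
    intro n
    induction n with
    | zero => exact fun x y _ => rfl
    | succ n ih =>
      intro x y hy
      rw [hcell1] at hy
      have h1 := ih x y (hPU _ n (hcells n x).1 _ hy)
      have h2 := hlab x n _ y hy
      have h3 : cell y n = cell x n := congrArg Prod.snd h1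
      have h4 : code y n = code x n := congrArg Prod.fst h1
      refine Prod.ext ?_ ?_
      · change code y (n + 1) = code x (n + 1)
        rw [hcode1, hcode1, h3, h4, h2]
      · change cell y (n + 1) = cell x (n + 1)
        rw [hcell1, hcell1, h3, h2]
  have hchild : ∀ x n, code x (n + 1) ∈ children T u (code x n) := fun x n => (ε _ _).2
  have hlevel : ∀ x n, dist u (code x n) = (n : ℕ) := by
    intro x n
    induction n with
    | zero => exact (dist_self u).trans Nat.cast_zero.symm
    | succ n ih =>
      rw [dist_of_mem_children hT.isTree hdist (hchild x n), ih]; push_cast; rfl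
  have hray : ∀ x, IsRayFrom u (code x) := fun x =>
    IsRayFrom.of_step rfl (fun n => hadj.2 (hchild x n).1) (hlevel x)
  have hcodest : ∀ n x y, code y n = code x n → st y n = st x n := by
    intro n
    induction n with
    | zero => exact fun x y _ => rfl
    | succ n ih =>
      intro x y hxy
      have h1 : code y n = code x n := hV.ray_eq_of_le (hray y) (hray x) (Nat.le_succ n) hxy
      have h3 : cell y n = cell x n := congrArg Prod.snd (ih x y h1)
      have h4 : lab (cell y n) n y = lab (cell x n) n x := by
        rw [hcode1, hcode1, h1] at hxy
        exact (ε _).injective (Subtype.ext hxy)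
      refine Prod.ext hxy ?_
      change cell y (n + 1) = cell x (n + 1)
      rw [hcell1, hcell1, h4, h3]
  have hcodecell : ∀ n x y, code y n = code x n ↔ y ∈ cell x n := by
    refine fun n x y => ⟨fun hxy => ?_, fun hy => congrArg Prod.fst (hcellst n x y hy)⟩
    have h1 : cell y n = cell x n := congrArg Prod.snd (hcodest n x y hxy)
    exact h1 ▸ (hcells n y).2
  have hchildcode : ∀ x n m, ∀ y ∈ P (cell x n) n m, code y (n + 1) = ε (code x n) m := by
    intro x n m y hy
    have h1 := hcellst n x y (hPU _ n (hcells n x).1 _ hy)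
    have h3 : cell y n = cell x n := congrArg Prod.snd h1
    have h4 : code y n = code x n := congrArg Prod.fst h1
    rw [hcode1, h3, h4, hlab x n m y hy]
  have hchildcell : ∀ x n m y, code y (n + 1) = ε (code x n) m → y ∈ P (cell x n) n m := by
    intro x n m y hy
    obtain ⟨z, hz⟩ := hPne _ n (hcells n x).1 m
    have h1 := hchildcode x n m z hz
    have h2 := (hcodecell (n + 1) z y).1 (hy.trans h1.symm)
    have h3 := hcellst n x z (hPU _ n (hcells n x).1 _ hz)
    have h4 : cell z n = cell x n := congrArg Prod.snd h3
    rw [hcell1, h4, hlab x n m z hz] at h2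
    exact h2
  have hprefix : ∀ n x y, code y (n + 1) = code x (n + 1) → π n y = π n x := by
    intro n x y hxy
    have h1 := (hcodecell (n + 1) x y).1 hxy
    have h2 := (hcells (n + 1) x).2
    rw [hcell1] at h1 h2
    exact hPpre _ n (hcells n x).1 _ y h1 x h2
  have hcont : ∀ n, Continuous fun x => code x n := by
    intro n
    refine IsLocallyConstant.continuous ((IsLocallyConstant.iff_exists_open _).2 fun x =>
      ⟨cell x n, (hcells n x).1.1.isOpen, (hcells n x).2, fun y hy => (hcodecell n x y).2 hy⟩)
  have hcode_inj : Function.Injective code := by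
    intro x y hxy
    by_contra hne
    obtain ⟨n, hn⟩ := h.separates hne
    exact hn (hprefix n y x (congrFun hxy (n + 1)))
  have hcode_ind : IsInducing code := by
    refine isInducing_iff_nhds.2 fun x => le_antisymm ?_ ?_
    · exact (continuous_pi hcont).continuousAt.le_comap
    · intro U hU
      obtain ⟨U', hU'U, hU'o, hxU'⟩ := mem_nhds_iff.1 hU
      obtain ⟨n, hn⟩ := h.basis x U' hU'o hxU'
      refine ⟨{r | r (n + 1) = code x (n + 1)}, ((isOpen_discrete {code x (n + 1)}).preimage
        (continuous_apply (A := fun _ => V) (n + 1))).mem_nhds rfl, fun y hy => hU'U (hn y (hprefix n x y hy))⟩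
  -- Tree `i` consists of the vertices on the codes of `K i`. Three pieces meeting `K i` give degree
  -- at least three, a piece met only by `K (i + 1)` gives a larger degree, and compactness gives
  -- local finiteness.
  set S : ℕ → Set V := fun i => {v | ∃ x ∈ K i, ∃ n, code x n = v} with hS
  have hKne : ∀ i, (K i).Nonempty := fun i => h.nonempty.mono (h.mono (Nat.zero_le i))
  have hlev : ∀ x n y m, code x n = code y m → n = m := by
    intro x n y m he
    have h1 := hlevel x n
    rw [he, hlevel y m] at h1
    exact_mod_cast h1.symm
  have hnested : ∀ i, S i ⊆ S (i + 1) := by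
    rintro i _ ⟨x, hx, n, rfl⟩
    exact ⟨x, h.mono (Nat.le_succ i) hx, n, rfl⟩
  have hfin : ∀ i, ∀ v ∈ S i, (T.neighborSet v ∩ S i).Finite := by
    rintro i _ ⟨x, hx, n, rfl⟩
    refine ((finite_Iic (n + 1)).biUnion fun m _ =>
      ((h.isCompact i).image (hcont m)).finite_of_discrete).subset ?_
    rintro w ⟨hw, y, hy, m, rfl⟩
    refine mem_biUnion (x := m) ?_ ⟨y, hy, rfl⟩
    have h1 := dist_triangle u (code x n) (code y m)
    rw [hlevel, hlevel, hadj.2 hw] at h1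
    exact_mod_cast h1
  have hmeet : ∀ i x n m, (P (cell x n) n m ∩ K i).Nonempty →
      (ε (code x n) m : V) ∈ T.neighborSet (code x n) ∩ S i := by
    rintro i x n m ⟨y, hy, hyK⟩
    exact ⟨(ε (code x n) m).2.1, y, hyK, n + 1, hchildcode x n m y hy⟩
  -- All pieces are nonempty and every child has one, so every vertex lies on some code; this gives
  -- the filling property.
  have hsurj : ∀ (n : ℕ) v, dist u v = n → ∃ x, code x n = v := by
    intro n
    induction n with
    | zero =>
      intro v hv
      obtain ⟨x, -⟩ := hKne 0
      exact ⟨x, dist_le_zero.1 (show dist u v ≤ 0 by rw [hv, Nat.cast_zero])⟩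
    | succ n ih =>
      intro v hv
      obtain ⟨w, hw, hwv⟩ := hV.exists_point u v n (by rw [hv]; push_cast; linarith)
      obtain ⟨x, rfl⟩ := ih w hw
      have h1 : dist u (code x n) + dist (code x n) v = dist u v := hwv
      rw [hw, hv] at h1
      have h2 : v ∈ children T u (code x n) := ⟨hadj.1 (by push_cast at h1; linarith), hwv⟩
      obtain ⟨z, hz⟩ := hPne _ n (hcells n x).1 ((ε (code x n)).symm ⟨v, h2⟩)
      refine ⟨z, ?_⟩
      rw [hchildcode x n _ z hz, Equiv.apply_symm_apply]
  refine ⟨S, ⟨fun i => ⟨?_, hT.isTree.isAcyclic.induce _⟩, hnested, hfin, ?_, ?_, ?_⟩, ?_⟩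
  · have hreach : ∀ x (hx : x ∈ K i) n, (T.induce (S i)).Reachable ⟨code x 0, x, hx, 0, rfl⟩
        ⟨code x n, x, hx, n, rfl⟩ := by
      intro x hx n
      induction n with
      | zero => exact SimpleGraph.Reachable.refl _
      | succ n ih =>
        refine ih.trans (SimpleGraph.Adj.reachable ?_)
        exact (hchild x n).1
    have hne : Nonempty (S i) := by
      obtain ⟨x, hx⟩ := hKne i
      exact ⟨⟨_, x, hx, 0, rfl⟩⟩
    refine ⟨?_⟩
    rintro ⟨_, x, hx, n, rfl⟩ ⟨_, y, hy, m, rfl⟩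
    exact (hreach x hx n).symm.trans (hreach y hy m)
  · rintro i _ ⟨x, hx, n, rfl⟩
    obtain ⟨a, b, c, hab, hac, hbc, ha, hb, hc⟩ := hP3 _ n (hcells n x).1 i ⟨x, (hcells n x).2, hx⟩
    have hinj : Function.Injective fun m => (ε (code x n) m : V) := fun m m' hm =>
      (ε (code x n)).injective (Subtype.ext hm)
    have hsub : ({(ε (code x n) a : V), (ε (code x n) b : V), (ε (code x n) c : V)} : Set V) ⊆
        T.neighborSet (code x n) ∩ S i := by
      rintro w (rfl | rfl | rfl)
      · exact hmeet i x n a ha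
      · exact hmeet i x n b hb
      · exact hmeet i x n c hc
    have h3 := Set.ncard_le_ncard hsub (hfin i _ ⟨x, hx, n, rfl⟩)
    rwa [Set.ncard_eq_three.2 ⟨_, _, _, hinj.ne hab, hinj.ne hac, hinj.ne hbc, rfl⟩] at h3
  · rintro i _ ⟨x, hx, n, rfl⟩
    obtain ⟨m, hm, hm'⟩ := hPnew _ n (hcells n x).1 i ⟨x, (hcells n x).2, hx⟩
    refine Set.ncard_lt_ncard ⟨inter_subset_inter_right _ (hnested i), fun hsub => ?_⟩
      (hfin (i + 1) _ (hnested i ⟨x, hx, n, rfl⟩))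
    obtain ⟨-, y, hy, k, hk⟩ := hsub (hmeet (i + 1) x n m hm)
    obtain ⟨z, hz, -⟩ := hm
    have hkn : k = n + 1 := hlev y k z (n + 1) (hk.trans (hchildcode x n m z hz).symm)
    subst hkn
    exact hm'.subset ⟨hchildcell x n m y hk, hy⟩
  · have key : ∀ v w, T.Adj v w → Betw u v w → ∃ i, v ∈ S i ∧ w ∈ S i := by
      intro v w hvw hb
      obtain ⟨n, hn⟩ := hV.exists_nat u v
      have hw := dist_of_mem_children hT.isTree hdist (show w ∈ children T u v from ⟨hvw, hb⟩)
      obtain ⟨x, hx⟩ := hsurj (n + 1) w (by rw [hw, hn]; push_cast; rfl)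
      obtain ⟨i, hi⟩ := h.exhausts x
      refine ⟨i, ⟨x, hi, n, ?_⟩, x, hi, n + 1, hx⟩
      exact hV.unique (hx ▸ (hray x).betw (Nat.le_succ n)) hb (by rw [hlevel, hn])
    intro v w hvw
    rcases betw_or_betw_of_adj hT.isTree hdist u hvw with hb | hb
    · exact key v w hvw hb
    · exact (key w v hvw.symm hb).imp fun i hi => hi.symm
  · choose Φ hΦ using fun x => hV.exists_rayTo_eq u (hray x)
    have hcomp : hV.rayTo u ∘ Φ = code := funext hΦ
    have hemb : IsEmbedding Φ := by
      refine ⟨(hV.isInducing_rayTo u).of_comp_iff.1 (hcomp ▸ hcode_ind), fun x y hxy => hcode_inj ?_⟩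
      rw [← hΦ, ← hΦ, hxy]
    have hrange : range Φ = ⋃ i, boundaryOf (S i) := by
      apply subset_antisymm
      · rintro _ ⟨x, rfl⟩
        obtain ⟨i, hi⟩ := h.exhausts x
        refine mem_iUnion.2 ⟨i, code x, fun n => ⟨x, hi, n, rfl⟩, ?_⟩
        rw [hV.represents_iff u, hΦ]
        exact (hray x).tendsTo
      · refine iUnion_subset fun i => ?_
        rintro ξ ⟨s, hs, hsξ⟩
        rw [hV.represents_iff u] at hsξ
        have hrξ := hV.rayTo_isRayFrom u ξ
        -- A sequence in tree `i` approximates its limit by prefixes of codes of `K i`. The codes of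
        -- `K i` form a compact set, so the limit is itself a code.
        have hclosed : IsClosed (code '' K i) := ((h.isCompact i).image hcode_ind.continuous).isClosed
        have hmem : hV.rayTo u ξ ∈ code '' K i := by
          rw [← hclosed.closure_eq, mem_closure_iff_prefix]
          intro k
          obtain ⟨n, hn⟩ := (hsξ k).exists
          obtain ⟨z, hz, m, hzm⟩ := hs n
          refine ⟨code z, ⟨z, hz, rfl⟩, fun j hj => ?_⟩
          rw [← hzm] at hn
          have h1 : dist u (hV.rayTo u ξ k) + dist (hV.rayTo u ξ k) (code z m) = dist u (code z m) := hn
          rw [hrξ.dist_base, hlevel] at h1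
          have hkm : k ≤ m := by
            have : (k : ℝ) ≤ m := by linarith [dist_nonneg (x := hV.rayTo u ξ k) (y := code z m)]
            exact_mod_cast this
          exact hV.ray_eq_of_le (hray z) hrξ hj.le
            (hV.ray_eq_of_betw (hray z) hrξ ((hray z).betw hkm) hn)
        obtain ⟨z, -, hz⟩ := hmem
        exact ⟨z, hV.rayTo_injective u ((hΦ z).trans hz)⟩
    exact ⟨hemb.toHomeomorph.trans (Homeomorph.setCongr hrange)⟩

end Coding

section Conclusion

variable {G Y V : Type*} [Group G] [MetricSpace Y] [MulAction G Y] [MetricSpace V] [MulAction G V]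

/-! ### The Morse boundary as a Cantor chain -/

theorem boundaryMap_injective {κ : ℝ → ℝ} {o : Y} {p : Y → V} (h : KappaInjective κ o p) :
    Function.Injective (boundaryMap h) := by
  intro ξ η he
  obtain ⟨α, rfl⟩ := Quot.exists_rep ξ
  obtain ⟨β, rfl⟩ := Quot.exists_rep η
  have hα : DefinesPoint (p ∘ α.1) (boundaryMap h (Quot.mk _ α)) := (h.definesPoint α).choose_spec
  have hβ : DefinesPoint (p ∘ β.1) (boundaryMap h (Quot.mk _ β)) := (h.definesPoint β).choose_spec
  exact Quot.sound ((h.close_iff α β).2 ⟨_, hα, he ▸ hβ⟩)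

theorem IsLevelFinite.closure_of [DiscreteTopology V] {Z : Set (ℕ → V)}
    (hZ : ∀ k, ((fun r => r k) '' Z).Finite) : IsLevelFinite (closure Z) := by
  refine ⟨isClosed_closure, fun k => (hZ k).subset ?_⟩
  rintro _ ⟨r, hr, rfl⟩
  obtain ⟨z, hz, hzr⟩ := mem_closure_iff_prefix.1 hr (k + 1)
  exact ⟨z, hz, hzr k (Nat.lt_succ_self k)⟩

/-- A set of ends has an exhaustion by perfect sets, each nowhere dense in the next one. -/
theorem IsEndSet.exists_isExhausted {T : SimpleGraph V} {u : V} {I : Set (ℕ → V)}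
    {C : ℕ → Set (ℕ → V)} (h : IsEndSet T u I C) :
    ∃ K : ℕ → Set I, IsExhausted (fun n (x : I) => x.1 n) K := by
  have := h.treeMetric.discreteTopology
  obtain ⟨X, hX, hX0, hXm, hXI, hXp, hXn⟩ := h.exists_exhaustion
  have hsub : ∀ i, X i ⊆ I := fun i => hXI ▸ subset_iUnion X i
  refine ⟨fun i => Subtype.val ⁻¹' X i, ⟨fun n s => ?_, fun {i k x y} hik hk => ?_, fun x U hU hx => ?_,
    fun {x y} hne => ?_, fun i => ?_, fun i => ?_, ?_, fun i j hij => preimage_mono (hXm hij), fun x => ?_,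
    fun i x hx n => ?_, fun i x hx n => ?_⟩⟩
  · exact (isClopen_discrete s).preimage ((continuous_apply n).comp continuous_subtype_val)
  · exact h.eq_of_le x.2 y.2 hik hk
  · obtain ⟨O, hO, rfl⟩ := isOpen_induced_iff.1 hU
    obtain ⟨_, ⟨z, n, rfl⟩, hxz, hzO⟩ :=
      (PiNat.isTopologicalBasis_cylinders (fun _ => V)).exists_subset_of_mem_open hx hO
    exact ⟨n, fun y hy => hzO fun i hi => (h.eq_of_le y.2 x.2 hi.le hy).trans (hxz i hi)⟩
  · exact Function.ne_iff.1 fun hc => hne (Subtype.ext hc)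
  · exact (hX i).isClosed.preimage continuous_subtype_val
  · exact (IsInducing.subtypeVal.isCompact_preimage_iff (by rw [Subtype.range_coe]; exact hsub i)).2
      (hX i).isCompact
  · obtain ⟨x, hx⟩ := hX0
    exact ⟨⟨x, hsub 0 hx⟩, hx⟩
  · have hxI : x.1 ∈ ⋃ i, X i := hXI ▸ x.2
    obtain ⟨i, hi⟩ := mem_iUnion.1 hxI
    exact ⟨i, hi⟩
  · obtain ⟨y, hy, hyx, hyn⟩ := hXp i x hx n
    exact ⟨⟨y, hsub i hy⟩, hy, fun hc => hyx (congrArg Subtype.val hc), hyn⟩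
  · obtain ⟨y, hy, hyx, hyn⟩ := hXn i x hx n
    exact ⟨⟨y, hsub (i + 1) hy⟩, hy, hyx, hyn⟩

/-- If there are Morse ends behind every vertex and countably many gauges suffice, then the Morse
ends form a set to which the exhaustion applies. -/
theorem MorseSetting.isEndSet {κ : ℝ → ℝ} {o : Y} {p : Y → V} (h : MorseSetting G κ o p)
    {T : SimpleGraph V} (hT : IsCountablyInfiniteValenceTree T)
    (hdist : ∀ u v : V, dist u v = (T.dist u v : ℝ)) {N : ℕ → ℝ → ℝ → ℝ≥0}
    (hN : (⋃ i, stratum κ o (N i)) = univ) (hdense : ∀ v, ∃ r ∈ h.ends, ∃ n, r n = v) :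
    ∃ C, IsEndSet T (p o) h.ends C := by
  have := h.tree.discreteTopology
  obtain ⟨M, hM⟩ := h.exists_cover hN
  choose r hr n hrn using hdense
  have hunc : ¬ h.ends.Countable := by
    set w := (hT.infinite (p o)).natEmbedding with hw
    -- Ends through three different neighbours of `p o` are different at level one.
    refine h.not_countable_ends hM (R := fun j : Fin 3 => r (w j)) (fun j => hr _) fun i j hij => ?_
    have hlev : ∀ j : Fin 3, n (w j) = 1 := by
      intro j
      have h1 := (h.isRayFrom_of_mem_ends (hr (w j))).dist_base (n (w j))
      rw [hrn, (dist_eq_one_iff hT.isTree hdist).2 (w j).2] at h1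
      exact_mod_cast h1.symm
    have h1 := hrn (w i)
    have h2 := hrn (w j)
    rw [hlev] at h1 h2
    have h3 : r (w i) = r (w j) := hij
    rw [h3, h2] at h1
    exact Fin.ext (w.injective (Subtype.ext h1.symm))
  refine ⟨fun j => closure (endsOf (gaugeOf κ) o p (M j)), hT, hdist, fun r hr => h.isRayFrom_of_mem_ends hr,
    fun j => IsLevelFinite.closure_of (h.finite_level_endsOf (M j)), subset_antisymm ?_ ?_,
    h.not_countable_shadow hM hunc fun v => ⟨r v, hr v, n v, hrn v⟩⟩
  · rw [hM]
    exact iUnion_mono fun j => subset_closure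
  · refine iUnion_subset fun j => ?_
    obtain ⟨M₁, hM₁⟩ := h.exists_closure_subset (M j)
    exact hM₁.trans (h.endsOf_subset M₁)

end Conclusion

end CantorChain

/-! ### The theorem -/

theorem mainTheorem7 {G Y V : Type*} [Group G] [Group.FG G]
    -- a geodesic space `Y` with base point `o` and a geometric action of `G`
    [MetricSpace Y] [MulAction G Y] (hY : CantorChain.IsGeodesicSpace Y)
    (hGY : CantorChain.IsGeometricAction G Y) (o : Y)
    -- the tree `T` of countably infinite valence, with a cobounded action of `G`
    [MetricSpace V] [MulAction G V] (T : SimpleGraph V)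
    (hT : CantorChain.IsCountablyInfiniteValenceTree T)
    (hdist : ∀ u v : V, dist u v = (T.dist u v : ℝ))
    (hGT : CantorChain.IsCoboundedAction G V)
    -- the sublinear function and the projection
    (κ : ℝ → ℝ) (hκ : CantorChain.IsSublinear κ)
    (p : Y → V) (hp : CantorChain.IsProjection G p)
    (hinj : CantorChain.KappaInjective κ o p)
    -- the Morse gauges
    (N : ℕ → ℝ → ℝ → NNReal)
    (hN : ∀ (i : ℕ) (K C : ℝ), 1 ≤ K → 0 ≤ C → N i K C ≤ N (i + 1) K C)
    (hchain : CantorChain.IsStronglyEntwinedFillingChain T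
      (fun i => CantorChain.geodesicHull
        (CantorChain.boundaryMap hinj '' CantorChain.stratum κ o (N i))))
    (hunion : (⋃ i, CantorChain.stratum κ o (N i)) = Set.univ) :
    @CantorChain.IsCantorChain V _ T (CantorChain.KappaBoundary κ o)
      (CantorChain.projectionTopology hinj) := by
  open CantorChain in
  have hV := isTreeMetric hT.isTree hdist
  have hpos : 0 < κ 1 := by
    refine lt_of_le_of_ne (hκ.nonneg 1 zero_le_one) fun h0 => ?_
    have := subsingleton_kappaBoundary hκ h0.symm o
    obtain ⟨⟨v, hv⟩⟩ := (hchain.isTree 0).connected.nonempty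
    rw [geodesicHull_eq_empty hV (Set.subsingleton_of_subsingleton.image _)] at hv
    exact hv
  have h : MorseSetting G κ o p := ⟨hY, hGY, hV, hGT, hκ, hpos, hp, hinj⟩
  have hdense : ∀ v, ∃ r ∈ h.ends, ∃ n, r n = v := by
    intro v
    obtain ⟨w, hw⟩ := (hT.infinite v).nonempty
    obtain ⟨i, hv, -⟩ := hchain.filling v w hw
    obtain ⟨_, ⟨ξ, -, rfl⟩, n, hn⟩ := exists_end_of_mem_geodesicHull hV (p o) hv
    exact ⟨_, ⟨ξ, rfl⟩, n, hn⟩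
  obtain ⟨C, hC⟩ := h.isEndSet hT hdist hunion hdense
  obtain ⟨K, hK⟩ := hC.exists_isExhausted
  have := countable_of_tree hT
  obtain ⟨S, hS, ⟨e⟩⟩ := hK.exists_chain hT hdist
  let _ := projectionTopology hinj
  -- The pulled-back topology makes `∂p` inducing, and so is the passage from boundary points to
  -- rays; the Morse boundary is thus homeomorphic to the set of ends.
  have hemb : IsEmbedding fun ξ => h.tree.rayTo (p o) (boundaryMap h.inj ξ) :=
    ⟨(h.tree.isInducing_rayTo (p o)).comp ⟨rfl⟩,
      (h.tree.rayTo_injective (p o)).comp (boundaryMap_injective h.inj)⟩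
  exact ⟨S, hS, ⟨hemb.toHomeomorph.trans e⟩⟩
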